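/- **Setting.** Let $\mathcal A$ (actions) and $\mathcal E$ (percepts) be non-empty finite sets. A real function $f$ is *estimable* if there is a computable rational-valued $\phi$ with $|f(x)-\phi(x,k)|<1/k$ for all $x$ in the domain of $f$ and all $k\ge 1$. Each percept $e$ carries a reward $r(e)\in[0,1]$ that is an estimable real. Discounts $\gamma_t\ge 0$ with $\sum_t\gamma_t<\infty$ are given such that $\Gamma_t=\sum_{i\ge t}\gamma_i$ is estimable as a function of $t$. A policy $\pi$ gives $\pi(\cdot\mid h)\in\Delta\mathcal A$ for every history $h\in(\mathcal A\times\mathcal E)^*$; an environment $\nu$ gives $\nu(\cdot\mid ha)\in\Delta\mathcal E$ for $a\in\mathcal A$ and $h$ in a set of histories, its domain, that contains the empty history and, with $h$, every $hae$ with $\nu(e\mid ha)>0$. Write $\pi(a_{\le t}\|e_{\le t})$ and $\nu(e_{\le t}\|a_{\le t})$ for the products of the conditionals along a history. A *dominant element* of a class of policies (of environments) is a member $\zeta$ of the class such that for every member $\pi$ there is $c>0$ with $\zeta(\cdot\|\cdot)\ge c\,\pi(\cdot\|\cdot)$ on all histories. **Reflective oracles.** Let $\Sigma$ be a finite alphabet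 and let $B\subseteq\Sigma$ be partitioned into types. An oracle is a function $O_\alpha(T,x,p)\in[0,1]$ of probabilistic oracle machines $T$, strings $x\in\Sigma^*$, rationals $p\in[0,1]$ and symbols $\alpha\in B$; it answers a query by $1$ with this probability, independently each time. Let $\lambda^O_T(\alpha\mid x)$ be the probability that $T$ with oracle $O$ outputs $\alpha$ on input $x$. $O$ is *typed reflective* if for all $T,x$ there are $q_\alpha$ ($\alpha\in B$) with $\sum q_\alpha=1$ over each type, $\lambda^O_T(\alpha\mid x)\le q_\alpha\le 1-\sum_{\beta\ne\alpha}\lambda^O_T(\beta\mid x)$ (sum over the type of $\alpha$), and $O_\alpha(T,x,p)=1$ for $p<q_\alpha$, $O_\alpha(T,x,p)=0$ for $p>q_\alpha$; it is *reflective* if this holds with all of $B$ as a single type. The (unique) $q_\alpha$ are written $\bar\lambda^O_T(\alpha\mid x)$. Actions and percepts are encoded by words over $\Sigma$, each of the two codes being prefix-free; $\langle h\rangle$ is the concatenation of the codewords along $h$. For conditionals $f(s\mid x)$ of symbols put $f(w\mid x)=\prod_j f(w_j\mid xw_{<j})$. Let $\mathcal P^O_{\rm refl}$ be the set of policies $\pi$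 for which some $T$ satisfies $\pi(a\mid h)=\lambda^O_T(\langle a\rangle\mid\langle h\rangle)$ for all $h,a$. If $B=\Sigma$, let $\mathcal M^O_{\rm refl}$ be the set of environments $\nu$ for which some $T$ satisfies $\nu(e\mid ha)=\bar\lambda^O_T(\langle e\rangle\mid\langle h\rangle\langle a\rangle)$ for all $e$, $a$ and all $h$ in the domain of $\nu$. **Self-AIXI.** After a history $h$ of $t-1$ steps let $$V^\zeta_\xi(ha_t)=\frac1{\Gamma_t}\lim_{m\to\infty}\sum_{a_{t+1:m},\,e_{t:m}}\Big(\sum_{i=t}^m\gamma_i\,r(e_i)\Big)\prod_{j=t}^m\xi(e_j\mid h_{<j}a_j)\prod_{j=t+1}^m\zeta(a_j\mid h_{<j}),$$ where $h_{<j}=h\,a_te_t\cdots a_{j-1}e_{j-1}$ (and the value is $0$ if $\Gamma_t=0$). A policy $\pi_S$ is a *stochastic Self-AIXI policy for $\zeta,\xi$* if for every $h$ in the domain of $\xi$ these limits exist and $\pi_S(\cdot\mid h)$ is supported on $\arg\max_{a\in\mathcal A}V^\zeta_\xi(ha)$. **Theorem.** 1. Let $O$ be a reflective oracle with input alphabet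 $\Sigma=\mathcal A\sqcup\mathcal E$ and output alphabet $B=\mathcal A$, actions and percepts being encoded by single symbols. Let $\mathcal M$ be a class of environments that has a dominant element $\xi$ whose conditionals are estimable. Then $\mathcal P^O_{\rm refl}$ has a dominant element, and for every dominant element $\zeta$ of $\mathcal P^O_{\rm refl}$ there is a stochastic Self-AIXI policy $\pi_S\in\mathcal P^O_{\rm refl}$ for $\zeta,\xi$. 2. Let $\Sigma$ be a finite alphabet with types and with prefix-free encodings of $\mathcal A$ by words over the symbols of one type and of $\mathcal E$ by words over the symbols of one type (for example $\Sigma=\mathcal A\sqcup\mathcal E$ with the types $\mathcal A$ and $\mathcal E$ and single-symbol encodings). Let $O$ be a typed reflective oracle with input and output alphabet $\Sigma$, and let $\xi$ be a dominant element of $\mathcal M^O_{\rm refl}$. Then $\mathcal P^O_{\rm refl}$ has a dominant element, and for every dominant element $\zeta$ of $\mathcal P^O_{\rm refl}$ there is a stochastic Self-AIXI policy $\pi_S\in\mathcal P^O_{\rm refl}$ for $\zeta,\xi$. -/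

import Mathlib

open Filter Topology
open scoped BigOperators

namespace ReflOracle

/-! ### Probabilistic oracle machines -/

/-- Machines are finite program descriptions; Mathlib's codes of partial recursive functions are
used as the (effectively enumerated) set of descriptions. -/
abbrev Machine : Type := Nat.Partrec.Code

/-- An oracle query `(T, x, (m, d), b)`: machine, input string, a rational written as a
numerator and a denominator, and an output symbol. -/
abbrev Query (S B : Type*) : Type _ := Machine × List S × (ℕ × ℕ) × B

/-- What a machine does when its deterministic computation pauses: read a random bit
(continuing in the first configuration on `1` and in the second on `0`), query the oracle
(continuing in the first configuration on answer `1` and in the second on `0`), or halt with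
one symbol on the output tape. -/
abbrev Move (S B : Type*) : Type _ := (ℕ × ℕ) ⊕ ((Query S B × ℕ × ℕ) ⊕ S)

/-- An oracle `O` with input alphabet `S` and output alphabet `B`: `O T x p b` is the probability
that the answer to the query `(T, x, p, b)` is `1`. -/
abbrev Oracle (S B : Type*) : Type _ :=
  Machine → List S → Set.Icc (0 : ℚ) 1 → B → Set.Icc (0 : ℝ) 1

/-- The rational in `[0,1]` written as `m / d` (clamped at `1`, and `0` if `d = 0`). -/
def readRat (m d : ℕ) : Set.Icc (0 : ℚ) 1 :=
  ⟨min ((m : ℚ) / d) 1, le_min (by positivity) zero_le_one, min_le_right _ _⟩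

section Machines

variable {S B : Type*} [Primcodable S] [Primcodable B]

open Classical in
/-- The next move of `T` in the configuration with code `c`: the program `T` is run on `c`.
There is none if this computation diverges or its result is not the code of a move. -/
noncomputable def nextMove (S B : Type*) [Primcodable S] [Primcodable B]
    (T : Machine) (c : ℕ) : Option (Move S B) :=
  (T.eval c).toOption.bind Encodable.decode

open Classical in
/-- The probability that `T` with oracle `O`, started in configuration `c`, halts with output `s`
after fewer than `n` coin tosses and oracle calls, all of them being independent. -/
noncomputable def outputProbWithin (O : Oracle S B) (T : Machine) (s : S) : ℕ → ℕ → ℝ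
  | 0, _ => 0
  | n + 1, c =>
    match nextMove S B T c with
    | none => 0
    | some (Sum.inl (c₁, c₀)) =>
        1 / 2 * outputProbWithin O T s n c₁ + 1 / 2 * outputProbWithin O T s n c₀
    | some (Sum.inr (Sum.inl ((T', x, (m, d), b), c₁, c₀))) =>
        (O T' x (readRat m d) b : ℝ) * outputProbWithin O T s n c₁
          + (1 - (O T' x (readRat m d) b : ℝ)) * outputProbWithin O T s n c₀
    | some (Sum.inr (Sum.inr s')) => if s' = s then 1 else 0

/-- `λ_T^O(s | x)`: the probability that `T` with oracle `O`, started on the input string `x`,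
halts with output `s`. -/
noncomputable def outputProb (O : Oracle S B) (T : Machine) (x : List S) (s : S) : ℝ :=
  ⨆ n, outputProbWithin O T s n (Encodable.encode x)

theorem outputProbWithin_mem (O : Oracle S B) (T : Machine) (s : S) (n c : ℕ) :
    outputProbWithin O T s n c ∈ Set.Icc (0 : ℝ) 1 := by
  induction n generalizing c with
  | zero => simp [outputProbWithin]
  | succ n ih =>
    rw [outputProbWithin]
    split
    · simp
    · next c₁ c₀ _ =>
      obtain ⟨h1, h2⟩ := ih c₁
      obtain ⟨h3, h4⟩ := ih c₀
      constructor <;> linarith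
    · next T' x m d b c₁ c₀ _ =>
      obtain ⟨h1, h2⟩ := ih c₁
      obtain ⟨h3, h4⟩ := ih c₀
      obtain ⟨h5, h6⟩ := (O T' x (readRat m d) b).2
      constructor <;> nlinarith
    · split <;> simp

theorem outputProbWithin_mono (O : Oracle S B) (T : Machine) (s : S) (c : ℕ) :
    Monotone fun n => outputProbWithin O T s n c := by
  refine monotone_nat_of_le_succ fun n => ?_
  induction n generalizing c with
  | zero => exact (outputProbWithin_mem O T s 1 c).1
  | succ n ih =>
    rw [outputProbWithin, outputProbWithin]
    split
    · simp
    · next c₁ c₀ _ => linarith [ih c₁, ih c₀]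
    · next T' x m d b c₁ c₀ _ =>
      obtain ⟨h5, h6⟩ := (O T' x (readRat m d) b).2
      have := mul_le_mul_of_nonneg_left (ih c₁) h5
      have := mul_le_mul_of_nonneg_left (ih c₀) (sub_nonneg.2 h6)
      linarith
    · exact le_rfl

/-- The supremum in `outputProb` is the limit over the number of random events. -/
theorem tendsto_outputProbWithin (O : Oracle S B) (T : Machine) (x : List S) (s : S) :
    Tendsto (fun n => outputProbWithin O T s n (Encodable.encode x)) atTop
      (𝓝 (outputProb O T x s)) :=
  tendsto_atTop_ciSup (outputProbWithin_mono O T s _)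
    ⟨1, by rintro _ ⟨n, rfl⟩; exact (outputProbWithin_mem O T s n _).2⟩

open Classical in
/-- `q` is the completion `λ̄_T^O(· | x)`. Output symbols `b : B` are written by machines as
`emb b : S`, and they are sorted into types by `ty`; on the symbols of each type, `q` is a
probability vector that extends `λ_T^O(· | x)` and at which the answers of `O` switch. -/
def IsCompletion [Fintype B] {I : Type*} (emb : B → S) (ty : B → I) (O : Oracle S B)
    (T : Machine) (x : List S) (q : B → ℝ) : Prop :=
  (∀ b, ∑ b' with ty b' = ty b, q b' = 1) ∧
  (∀ b, outputProb O T x (emb b) ≤ q b ∧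
    q b ≤ 1 - ∑ b' with b' ≠ b ∧ ty b' = ty b, outputProb O T x (emb b')) ∧
  ∀ (b : B) (p : Set.Icc (0 : ℚ) 1),
    (((p : ℚ) : ℝ) < q b → (O T x p b : ℝ) = 1) ∧ (q b < ((p : ℚ) : ℝ) → (O T x p b : ℝ) = 0)

/-- Typed reflective oracles. -/
def IsTypedReflective [Fintype B] {I : Type*} (emb : B → S) (ty : B → I)
    (O : Oracle S B) : Prop :=
  ∀ (T : Machine) (x : List S), ∃ q : B → ℝ, IsCompletion emb ty O T x q

/-- (Untyped) reflective oracles: all output symbols have the same type. -/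
def IsReflective [Fintype B] (emb : B → S) (O : Oracle S B) : Prop :=
  IsTypedReflective emb (fun _ : B => ()) O

end Machines

/-- `f` is estimable on `D`: some computable rational-valued `φ(x,k)` (its values written as
`z / (d + 1)`) satisfies `|f(x) - φ(x,k)| < 1/k` for all `x ∈ D` and `k ≥ 1`. -/
def EstimableOn {X : Type*} [Primcodable X] (f : X → ℝ) (D : Set X) : Prop :=
  ∃ φ : X → ℕ → ℤ × ℕ, Computable₂ φ ∧
    ∀ x ∈ D, ∀ k : ℕ, 1 ≤ k →
      |f x - ((φ x k).1 : ℝ) / (((φ x k).2 : ℝ) + 1)| < 1 / (k : ℝ)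

/-! ### Policies and environments -/

/-- Interaction histories `a₁e₁…aₙeₙ`. -/
abbrev History (A E : Type*) : Type _ := List (A × E)

/-- Policies (strategies), given by the conditionals `π(a | h)`. -/
structure Policy (A E : Type*) [Fintype A] where
  prob : History A E → A → ℝ
  nonneg : ∀ h a, 0 ≤ prob h a
  sum_eq_one : ∀ h, ∑ a, prob h a = 1

/-- `π(a₁…aₙ || e₁…eₙ)` for the history `h = a₁e₁…aₙeₙ`. -/
noncomputable def Policy.joint {A E : Type*} [Fintype A] (π : Policy A E)
    (h : History A E) : ℝ :=
  ∏ k : Fin h.length, π.prob (h.take k) (h.get k).1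

/-- Environments, given by the conditionals `ν(e | h a)` on a set `dom` of histories `h` on which
they are specified. It must contain the empty history and be closed under continuations of positive
probability; in particular it contains each history of positive probability. The values of
`prob h` for `h ∉ dom` are irrelevant. -/
structure Environment (A E : Type*) [Fintype E] where
  dom : Set (History A E)
  prob : History A E → A → E → ℝ
  nil_mem : [] ∈ dom
  step_mem : ∀ h ∈ dom, ∀ a e, 0 < prob h a e → h ++ [(a, e)] ∈ dom
  nonneg : ∀ h ∈ dom, ∀ a e, 0 ≤ prob h a e
  sum_eq_one : ∀ h ∈ dom, ∀ a, ∑ e, prob h a e = 1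

/-- `ν(e₁…eₙ || a₁…aₙ)` for the history `h = a₁e₁…aₙeₙ`. -/
noncomputable def Environment.joint {A E : Type*} [Fintype E] (ν : Environment A E)
    (h : History A E) : ℝ :=
  ∏ k : Fin h.length, ν.prob (h.take k) (h.get k).1 (h.get k).2

/-- The conditionals of `ν` are estimable (wherever they are specified). -/
def Environment.HasEstimableConditionals {A E : Type*} [Fintype E] [Primcodable A] [Primcodable E]
    (ν : Environment A E) : Prop :=
  EstimableOn (fun y : History A E × A × E => ν.prob y.1 y.2.1 y.2.2) {y | y.1 ∈ ν.dom}

/-- `ζ` is a dominant element of the class `P` of policies. -/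
def IsDominantPolicy {A E : Type*} [Fintype A] (P : Set (Policy A E)) (ζ : Policy A E) : Prop :=
  ζ ∈ P ∧ ∀ π ∈ P, ∃ c : ℝ, 0 < c ∧ ∀ h, c * π.joint h ≤ ζ.joint h

/-- `ξ` is a dominant element of the class `M` of environments. -/
def IsDominantEnvironment {A E : Type*} [Fintype E] (M : Set (Environment A E))
    (ξ : Environment A E) : Prop :=
  ξ ∈ M ∧ ∀ ν ∈ M, ∃ c : ℝ, 0 < c ∧ ∀ h, c * ν.joint h ≤ ξ.joint h

/-! ### Encodings and the reflective-oracle computable classes -/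

/-- Encodings of actions and percepts by strings over the alphabet `S`; both codes are
prefix-free, so that histories are decodable symbol by symbol. -/
structure Coding (A E S : Type*) where
  act : A → List S
  per : E → List S
  act_prefixFree : ∀ a a', act a <+: act a' → a = a'
  per_prefixFree : ∀ e e', per e <+: per e' → e = e'

/-- The string `⟨a₁⟩⟨e₁⟩…⟨aₙ⟩⟨eₙ⟩`. -/
def Coding.hist {A E S : Type*} (C : Coding A E S) (h : History A E) : List S :=
  h.flatMap fun y => C.act y.1 ++ C.per y.2

/-- The encoding by single symbols over `A ⊔ E`. -/
def Coding.single (A E : Type*) : Coding A E (A ⊕ E) where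
  act a := [Sum.inl a]
  per e := [Sum.inr e]
  act_prefixFree a a' h := by simpa using h
  per_prefixFree e e' h := by simpa using h

/-- The probability of producing the word `w` after `x`, one symbol at a time, given the
conditionals `f x s` of symbols `s` after strings `x`. For a word of one symbol `s` this is
`f x s`. -/
noncomputable def wordProb {S : Type*} (f : List S → S → ℝ) (x w : List S) : ℝ :=
  ∏ j : Fin w.length, f (x ++ w.take j) (w.get j)

/-- `P_refl^O`: the policies sampled by some machine with oracle `O`. -/
def reflPolicies {A E S B : Type*} [Fintype A] [Primcodable S] [Primcodable B]
    (C : Coding A E S) (O : Oracle S B) : Set (Policy A E) :=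
  {π | ∃ T : Machine, ∀ h a, π.prob h a = wordProb (outputProb O T) (C.hist h) (C.act a)}

/-- `M_refl^O`: the environments `λ̄_T^O` obtained by completing some machine by the typed
oracle `O`, whose output alphabet is the whole alphabet `S`. -/
def reflEnvironments {A E S I : Type*} [Fintype E] [Fintype S] [Primcodable S]
    (C : Coding A E S) (ty : S → I) (O : Oracle S S) : Set (Environment A E) :=
  {ν | ∃ (T : Machine) (q : List S → S → ℝ), (∀ x, IsCompletion id ty O T x (q x)) ∧
    ∀ h ∈ ν.dom, ∀ a e, ν.prob h a e = wordProb q (C.hist h ++ C.act a) (C.per e)}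

/-! ### Values and Self-AIXI policies -/

/-- `Γ_t`, where `γ t` is the discount of the step taken after a history of length `t`
(steps are counted from `0`). -/
noncomputable def discountNorm (γ : ℕ → ℝ) (t : ℕ) : ℝ := ∑' k, γ (t + k)

/-- The expected discounted reward sum over the steps `h.length, …, h.length + m`, when action `a`
is taken after `h` and later actions are drawn from `ζ`; it is a sum over the later actions `b` and
the percepts `e`. -/
noncomputable def expectedReturn {A E : Type*} [Fintype A] [Fintype E] (γ : ℕ → ℝ) (r : E → ℝ)
    (ζ : Policy A E) (ξ : Environment A E) (h : History A E) (a : A) (m : ℕ) : ℝ :=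
  ∑ b : Fin m → A, ∑ e : Fin (m + 1) → E,
    let act : Fin (m + 1) → A := Fin.cons a b
    let w : History A E := List.ofFn fun i => (act i, e i)
    (∑ i : Fin (m + 1), γ (h.length + i) * r (e i))
      * (∏ i : Fin (m + 1), ξ.prob (h ++ w.take i) (act i) (e i))
      * ∏ i : Fin m, ζ.prob (h ++ w.take (i + 1)) (b i)

/-- `v` is the action value `V_ξ^ζ(h a)`. -/
def IsActionValue {A E : Type*} [Fintype A] [Fintype E] (γ : ℕ → ℝ) (r : E → ℝ)
    (ζ : Policy A E) (ξ : Environment A E) (h : History A E) (a : A) (v : ℝ) : Prop :=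
  Tendsto (fun m => (discountNorm γ h.length)⁻¹ * expectedReturn γ r ζ ξ h a m) atTop (𝓝 v)

/-- `π` is a (stochastic) Self-AIXI policy for `ζ`, `ξ`: after each history, `π` only takes actions
that maximize the (existing) action value `V_ξ^ζ(h a)`. -/
def IsSelfAIXI {A E : Type*} [Fintype A] [Fintype E] (γ : ℕ → ℝ) (r : E → ℝ)
    (ζ : Policy A E) (ξ : Environment A E) (π : Policy A E) : Prop :=
  ∀ h ∈ ξ.dom, ∃ V : A → ℝ, (∀ a, IsActionValue γ r ζ ξ h a (V a)) ∧
    ∀ a, 0 < π.prob h a → ∀ a', V a' ≤ V a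

end ReflOracle

open ReflOracle

/-! The basic device is a computable description of a number p in [0,1] for which the oracle answers
comparisons of p with rationals correctly, except possibly at p itself (`Param`, `IsParam`).
Bisection turns such a description into a coin of bias exactly p (`rejNext_test`), and a bad answer
at a tie does no harm. Completed probabilities are described by the oracle's own queries
(`IsCompletion.isParam`). Quotients of estimable functions are described by queries about a machine
that searches for a certificate of a strict inequality (`exists_ratioParam`). Rejection sampling
then yields machines that sample from conditional distributions built out of such coins
(`exists_rejectionSampler`).

Dominant policy: mix the completions of all machines T with weights that decay in the code of T. The
completions may leave the set of code words, so the mixture only satisfies Σ_a mixture(ha) ≤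
mixture(h). Normalizing at each step can only increase it and gives a policy that dominates every T.
A rejection sampler produces it symbol by symbol (`exists_mixtureMachine`, `exists_dominantPolicy`).

Self-AIXI: with ρ = Γ_{t+1}/Γ_t, the value solves V(ha) = Σ_e ξ(e|ha) ((1-ρ) r(e) + ρ Σ_a' ζ(a'|hae)
V(hae a')). By the recursion theorem there is a machine that samples the right-hand side, with its
own completion in place of V. It queries this completion and does not simulate it, so there is no
infinite regress. It halts almost surely with one of two symbols of one type, so its completion
equals its output probability (`IsCompletion.eq_outputProb`) and solves the equation. A solution
with 0 ≤ Γ_t V ≤ Γ_t is unique, because Γ tends to 0 (`exists_valueMachine`,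
`tendsto_expectedReturn_of_bellman`).

To compare V(a) with V(b), one asks whether ½V(a) + ½(1 - V(b)) exceeds ½. The answer is reliable
unless the values agree, and then either action will do. A tournament of such comparisons therefore
ends at a maximizer (`exists_comparison`, `exists_greedyPolicy`). For codes of several symbols it is
replayed after each symbol among the actions still possible. The two parts of the theorem differ
only in how the conditionals of ξ are turned into coins. -/

namespace ReflOracle

/-! ### Typed state machines -/

/-- A move of a machine with states `σ`. -/
abbrev StateMove (S B σ : Type*) : Type _ := (σ × σ) ⊕ ((Query S B × σ × σ) ⊕ S)

section Compile

variable {S B : Type*}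

/-- The move with the states replaced by configurations. -/
def StateMove.code {σ : Type*} (f : σ → ℕ) : StateMove S B σ → Move S B
  | Sum.inl (u, v) => Sum.inl (f u, f v)
  | Sum.inr (Sum.inl (Q, u, v)) => Sum.inr (Sum.inl (Q, f u, f v))
  | Sum.inr (Sum.inr s) => Sum.inr (Sum.inr s)

/-- The probability of the answer `1` to a query. -/
noncomputable def answer (O : Oracle S B) (Q : Query S B) : ℝ :=
  O Q.1 Q.2.1 (readRat Q.2.2.1.1 Q.2.2.1.2) Q.2.2.2

theorem answer_mem (O : Oracle S B) (Q : Query S B) : answer O Q ∈ Set.Icc (0 : ℝ) 1 :=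
  (O _ _ _ _).2

open Classical in
/-- The expectation of `F` after a move, where halting with `s` counts as `1` and halting with
another symbol as `0`. -/
noncomputable def moveValue {σ : Type*} (O : Oracle S B) (s : S) (F : σ → ℝ) :
    StateMove S B σ → ℝ
  | Sum.inl (u, v) => 1 / 2 * F u + 1 / 2 * F v
  | Sum.inr (Sum.inl (Q, u, v)) => answer O Q * F u + (1 - answer O Q) * F v
  | Sum.inr (Sum.inr s') => if s' = s then 1 else 0

variable [Primcodable S] [Primcodable B]

/-- The probability of the output `s` from configuration `c`. -/
noncomputable def outputFrom (O : Oracle S B) (T : Machine) (s : S) (c : ℕ) : ℝ :=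
  ⨆ n, outputProbWithin O T s n c

theorem tendsto_outputFrom (O : Oracle S B) (T : Machine) (s : S) (c : ℕ) :
    Tendsto (fun n => outputProbWithin O T s n c) atTop (𝓝 (outputFrom O T s c)) :=
  tendsto_atTop_ciSup (outputProbWithin_mono O T s _)
    ⟨1, by rintro _ ⟨n, rfl⟩; exact (outputProbWithin_mem O T s n _).2⟩

theorem outputFrom_mem (O : Oracle S B) (T : Machine) (s : S) (c : ℕ) :
    outputFrom O T s c ∈ Set.Icc (0 : ℝ) 1 :=
  isClosed_Icc.mem_of_tendsto (tendsto_outputFrom O T s c)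
    (Eventually.of_forall fun n => outputProbWithin_mem O T s n c)

/-- The recursion in the number of random events passes to the limit. From here on, output
probabilities enter only as bounded solutions of this one-step equation. -/
theorem outputFrom_eq {σ : Type*} (O : Oracle S B) (T : Machine) (s : S) (c : ℕ) (f : σ → ℕ)
    (m : StateMove S B σ) (h : nextMove S B T c = some (m.code f)) :
    outputFrom O T s c = moveValue O s (fun u => outputFrom O T s (f u)) m := by
  have h1 := (tendsto_add_atTop_iff_nat 1).2 (tendsto_outputFrom O T s c)
  refine tendsto_nhds_unique h1 ?_
  simp only [outputProbWithin, h]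
  rcases m with ⟨u, v⟩ | ⟨⟨T', x, ⟨m, d⟩, b⟩, u, v⟩ | s'
  · exact ((tendsto_outputFrom O T s _).const_mul _).add ((tendsto_outputFrom O T s _).const_mul _)
  · exact ((tendsto_outputFrom O T s _).const_mul _).add ((tendsto_outputFrom O T s _).const_mul _)
  · exact tendsto_const_nhds

theorem outputProb_mem (O : Oracle S B) (T : Machine) (x : List S) (s : S) :
    outputProb O T x s ∈ Set.Icc (0 : ℝ) 1 :=
  outputFrom_mem O T s _

theorem StateMove.computable_code {α σ : Type*} [Primcodable α] [Primcodable σ] {f : σ → ℕ}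
    (hf : Computable f) {m : α → StateMove S B σ} (hm : Computable m) :
    Computable fun a => (m a).code f := by
  have : Computable fun a => (Sum.casesOn (m a) (fun p => Sum.inl (f p.1, f p.2))
      (fun q => Sum.casesOn q (fun p => Sum.inr (Sum.inl (p.1, f p.2.1, f p.2.2)))
        fun s => Sum.inr (Sum.inr s)) : Move S B) := by
    refine Computable.sumCasesOn hm ?_ ?_
    · exact Computable.sumInl.comp (.pair (hf.comp (Computable.fst.comp .snd))
        (hf.comp (Computable.snd.comp .snd)))
    · refine Computable.sumCasesOn (f := fun p : α × ((Query S B × σ × σ) ⊕ S) => p.2) .snd ?_ ?_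
      · refine Computable.sumInr.comp (Computable.sumInl.comp (.pair ?_ (.pair (hf.comp ?_)
          (hf.comp ?_))))
        · exact Computable.fst.comp .snd
        · exact Computable.fst.comp (Computable.snd.comp .snd)
        · exact Computable.snd.comp (Computable.snd.comp .snd)
      · exact Computable.sumInr.comp (Computable.sumInr.comp .snd)
  refine this.of_eq fun a => ?_
  rcases m a with ⟨u, v⟩ | ⟨Q, u, v⟩ | s' <;> rfl

/-- Every effective typed state machine, which may refer to its own program and to a parameter,
is realized by a program. -/
theorem exists_machine [Finite S] {Z σ : Type*} [Primcodable Z] [Primcodable σ]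
    (start : Machine × Z × List S →. StateMove S B σ) (hstart : Partrec start)
    (next : Machine × Z × σ → StateMove S B σ) (hnext : Computable next) :
    ∃ c : Machine, ∀ (O : Oracle S B) (z : Z) (s : S), ∃ F : σ → ℝ,
      (∀ u, F u ∈ Set.Icc (0 : ℝ) 1) ∧
      (∀ u, F u = moveValue O s F (next (c, z, u))) ∧
      ∀ x, ∀ m ∈ start (c, z, x),
        outputProb O (c.curry (Encodable.encode z)) x s = moveValue O s F m := by
  -- States must not be confused with input strings. A nonempty string is encoded as the successor
  -- of a pair that begins with the code of its first symbol, which is below K. The empty string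
  -- yields 0. Hence the tag K marks states only.
  obtain ⟨K, hK0, hK⟩ : ∃ K : ℕ, 0 < K ∧ ∀ s : S, Encodable.encode s < K := by
    obtain ⟨M, hM⟩ := (Set.finite_range (Encodable.encode : S → ℕ)).bddAbove
    exact ⟨M + 1, M.succ_pos, fun s => Nat.lt_succ_of_le (hM ⟨s, rfl⟩)⟩
  let cfg : σ → ℕ := fun u => Nat.pair K (Encodable.encode u) + 1
  have hcfg : Computable cfg :=
    (Primrec.succ.comp (Primrec₂.natPair.comp (Primrec.const K) Primrec.encode)).to_comp
  let inp : ℕ → Option (List S ⊕ σ) := fun n =>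
    if n.pred.unpair.1 = K then (Encodable.decode n.pred.unpair.2).map Sum.inr
    else (Encodable.decode n).map Sum.inl
  have hunp : Primrec fun n : ℕ => n.pred.unpair := Primrec.unpair.comp Primrec.pred
  have hinp : Computable inp := by
    refine (Primrec.ite (Primrec.eq.comp (Primrec.fst.comp hunp) (.const K)) ?_ ?_).to_comp
    · exact Primrec.option_map (Primrec.decode.comp (Primrec.snd.comp hunp))
        (Primrec.sumInr.comp .snd)
    · exact Primrec.option_map Primrec.decode (Primrec.sumInl.comp .snd)
  have inp_cfg : ∀ u, inp (cfg u) = some (Sum.inr u) := fun u => by simp [inp, cfg]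
  have inp_str : ∀ x : List S, inp (Encodable.encode x) = some (Sum.inl x) := fun x => by
    have : (Encodable.encode x - 1).unpair.1 ≠ K := by
      cases x with
      | nil => simpa using hK0.ne
      | cons a l => simpa using (hK a).ne
    simp [inp, this]
  let run : Machine → Z → List S ⊕ σ →. ℕ := fun c z w =>
    Sum.casesOn w (fun x => (start (c, z, x)).map fun m => Encodable.encode (m.code cfg))
      fun u => Part.some (Encodable.encode ((next (c, z, u)).code cfg))
  have hrun : Partrec fun p : Machine × Z × (List S ⊕ σ) => run p.1 p.2.1 p.2.2 := by
    refine Partrec.sumCasesOn_left (f := fun p : Machine × Z × (List S ⊕ σ) => p.2.2)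
      (g := fun p x => (start (p.1, p.2.1, x)).map fun m => Encodable.encode (m.code cfg))
      (h := fun p u => Encodable.encode ((next (p.1, p.2.1, u)).code cfg))
      (Computable.snd.comp .snd) ?_ ?_
    · refine Partrec.map (hstart.comp (.pair (Computable.fst.comp .fst)
        (.pair (Computable.fst.comp (Computable.snd.comp .fst)) .snd))) ?_
      exact Computable.encode.comp (StateMove.computable_code hcfg .snd)
    · exact Computable.encode.comp (StateMove.computable_code hcfg
        (hnext.comp (.pair (Computable.fst.comp .fst)
          (.pair (Computable.fst.comp (Computable.snd.comp .fst)) .snd))))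
  let prog : Machine → ℕ →. ℕ := fun c n =>
    (Part.ofOption (Encodable.decode (α := Z) n.unpair.1)).bind fun z =>
      (Part.ofOption (inp n.unpair.2)).bind fun w => run c z w
  have hprog : Partrec₂ prog := by
    have hu : Computable fun p : Machine × ℕ => p.2.unpair := Computable.unpair.comp .snd
    have h1 : Partrec fun p : Machine × ℕ =>
        (Part.ofOption (Encodable.decode (α := Z) p.2.unpair.1) : Part Z) :=
      Computable.ofOption (Computable.decode.comp (Computable.fst.comp hu))
    have h2 : Partrec fun p : (Machine × ℕ) × Z => Part.ofOption (inp p.1.2.unpair.2) :=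
      Computable.ofOption (hinp.comp (Computable.snd.comp (hu.comp .fst)))
    have h3 : Partrec₂ fun (p : (Machine × ℕ) × Z) (w : List S ⊕ σ) => run p.1.1 p.2 w :=
      Partrec.comp (g := fun q : ((Machine × ℕ) × Z) × (List S ⊕ σ) => (q.1.1.1, q.1.2, q.2)) hrun
        (.pair (Computable.fst.comp (Computable.fst.comp .fst))
          (.pair (Computable.snd.comp .fst) .snd))
    exact Partrec.bind h1 (Partrec.to₂ (h2.bind h3))
  -- The recursion theorem: c has access to its own code. The parameter z is supplied separately
  -- through `curry`, so that c can also form the codes of its siblings with other parameters.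
  obtain ⟨c, hc⟩ := Nat.Partrec.Code.fixed_point₂ hprog
  have key : ∀ (z : Z) (k : ℕ) (w : List S ⊕ σ), inp k = some w →
      (c.curry (Encodable.encode z)).eval k = run c z w := by
    intro z k w hw
    rw [Nat.Partrec.Code.eval_curry, hc]
    simp [prog, hw]
  have move : ∀ (z : Z) (k : ℕ) (w : List S ⊕ σ) (m : StateMove S B σ), inp k = some w →
      run c z w = Part.some (Encodable.encode (m.code cfg)) →
      nextMove S B (c.curry (Encodable.encode z)) k = some (m.code cfg) := by
    intro z k w m hw hm
    rw [nextMove, key z k w hw]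
    simp [hm, -Encodable.decode_sum_val]
  refine ⟨c, fun O z s => ⟨fun u => outputFrom O (c.curry (Encodable.encode z)) s (cfg u),
    fun u => outputFrom_mem _ _ _ _, fun u => ?_, fun x m hm => ?_⟩⟩
  · exact outputFrom_eq O _ s _ cfg _ (move z _ _ _ (inp_cfg u) rfl)
  · refine outputFrom_eq O _ s _ cfg _ (move z _ _ _ (inp_str x) ?_)
    simp only [run]
    rw [Part.eq_some_iff.2 hm, Part.map_some]

end Compile

/-! ### Tests with prescribed success probabilities -/

section Tests

/-- A description of a number in `[0,1]`: the completed probability of `b` for the machine `T` on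
input `x`, or the number `θ` such that the machine with code `c` and parameters `y, m, d` decides
between `m / d < θ` (output `b`) and `θ < m / d`. -/
abbrev Param (S B : Type*) : Type _ := (Machine × List S × B) ⊕ (Machine × ℕ × B)

/-- The query that compares the described number with `m / d`. -/
def Param.query {S B : Type*} : Param S B → ℕ × ℕ → Query S B
  | Sum.inl (T, x, b), p => (T, x, p, b)
  | Sum.inr (c, y, b), p => (c.curry (Nat.pair y (Nat.pair p.1 p.2)), [], (1, 2), b)

/-- A test: a fair coin, or an event whose probability is the described number (`true`) or its
complement (`false`). -/
abbrev Test (S B : Type*) : Type _ := Option (Param S B × Bool)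

variable {S B : Type*}

/-- `θ` describes the number `p` with respect to the oracle `O`. -/
def IsParam (O : Oracle S B) (θ : Param S B) (p : ℝ) : Prop :=
  0 ≤ p ∧ p ≤ 1 ∧ ∀ m d : ℕ, 0 < d → m ≤ d →
    ((m : ℝ) / d < p → answer O (θ.query (m, d)) = 1) ∧
    (p < (m : ℝ) / d → answer O (θ.query (m, d)) = 0)

/-- Independent trials of the tests in `l` all succeed with probability `p`. -/
inductive Pass (O : Oracle S B) : List (Test S B) → ℝ → Prop
  | nil : Pass O [] 1
  | coin {l p} : Pass O l p → Pass O (none :: l) (1 / 2 * p)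
  | pos {l p θ r} : IsParam O θ r → Pass O l p → Pass O (some (θ, true) :: l) (r * p)
  | neg {l p θ r} : IsParam O θ r → Pass O l p → Pass O (some (θ, false) :: l) ((1 - r) * p)

theorem Pass.append {O : Oracle S B} {l l' : List (Test S B)} {p p' : ℝ} (h : Pass O l p)
    (h' : Pass O l' p') : Pass O (l ++ l') (p * p') := by
  induction h with
  | nil => simpa using h'
  | coin _ ih => rw [mul_assoc]; exact ih.coin
  | pos hr _ ih => rw [mul_assoc]; exact ih.pos hr
  | neg hr _ ih => rw [mul_assoc]; exact ih.neg hr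

theorem Pass.nonneg {O : Oracle S B} {l : List (Test S B)} {p : ℝ} (h : Pass O l p) : 0 ≤ p := by
  induction h with
  | nil => norm_num
  | coin _ ih => positivity
  | pos hr _ ih => exact mul_nonneg hr.1 ih
  | neg hr _ ih => exact mul_nonneg (sub_nonneg.2 hr.2.1) ih

theorem Pass.le_one {O : Oracle S B} {l : List (Test S B)} {p : ℝ} (h : Pass O l p) : p ≤ 1 := by
  induction h with
  | nil => norm_num
  | coin _ ih => linarith
  | pos hr h ih => exact mul_le_one₀ hr.2.1 h.nonneg ih
  | neg hr h ih => exact mul_le_one₀ (by linarith [hr.1]) h.nonneg ih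

theorem Pass.coins (O : Oracle S B) (n : ℕ) :
    Pass O ((List.range n).map fun _ => none) ((1 / 2) ^ n) := by
  have : ∀ l : List ℕ, Pass O (l.map fun _ => none) ((1 / 2) ^ l.length) := by
    intro l
    induction l with
    | nil => exact Pass.nil
    | cons a l ih => rw [List.map_cons, List.length_cons, pow_succ']; exact ih.coin
  simpa using this (List.range n)

theorem Pass.map {O : Oracle S B} {ι : Type*} (l : List ι) (f : ι → Param S B) (r : ι → ℝ)
    (h : ∀ i ∈ l, IsParam O (f i) (r i)) :
    Pass O (l.map fun i => some (f i, true)) (l.map r).prod := by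
  induction l with
  | nil => exact Pass.nil
  | cons a l ih =>
    rw [List.map_cons, List.map_cons, List.prod_cons]
    exact (ih fun i hi => h i (List.mem_cons_of_mem _ hi)).pos (h a List.mem_cons_self)

theorem readRat_coe {m d : ℕ} (hd : 0 < d) (h : m ≤ d) :
    (((readRat m d : Set.Icc (0 : ℚ) 1) : ℚ) : ℝ) = (m : ℝ) / d := by
  have h1 : (m : ℚ) / d ≤ 1 := (div_le_one (by exact_mod_cast hd)).2 (by exact_mod_cast h)
  simp [readRat, min_eq_left h1]

end Tests

/-! ### Rejection sampling -/

section Rejection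

variable {S B X : Type*}

/-- States of the rejection sampler: about to accept or skip the `v`-th candidate, or running the
remaining tests `l` of the `v`-th candidate, where the next test is decided by comparing the
remaining binary digits. -/
abbrev RejState (S B X : Type*) : Type _ :=
  (X × ℕ) ⊕ (X × ℕ × List (Test S B) × ℕ × ℕ × Option Bool)

/-- The moves of the rejection sampler. -/
def rejNext (tests : X × ℕ → List (Test S B)) (res : X × ℕ → Option S) :
    RejState S B X → StateMove S B (RejState S B X)
  | Sum.inl (x, v) =>
      Sum.inl (Sum.inr (x, v, tests (x, v), 0, 1, none), Sum.inl (x, v + 1))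
  | Sum.inr (x, v, l, m, d, ph) =>
    match l.head? with
    | none =>
      match res (x, v) with
      | none => Sum.inl (Sum.inl (x, 0), Sum.inl (x, 0))
      | some s => Sum.inr (Sum.inr s)
    | some none => Sum.inl (Sum.inr (x, v, l.tail, 0, 1, none), Sum.inl (x, 0))
    | some (some (θ, fl)) =>
      match ph with
      | none => Sum.inl (Sum.inr (x, v, l, m, d, some true), Sum.inr (x, v, l, m, d, some false))
      | some true => Sum.inr (Sum.inl (θ.query (2 * m + 1, 2 * d),
          bif fl then Sum.inr (x, v, l.tail, 0, 1, none) else Sum.inl (x, 0),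
          bif fl then Sum.inl (x, 0) else Sum.inr (x, v, l.tail, 0, 1, none)))
      | some false => Sum.inr (Sum.inl (θ.query (2 * m + 1, 2 * d),
          Sum.inr (x, v, l, 2 * m + 1, 2 * d, none), Sum.inr (x, v, l, 2 * m, 2 * d, none)))

variable {tests : X × ℕ → List (Test S B)} {res : X × ℕ → Option S} {O : Oracle S B} {s : S}
  {F : RejState S B X → ℝ}

/-- The state (m, d) means that success is still wanted with probability t = dp - m. Half of the
time the sampler decides at once whether t > 1/2. Otherwise it continues with 2t - 1 or 2t,
according to the answer. Each round halves the error of any bounded solution `F`, so `F` has the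
claimed value. -/
theorem rejNext_test (hF01 : ∀ u, F u ∈ Set.Icc (0 : ℝ) 1)
    (hF : ∀ u, F u = moveValue O s F (rejNext tests res u)) {θ : Param S B} {p : ℝ}
    (hp : IsParam O θ p) (x : X) (v : ℕ) (fl : Bool) (l : List (Test S B)) :
    F (Sum.inr (x, v, some (θ, fl) :: l, 0, 1, none)) =
      p * F (bif fl then Sum.inr (x, v, l, 0, 1, none) else Sum.inl (x, 0)) +
      (1 - p) * F (bif fl then Sum.inl (x, 0) else Sum.inr (x, v, l, 0, 1, none)) := by
  set a := F (bif fl then Sum.inr (x, v, l, 0, 1, none) else Sum.inl (x, 0)) with ha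
  set b := F (bif fl then Sum.inl (x, 0) else Sum.inr (x, v, l, 0, 1, none)) with hb
  have ha01 : a ∈ Set.Icc (0 : ℝ) 1 := hF01 _
  have hb01 : b ∈ Set.Icc (0 : ℝ) 1 := hF01 _
  have key : ∀ N m d : ℕ, m < d → 0 ≤ d * p - m → d * p - m ≤ 1 →
      |F (Sum.inr (x, v, some (θ, fl) :: l, m, d, none)) -
        ((d * p - m) * a + (1 - (d * p - m)) * b)| ≤ (1 / 2) ^ N := by
    intro N
    induction N with
    | zero =>
      intro m d _ h0 h1
      obtain ⟨h2, h3⟩ := hF01 (Sum.inr (x, v, some (θ, fl) :: l, m, d, none))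
      obtain ⟨h4, h5⟩ := ha01
      obtain ⟨h6, h7⟩ := hb01
      rw [pow_zero, abs_le]
      constructor <;> nlinarith
    | succ N ih =>
      intro m d hmd h0 h1
      have hd : 0 < d := by omega
      have hd' : (0 : ℝ) < d := by exact_mod_cast hd
      have e0 := hF (Sum.inr (x, v, some (θ, fl) :: l, m, d, none))
      have e1 := hF (Sum.inr (x, v, some (θ, fl) :: l, m, d, some true))
      have e2 := hF (Sum.inr (x, v, some (θ, fl) :: l, m, d, some false))
      simp only [rejNext, List.head?_cons, List.tail_cons, moveValue] at e0 e1 e2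
      rw [← ha, ← hb] at e1
      obtain ⟨hc1, hc0⟩ := hp.2.2 (2 * m + 1) (2 * d) (by omega) (by omega)
      rw [div_lt_iff₀ (by positivity)] at hc1
      rw [lt_div_iff₀ (by positivity)] at hc0
      have i1 := ih (2 * m + 1) (2 * d) (by omega)
      have i0 := ih (2 * m) (2 * d) (by omega)
      obtain ⟨r0, r1⟩ := answer_mem O (θ.query (2 * m + 1, 2 * d))
      set ρ := answer O (θ.query (2 * m + 1, 2 * d))
      push_cast at hc1 hc0 i1 i0
      rw [e0, e1, e2, pow_succ']
      set f1 := F (Sum.inr (x, v, some (θ, fl) :: l, 2 * m + 1, 2 * d, none))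
      set f0 := F (Sum.inr (x, v, some (θ, fl) :: l, 2 * m, 2 * d, none))
      -- This identity holds for every answer probability ρ, because both phases ask the same query.
      -- It reduces the error at t to the errors at 2t - 1 and 2t.
      have split : ∀ t : ℝ, 1 / 2 * (ρ * a + (1 - ρ) * b) + 1 / 2 * (ρ * f1 + (1 - ρ) * f0) -
          (t * a + (1 - t) * b) =
          1 / 2 * (ρ * (f1 - ((2 * t - 1) * a + (1 - (2 * t - 1)) * b)) +
            (1 - ρ) * (f0 - (2 * t * a + (1 - 2 * t) * b))) := fun t => by ring
      rw [split, abs_mul, abs_of_pos (by norm_num : (0 : ℝ) < 1 / 2)]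
      refine mul_le_mul_of_nonneg_left ?_ (by norm_num)
      rw [show 2 * ((d : ℝ) * p - m) - 1 = 2 * d * p - (2 * m + 1) by ring,
        show 2 * ((d : ℝ) * p - m) = 2 * d * p - 2 * m by ring]
      rcases lt_trichotomy (2 * (m : ℝ) + 1) (p * (2 * d)) with h | h | h
      · rw [hc1 h]
        simpa using i1 (by linarith) (by linarith)
      -- At a tie nothing is known about ρ, but the residues 2t - 1 = 0 and 2t = 1 are both
      -- admissible, so both induction hypotheses apply.
      · refine (abs_add_le _ _).trans ?_
        rw [abs_mul, abs_mul, abs_of_nonneg r0, abs_of_nonneg (sub_nonneg.2 r1)]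
        have j1 := mul_le_mul_of_nonneg_left (i1 (by linarith) (by linarith)) r0
        have j0 := mul_le_mul_of_nonneg_left (i0 (by linarith) (by linarith)) (sub_nonneg.2 r1)
        linarith
      · rw [hc0 (by linarith)]
        simpa using i0 (by linarith) (by linarith)
  have hlim : Tendsto (fun N : ℕ => (1 / 2 : ℝ) ^ N) atTop (𝓝 0) :=
    tendsto_pow_atTop_nhds_zero_of_lt_one (by norm_num) (by norm_num)
  have := ge_of_tendsto' hlim fun N =>
    key N 0 1 one_pos (by simpa using hp.1) (by simpa using hp.2.1)
  have := abs_nonpos_iff.1 this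
  simp only [Nat.cast_one, Nat.cast_zero, one_mul, sub_zero] at this
  linarith

-- Every failed test returns to the state (x, 0). Relative to the value of that state, each passed
-- test therefore just multiplies by its probability. A candidate without a result is rejected as
-- well and contributes 0.
open Classical in
theorem rejNext_run (hF01 : ∀ u, F u ∈ Set.Icc (0 : ℝ) 1)
    (hF : ∀ u, F u = moveValue O s F (rejNext tests res u)) (x : X) (v : ℕ)
    {l : List (Test S B)} {p : ℝ} (hp : Pass O l p) :
    F (Sum.inr (x, v, l, 0, 1, none)) - F (Sum.inl (x, 0)) =
      p * ((if res (x, v) = some s then 1 else 0) -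
        (if (res (x, v)).isSome then 1 else 0) * F (Sum.inl (x, 0))) := by
  induction hp with
  | nil =>
    rw [hF (Sum.inr (x, v, [], 0, 1, none))]
    simp only [rejNext, List.head?_nil]
    cases h : res (x, v) with
    | none => simp only [moveValue]; simp; ring
    | some s' => simp only [moveValue]; simp
  | coin hl ih =>
    rw [hF (Sum.inr (x, v, none :: _, 0, 1, none))]
    simp only [rejNext, List.head?_cons, List.tail_cons, moveValue]
    linear_combination (1 / 2) * ih
  | pos hr hl ih =>
    rw [rejNext_test hF01 hF hr]
    simp only [cond_true]
    linear_combination _ * ih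
  | neg hr hl ih =>
    rw [rejNext_test hF01 hF hr]
    simp only [cond_false]
    linear_combination (1 - _) * ih

-- Candidate v is tried with probability 2^(-(v+1)), and the values at (x, v) telescope. Solved for
-- `F` at (x, 0), the identity says that the output is distributed as the result conditioned on
-- acceptance. Written as a vanishing sum, it needs no division by the acceptance probability.
open Classical in
theorem rejNext_hasSum (hF01 : ∀ u, F u ∈ Set.Icc (0 : ℝ) 1)
    (hF : ∀ u, F u = moveValue O s F (rejNext tests res u)) (x : X) (P : ℕ → ℝ)
    (hP : ∀ v, Pass O (tests (x, v)) (P v)) :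
    HasSum (fun v => (1 / 2 : ℝ) ^ (v + 1) * (P v * ((if res (x, v) = some s then 1 else 0) -
        (if (res (x, v)).isSome then 1 else 0) * F (Sum.inl (x, 0))))) 0 := by
  have hstep : ∀ v, F (Sum.inl (x, v)) =
      1 / 2 * F (Sum.inr (x, v, tests (x, v), 0, 1, none)) + 1 / 2 * F (Sum.inl (x, v + 1)) :=
    fun v => by rw [hF (Sum.inl (x, v))]; simp only [rejNext, moveValue]
  have hpart : ∀ N, ∑ v ∈ Finset.range N, (1 / 2 : ℝ) ^ (v + 1) *
      (F (Sum.inr (x, v, tests (x, v), 0, 1, none)) - F (Sum.inl (x, 0))) =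
      (1 / 2) ^ N * (F (Sum.inl (x, 0)) - F (Sum.inl (x, N))) := by
    intro N
    induction N with
    | zero => simp
    | succ N ih =>
      rw [Finset.sum_range_succ, ih]
      linear_combination -(1 / 2) ^ N * hstep N
  have hb : ∀ v, |F (Sum.inr (x, v, tests (x, v), 0, 1, none)) - F (Sum.inl (x, 0))| ≤ 1 := by
    intro v
    obtain ⟨h1, h2⟩ := hF01 (Sum.inr (x, v, tests (x, v), 0, 1, none))
    obtain ⟨h3, h4⟩ := hF01 (Sum.inl (x, 0))
    rw [abs_le]; constructor <;> linarith
  have hgeo : Summable fun v : ℕ => (1 / 2 : ℝ) ^ (v + 1) :=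
    (summable_nat_add_iff 1).2 summable_geometric_two
  have hsum : Summable fun v => (1 / 2 : ℝ) ^ (v + 1) *
      (F (Sum.inr (x, v, tests (x, v), 0, 1, none)) - F (Sum.inl (x, 0))) := by
    refine Summable.of_norm_bounded hgeo fun v => ?_
    rw [Real.norm_eq_abs, abs_mul, abs_of_pos (by positivity)]
    exact mul_le_of_le_one_right (by positivity) (hb v)
  have hlim : Tendsto (fun N : ℕ => (1 / 2 : ℝ) ^ N *
      (F (Sum.inl (x, 0)) - F (Sum.inl (x, N)))) atTop (𝓝 0) := by
    have h0 : Tendsto (fun N : ℕ => (1 / 2 : ℝ) ^ N) atTop (𝓝 0) :=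
      tendsto_pow_atTop_nhds_zero_of_lt_one (by norm_num) (by norm_num)
    refine squeeze_zero_norm (fun N => ?_) h0
    obtain ⟨h1, h2⟩ := hF01 (Sum.inl (x, N))
    obtain ⟨h3, h4⟩ := hF01 (Sum.inl (x, 0))
    rw [Real.norm_eq_abs, abs_mul, abs_of_pos (by positivity)]
    exact mul_le_of_le_one_right (by positivity) (abs_le.2 ⟨by linarith, by linarith⟩)
  have h0 := tendsto_nhds_unique hsum.hasSum.tendsto_sum_nat
    (hlim.congr fun N => (hpart N).symm)
  have := hsum.hasSum
  rw [h0] at this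
  refine this.congr_fun ?_
  intro v
  rw [rejNext_run hF01 hF x v (hP v)]

end Rejection

/-! ### Rejection sampling by oracle machines -/

section RejectionMachine

variable {S B : Type*} [Primcodable S] [Primcodable B]

theorem Param.computable_query : Computable₂ (Param.query : Param S B → ℕ × ℕ → Query S B) := by
  have h1 : Primrec₂ fun (q : Param S B × (ℕ × ℕ)) (t : Machine × List S × B) =>
      ((t.1, t.2.1, q.2, t.2.2) : Query S B) :=
    Primrec.pair (Primrec.fst.comp .snd) (.pair (Primrec.fst.comp (Primrec.snd.comp .snd))
      (.pair (Primrec.snd.comp .fst) (Primrec.snd.comp (Primrec.snd.comp .snd))))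
  have h2 : Primrec₂ fun (q : Param S B × (ℕ × ℕ)) (t : Machine × ℕ × B) =>
      ((t.1.curry (Nat.pair t.2.1 (Nat.pair q.2.1 q.2.2)), [], (1, 2), t.2.2) : Query S B) := by
    refine Primrec.pair (Nat.Partrec.Code.primrec₂_curry.comp (Primrec.fst.comp .snd)
      (Primrec₂.natPair.comp (Primrec.fst.comp (Primrec.snd.comp .snd))
        (Primrec₂.natPair.comp (Primrec.fst.comp (Primrec.snd.comp .fst))
          (Primrec.snd.comp (Primrec.snd.comp .fst))))) (.pair (.const _) (.pair (.const _)
            (Primrec.snd.comp (Primrec.snd.comp .snd))))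
  have h : Primrec fun q : Param S B × (ℕ × ℕ) => q.1.query q.2 := by
    refine (Primrec.sumCasesOn (f := fun q : Param S B × (ℕ × ℕ) => q.1) .fst h1 h2).of_eq ?_
    rintro ⟨⟨T, x, b⟩ | ⟨c, y, b⟩, p⟩ <;> rfl
  exact h.to_comp

instance instPrimcodableRejState {X : Type*} [Primcodable X] : Primcodable (RejState S B X) :=
  inferInstance

theorem computable_rejNext {X W : Type*} [Primcodable X] [Primcodable W]
    {tests : W → X × ℕ → List (Test S B)} {res : W → X × ℕ → Option S}
    (ht : Computable₂ tests) (hr : Computable₂ res) :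
    Computable₂ fun (w : W) (u : RejState S B X) => rejNext (tests w) (res w) u := by
  have hL : Computable₂ fun (q : W × RejState S B X) (t : X × ℕ) =>
      (Sum.inl (Sum.inr (t.1, t.2, tests q.1 t, 0, 1, none), Sum.inl (t.1, t.2 + 1)) :
        StateMove S B (RejState S B X)) := by
    have hx : Computable fun p : (W × RejState S B X) × (X × ℕ) => p.2.1 :=
      Computable.fst.comp .snd
    have hv : Computable fun p : (W × RejState S B X) × (X × ℕ) => p.2.2 :=
      Computable.snd.comp .snd
    have htt : Computable fun p : (W × RejState S B X) × (X × ℕ) => tests p.1.1 p.2 :=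
      ht.comp (Computable.fst.comp .fst) .snd
    exact Computable.sumInl.comp (.pair
      (Computable.sumInr.comp (.pair hx (.pair hv (.pair htt (.const (0, 1, none))))))
      (Computable.sumInl.comp (.pair hx (Computable.succ.comp hv))))
  have hR : Computable₂ fun (q : W × RejState S B X)
      (t : X × ℕ × List (Test S B) × ℕ × ℕ × Option Bool) =>
      rejNext (tests q.1) (res q.1) (Sum.inr t) := by
    let D := (W × RejState S B X) × (X × ℕ × List (Test S B) × ℕ × ℕ × Option Bool)
    have hw : Computable fun p : D => p.1.1 := Computable.fst.comp .fst
    have h2 : Computable fun p : D => p.2 := Computable.snd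
    have hx : Computable fun p : D => p.2.1 := Computable.fst.comp h2
    have hv : Computable fun p : D => p.2.2.1 := Computable.fst.comp (Computable.snd.comp h2)
    have h3 : Computable fun p : D => p.2.2.2 := Computable.snd.comp (Computable.snd.comp h2)
    have hl : Computable fun p : D => p.2.2.2.1 := Computable.fst.comp h3
    have hm : Computable fun p : D => p.2.2.2.2.1 := Computable.fst.comp (Computable.snd.comp h3)
    have hd : Computable fun p : D => p.2.2.2.2.2.1 :=
      Computable.fst.comp (Computable.snd.comp (Computable.snd.comp h3))
    have hph : Computable fun p : D => p.2.2.2.2.2.2 :=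
      Computable.snd.comp (Computable.snd.comp (Computable.snd.comp h3))
    have htl : Computable fun p : D => p.2.2.2.1.tail := Primrec.list_tail.to_comp.comp hl
    have hm2 : Computable fun p : D => 2 * p.2.2.2.2.1 :=
      (Primrec.nat_mul.comp (.const 2) .id).to_comp.comp hm
    have hd2 : Computable fun p : D => 2 * p.2.2.2.2.2.1 :=
      (Primrec.nat_mul.comp (.const 2) .id).to_comp.comp hd
    have hrun : ∀ {l : D → List (Test S B)} {m d : D → ℕ} {ph : D → Option Bool},
        Computable l → Computable m → Computable d → Computable ph → Computable fun p : D =>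
          (Sum.inr (p.2.1, p.2.2.1, l p, m p, d p, ph p) : RejState S B X) :=
      fun hl hm hd hph => Computable.sumInr.comp (.pair hx (.pair hv (.pair hl
        (.pair hm (.pair hd hph)))))
    have hfail : Computable fun p : D => (Sum.inl (p.2.1, 0) : RejState S B X) :=
      Computable.sumInl.comp (.pair hx (.const 0))
    have hsucc : Computable fun p : D =>
        (Sum.inr (p.2.1, p.2.2.1, p.2.2.2.1.tail, 0, 1, none) : RejState S B X) :=
      hrun htl (.const 0) (.const 1) (.const none)
    have g0 : Computable fun p : D => (Option.casesOn (res p.1.1 (p.2.1, p.2.2.1))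
        (Sum.inl (Sum.inl (p.2.1, 0), Sum.inl (p.2.1, 0))) fun s => Sum.inr (Sum.inr s) :
          StateMove S B (RejState S B X)) :=
      Computable.option_casesOn (hr.comp hw (.pair hx hv))
        (Computable.sumInl.comp (.pair hfail hfail))
        (Computable.sumInr.comp (Computable.sumInr.comp .snd))
    have g1 : Computable fun p : D => (Sum.inl (Sum.inr (p.2.1, p.2.2.1, p.2.2.2.1.tail, 0, 1, none),
        Sum.inl (p.2.1, 0)) : StateMove S B (RejState S B X)) :=
      Computable.sumInl.comp (.pair hsucc hfail)
    have g2 : Computable fun p : D => (Sum.inl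
        (Sum.inr (p.2.1, p.2.2.1, p.2.2.2.1, p.2.2.2.2.1, p.2.2.2.2.2.1, some true),
        Sum.inr (p.2.1, p.2.2.1, p.2.2.2.1, p.2.2.2.2.1, p.2.2.2.2.2.1, some false)) :
          StateMove S B (RejState S B X)) :=
      Computable.sumInl.comp (.pair (hrun hl hm hd (.const _)) (hrun hl hm hd (.const _)))
    let D' := D × (Param S B × Bool)
    have hq : Computable fun p : D' =>
        p.2.1.query (2 * p.1.2.2.2.2.1 + 1, 2 * p.1.2.2.2.2.2.1) :=
      Param.computable_query.comp (Computable.fst.comp .snd)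
        (.pair (Computable.succ.comp (hm2.comp .fst)) (hd2.comp .fst))
    have hfl : Computable fun p : D' => p.2.2 := Computable.snd.comp .snd
    have g3 : Computable fun p : D' => (Sum.inr (Sum.inl
        (p.2.1.query (2 * p.1.2.2.2.2.1 + 1, 2 * p.1.2.2.2.2.2.1),
          bif p.2.2 then Sum.inr (p.1.2.1, p.1.2.2.1, p.1.2.2.2.1.tail, 0, 1, none)
            else Sum.inl (p.1.2.1, 0),
          bif p.2.2 then Sum.inl (p.1.2.1, 0)
            else Sum.inr (p.1.2.1, p.1.2.2.1, p.1.2.2.2.1.tail, 0, 1, none))) :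
              StateMove S B (RejState S B X)) :=
      Computable.sumInr.comp (Computable.sumInl.comp (.pair hq (.pair
        (.cond hfl (hsucc.comp .fst) (hfail.comp .fst))
        (.cond hfl (hfail.comp .fst) (hsucc.comp .fst)))))
    have g4 : Computable fun p : D' => (Sum.inr (Sum.inl
        (p.2.1.query (2 * p.1.2.2.2.2.1 + 1, 2 * p.1.2.2.2.2.2.1),
          Sum.inr (p.1.2.1, p.1.2.2.1, p.1.2.2.2.1, 2 * p.1.2.2.2.2.1 + 1,
            2 * p.1.2.2.2.2.2.1, none),
          Sum.inr (p.1.2.1, p.1.2.2.1, p.1.2.2.2.1, 2 * p.1.2.2.2.2.1,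
            2 * p.1.2.2.2.2.2.1, none))) : StateMove S B (RejState S B X)) :=
      Computable.sumInr.comp (Computable.sumInl.comp (.pair hq (.pair
        ((hrun hl (Computable.succ.comp hm2) hd2 (.const _)).comp .fst)
        ((hrun hl hm2 hd2 (.const _)).comp .fst))))
    have g5 := Computable.option_casesOn (o := fun p : D' => p.1.2.2.2.2.2.2) (hph.comp .fst)
      (g2.comp .fst) (Computable.cond (c := fun p : D' × Bool => p.2) .snd (g3.comp .fst)
        (g4.comp .fst)).to₂
    have g6 := Computable.option_casesOn (o := fun p : D × Test S B => p.2) .snd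
      (g1.comp .fst) (g5.comp (g := fun p : (D × Test S B) × (Param S B × Bool) => (p.1.1, p.2))
        (.pair (Computable.fst.comp .fst) .snd)).to₂
    have g7 := Computable.option_casesOn (o := fun p : D => p.2.2.2.1.head?)
      (Primrec.list_head?.to_comp.comp hl) g0 g6.to₂
    refine g7.of_eq ?_
    rintro ⟨⟨w, _⟩, x, v, l, m, d, ph⟩
    rcases l with _ | ⟨_ | ⟨θ, fl⟩, l⟩
    · simp only [rejNext, List.head?_nil]
      cases res w (x, v) <;> rfl
    · rfl
    · rcases ph with _ | _ | _ <;> rfl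
  refine (Computable.sumCasesOn (f := fun q : W × RejState S B X => q.2) .snd hL hR).of_eq ?_
  rintro ⟨w, ⟨x, v⟩ | t⟩ <;> rfl

open Classical in
/-- A machine that repeatedly draws a candidate `y` with weight `2 ^ (-cost y)`, accepts it if all
its tests succeed, and then outputs the result for `y` (or rejects it if there is none). -/
theorem exists_rejectionSampler [Finite S] {X Y Z : Type*} [Primcodable X] [Primcodable Y]
    [Primcodable Z] {inp : List S →. X} (hinp : Partrec inp)
    {tests : Machine × Z × X × Y → List (Test S B)} (ht : Computable tests)
    {res : Machine × Z × X × Y → Option S} (hr : Computable res)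
    {cost : Y → ℕ} (hc : Computable cost) (hcost : ∀ y, Encodable.encode y ≤ cost y) :
    ∃ c : Machine, ∀ (O : Oracle S B) (z : Z) (x₀ : List S), ∀ x ∈ inp x₀, ∀ P : Y → ℝ,
      (∀ y, Pass O (tests (c, z, x, y)) (P y)) → ∀ s,
      HasSum (fun y => (1 / 2 : ℝ) ^ cost y * (P y * ((if res (c, z, x, y) = some s then 1 else 0) -
        (if (res (c, z, x, y)).isSome then 1 else 0) *
          outputProb O (c.curry (Encodable.encode z)) x₀ s))) 0 := by
  -- Several numbers might decode to the same y. Demanding v = encode y makes each y a candidate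
  -- exactly once.
  let cand : ℕ → Option Y := fun v =>
    (Encodable.decode v).bind fun y => if Encodable.encode y = v then some y else none
  have hcand : Computable cand :=
    (Primrec.option_bind Primrec.decode (Primrec.to₂ (Primrec.ite (Primrec.eq.comp
      (Primrec.encode.comp .snd) .fst) (Primrec.option_some.comp .snd) (.const none)))).to_comp
  have cand_encode : ∀ y, cand (Encodable.encode y) = some y := fun y => by simp [cand]
  have cand_range : ∀ v, v ∉ Set.range (Encodable.encode : Y → ℕ) → cand v = none := by
    intro v hv
    simp only [cand, Option.bind_eq_none_iff, ite_eq_right_iff, reduceCtorEq, imp_false]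
    exact fun y _ h => hv ⟨y, h⟩
  -- The index v = encode y already costs v + 1 coins. The extra coins bring the weight down to
  -- 2^(-(cost y + 1)), and the common factor 1/2 is removed at the end.
  let tests' : Machine × Z → X × ℕ → List (Test S B) := fun w xv =>
    Option.casesOn (cand xv.2) [] fun y =>
      ((List.range (cost y - xv.2)).map fun _ => none) ++ tests (w.1, w.2, xv.1, y)
  let res' : Machine × Z → X × ℕ → Option S := fun w xv =>
    (cand xv.2).bind fun y => res (w.1, w.2, xv.1, y)
  have hcand' : Computable fun p : (Machine × Z) × (X × ℕ) => cand p.2.2 :=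
    hcand.comp (Computable.snd.comp .snd)
  have harg : Computable fun p : ((Machine × Z) × (X × ℕ)) × Y =>
      (p.1.1.1, p.1.1.2, p.1.2.1, p.2) :=
    .pair (Computable.fst.comp (Computable.fst.comp .fst))
      (.pair (Computable.snd.comp (Computable.fst.comp .fst))
        (.pair (Computable.fst.comp (Computable.snd.comp .fst)) .snd))
  have ht' : Computable₂ tests' := by
    refine Computable.option_casesOn hcand' (.const []) ?_
    refine Computable.list_append.comp ?_ (ht.comp harg)
    exact (Primrec.list_map Primrec.list_range (.const none)).to_comp.comp
      (Primrec.nat_sub.to_comp.comp (hc.comp .snd)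
        (Computable.snd.comp (Computable.snd.comp .fst)))
  have hr' : Computable₂ res' := Computable.option_bind hcand' (hr.comp harg)
  obtain ⟨c, hcm⟩ := exists_machine (S := S) (B := B) (Z := Z) (σ := RejState S B X)
    -- A start has to be a move, so it is a coin toss whose two outcomes lead to the same state.
    (fun p => (inp p.2.2).map fun x => Sum.inl (Sum.inl (x, 0), Sum.inl (x, 0)))
    (Partrec.map (hinp.comp (Computable.snd.comp .snd)) (Computable.sumInl.comp (.pair
      (Computable.sumInl.comp (.pair .snd (.const 0)))
      (Computable.sumInl.comp (.pair .snd (.const 0))))))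
    (fun p => rejNext (tests' (p.1, p.2.1)) (res' (p.1, p.2.1)) p.2.2)
    ((computable_rejNext ht' hr').comp (.pair .fst (Computable.fst.comp .snd))
      (Computable.snd.comp .snd))
  refine ⟨c, fun O z x₀ x hx P hP s => ?_⟩
  obtain ⟨F, hF01, hF, hstart⟩ := hcm O z s
  have hout : outputProb O (c.curry (Encodable.encode z)) x₀ s = F (Sum.inl (x, 0)) := by
    rw [hstart x₀ _ (Part.mem_map _ hx)]
    simp only [moveValue]
    ring
  let P' : ℕ → ℝ := fun v => (cand v).elim 1 fun y => (1 / 2) ^ (cost y - v) * P y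
  have hP' : ∀ v, Pass O (tests' (c, z) (x, v)) (P' v) := by
    intro v
    simp only [tests', P']
    cases cand v with
    | none => exact Pass.nil
    | some y => exact (Pass.coins O _).append (hP y)
  have hsum := rejNext_hasSum (tests := tests' (c, z)) (res := res' (c, z)) hF01 hF x P' hP'
  rw [← (Encodable.encode_injective (α := Y)).hasSum_iff] at hsum
  · have h2 := hsum.mul_left 2
    rw [mul_zero] at h2
    refine h2.congr_fun fun y => ?_
    have e : (1 / 2 : ℝ) ^ cost y =
        (1 / 2) ^ Encodable.encode y * (1 / 2) ^ (cost y - Encodable.encode y) := by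
      rw [← pow_add, Nat.add_sub_cancel' (hcost y)]
    simp only [Function.comp, P', res', cand_encode, Option.elim, Option.bind_some, hout, e,
      pow_succ]
    ring
  · intro v hv
    simp [res', cand_range v hv]

end RejectionMachine

/-! ### Completions -/

section Completion

variable {S B I : Type*} [Primcodable S] [Primcodable B] [Fintype B] {emb : B → S} {ty : B → I}
  {O : Oracle S B} {T : Machine} {x : List S} {q : B → ℝ}

theorem IsCompletion.nonneg (h : IsCompletion emb ty O T x q) (b : B) : 0 ≤ q b :=
  (outputProb_mem O T x (emb b)).1.trans (h.2.1 b).1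

theorem IsCompletion.le_one (h : IsCompletion emb ty O T x q) (b : B) : q b ≤ 1 :=
  (h.2.1 b).2.trans (sub_le_self _ (Finset.sum_nonneg fun _ _ => (outputProb_mem O T x _).1))

theorem IsCompletion.isParam (h : IsCompletion emb ty O T x q) (b : B) :
    IsParam O (Sum.inl (T, x, b)) (q b) := by
  refine ⟨h.nonneg b, h.le_one b, fun m d hd hm => ?_⟩
  have := h.2.2 b (readRat m d)
  rwa [readRat_coe hd hm] at this

/-- If a machine outputs one of two symbols of the same type almost surely, then its completion
agrees with its output probability. -/
theorem IsCompletion.eq_outputProb (h : IsCompletion emb ty O T x q) {b b' : B} (hne : b' ≠ b)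
    (hty : ty b' = ty b)
    (hsum : outputProb O T x (emb b) + outputProb O T x (emb b') = 1) :
    q b = outputProb O T x (emb b) := by
  classical
  -- The bounds leave no room: λ(b) ≤ q b ≤ 1 - λ(b') = λ(b).
  refine le_antisymm ((h.2.1 b).2.trans ?_) (h.2.1 b).1
  have : outputProb O T x (emb b') ≤
      ∑ b'' with b'' ≠ b ∧ ty b'' = ty b, outputProb O T x (emb b'') :=
    Finset.single_le_sum (f := fun b'' => outputProb O T x (emb b''))
      (fun _ _ => (outputProb_mem O T x _).1) (by simp [hne, hty])
  convert sub_le_sub_left this 1 using 1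
  · congr
  · linarith

/-- A query at `1 / 2` compares the probability of `b` with `1 / 2`. -/
theorem IsCompletion.answer_half (h : IsCompletion emb ty O T x q) (b : B) :
    (1 / 2 < q b → answer O (T, x, (1, 2), b) = 1) ∧
      (q b < 1 / 2 → answer O (T, x, (1, 2), b) = 0) := by
  have := (h.isParam b).2.2 1 2 (by norm_num) (by norm_num)
  simpa [Param.query] using this

end Completion

/-! ### Comparing estimable numbers -/

section Compare

/-- A variant of estimability with natural approximations: `k * f x` is within `2` of `g x k`. -/
def NatEstimableOn {X : Type*} [Primcodable X] (f : X → ℝ) (D : Set X) : Prop :=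
  ∃ g : X → ℕ → ℕ, Computable₂ g ∧ ∀ x ∈ D, ∀ k : ℕ, 1 ≤ k → |k * f x - g x k| < 2

/-- Integers are encoded with n at 2n and -n-1 at 2n+1, so parity gives the sign. -/
theorem primrec_int_toNat : Primrec Int.toNat := by
  have h : Primrec fun z : ℤ =>
      if Encodable.encode z % 2 = 0 then Encodable.encode z / 2 else 0 :=
    Primrec.ite (Primrec.eq.comp (Primrec.nat_mod.comp .encode (.const 2)) (.const 0))
      (Primrec.nat_div.comp .encode (.const 2)) (.const 0)
  refine h.of_eq fun z => ?_
  cases z with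
  | ofNat n =>
    have : Encodable.encode (Int.ofNat n) = 2 * n := rfl
    rw [this]
    simp
  | negSucc n =>
    have : Encodable.encode (Int.negSucc n) = 2 * n + 1 := rfl
    rw [this]
    simp

/-- Replacing a negative approximation by 0 does not increase the error, since f ≥ 0. The bound 2 is
1 for the error 1/k scaled by k, plus 1 for rounding down. -/
theorem EstimableOn.natEstimableOn {X : Type*} [Primcodable X] {f : X → ℝ} {D : Set X}
    (h : EstimableOn f D) (hf : ∀ x ∈ D, 0 ≤ f x) : NatEstimableOn f D := by
  obtain ⟨φ, hφ, happ⟩ := h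
  refine ⟨fun x k => (φ x k).1.toNat * k / ((φ x k).2 + 1), ?_, fun x hx k hk => ?_⟩
  · refine Primrec.nat_div.to_comp.comp (Primrec.nat_mul.to_comp.comp
      (primrec_int_toNat.to_comp.comp (Computable.fst.comp hφ)) .snd)
      (Computable.succ.comp (Computable.snd.comp hφ))
  · have h1 := happ x hx k hk
    have hk' : (0 : ℝ) < k := by exact_mod_cast hk
    set n := (φ x k).1
    set d := (φ x k).2
    have h2 : |f x - (n.toNat : ℝ) / ((d : ℝ) + 1)| < 1 / k := by
      rcases le_total 0 n with hn | hn
      · rwa [show ((n.toNat : ℕ) : ℝ) = (n : ℝ) by exact_mod_cast Int.toNat_of_nonneg hn]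
      · have : (n : ℝ) / ((d : ℝ) + 1) ≤ 0 :=
          div_nonpos_of_nonpos_of_nonneg (by exact_mod_cast hn) (by positivity)
        rw [Int.toNat_of_nonpos hn, Nat.cast_zero, zero_div, sub_zero, abs_of_nonneg (hf x hx)]
        exact lt_of_le_of_lt (by linarith) ((le_abs_self _).trans_lt h1)
    have h3 : |k * f x - (n.toNat * k : ℕ) / ((d + 1 : ℕ) : ℝ)| < 1 := by
      have : k * f x - (n.toNat * k : ℕ) / ((d + 1 : ℕ) : ℝ) =
          k * (f x - (n.toNat : ℝ) / ((d : ℝ) + 1)) := by push_cast; ring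
      rw [this, abs_mul, abs_of_pos hk']
      calc (k : ℝ) * _ < k * (1 / k) := mul_lt_mul_of_pos_left h2 hk'
        _ = 1 := by field_simp
    have h4 : ((n.toNat * k / (d + 1) : ℕ) : ℝ) ≤ (n.toNat * k : ℕ) / ((d + 1 : ℕ) : ℝ) :=
      Nat.cast_div_le
    have h5 : (n.toNat * k : ℕ) / ((d + 1 : ℕ) : ℝ) < ((n.toNat * k / (d + 1) : ℕ) : ℝ) + 1 := by
      rw [div_lt_iff₀ (by positivity)]
      have := Nat.lt_mul_div_succ (n.toNat * k) d.succ_pos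
      rw [mul_comm d.succ] at this
      exact_mod_cast this
    rw [abs_lt] at h3 ⊢
    constructor <;> linarith

theorem natEstimableOn_one {X : Type*} [Primcodable X] (D : Set X) :
    NatEstimableOn (fun _ : X => (1 : ℝ)) D :=
  ⟨fun _ k => k, Computable.snd, fun _ _ k _ => by simp⟩

theorem NatEstimableOn.comp {X Y : Type*} [Primcodable X] [Primcodable Y] {f : X → ℝ} {D : Set X}
    (h : NatEstimableOn f D) {u : Y → X} (hu : Computable u) :
    NatEstimableOn (fun y => f (u y)) (u ⁻¹' D) := by
  obtain ⟨g, hg, happ⟩ := h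
  exact ⟨fun y k => g (u y) k, hg.comp (hu.comp .fst) .snd, fun y hy => happ (u y) hy⟩

theorem NatEstimableOn.mono {X : Type*} [Primcodable X] {f : X → ℝ} {D D' : Set X}
    (h : NatEstimableOn f D) (hD : D' ⊆ D) : NatEstimableOn f D' := by
  obtain ⟨g, hg, happ⟩ := h
  exact ⟨g, hg, fun y hy => happ y (hD hy)⟩

/-- Comparison of the approximations `a.2.2.2` and `a.2.2.1`, scaled by `a.2.1` and `a.1`. -/
def compareApprox (a : ℕ × ℕ × ℕ × ℕ) : Option Bool :=
  -- For a = (m, d, g', f') with kg and kf within 2 of g' and f', the first case certifies m·kg <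
  -- d·kf and the second one the reverse strict inequality.
  if a.1 * (a.2.2.1 + 2) + 2 * a.2.1 ≤ a.2.1 * a.2.2.2 then some true
  else if a.2.1 * (a.2.2.2 + 2) + 2 * a.1 ≤ a.1 * a.2.2.1 then some false else none

theorem primrec_compareApprox : Primrec compareApprox := by
  have h1 : Primrec fun a : ℕ × ℕ × ℕ × ℕ => a.1 := .fst
  have h2 : Primrec fun a : ℕ × ℕ × ℕ × ℕ => a.2.1 := Primrec.fst.comp .snd
  have h3 : Primrec fun a : ℕ × ℕ × ℕ × ℕ => a.2.2.1 :=
    Primrec.fst.comp (Primrec.snd.comp .snd)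
  have h4 : Primrec fun a : ℕ × ℕ × ℕ × ℕ => a.2.2.2 :=
    Primrec.snd.comp (Primrec.snd.comp .snd)
  have h : ∀ {u v w : ℕ × ℕ × ℕ × ℕ → ℕ}, Primrec u → Primrec v → Primrec w →
      Primrec fun a => u a * (v a + 2) + 2 * w a := fun hu hv hw =>
    Primrec.nat_add.comp (Primrec.nat_mul.comp hu (Primrec.nat_add.comp hv (.const 2)))
      (Primrec.nat_mul.comp (.const 2) hw)
  exact Primrec.ite (Primrec.nat_le.comp (h h1 h3 h2) (Primrec.nat_mul.comp h2 h4)) (.const _)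
    (Primrec.ite (Primrec.nat_le.comp (h h2 h4 h1) (Primrec.nat_mul.comp h1 h3)) (.const _)
      (.const _))

variable {S B I : Type*} [Primcodable S] [Finite S] [Primcodable B] [Fintype B] {emb : B → S}
  {ty : B → I} {O : Oracle S B}

/-- The machine searches for a verdict and outputs b₁ for true and b₀ for false. If only one verdict
is possible and it occurs, the output is deterministic. The completion at b₁ is then 1 or 0, which
forces the answer at 1/2. If no verdict occurs, the machine diverges, and nothing is claimed. -/
theorem exists_decider (hO : IsTypedReflective emb ty O) {b₀ b₁ : B} (hne : emb b₀ ≠ emb b₁)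
    (hty : ty b₀ = ty b₁) {Y : Type*} [Primcodable Y] {test : Y → ℕ → Option Bool}
    (ht : Computable₂ test) :
    ∃ c : Machine, ∀ y,
      ((∃ k, test y k = some true) → (∀ k, test y k ≠ some false) →
        answer O (c.curry (Encodable.encode y), [], (1, 2), b₁) = 1) ∧
      ((∃ k, test y k = some false) → (∀ k, test y k ≠ some true) →
        answer O (c.curry (Encodable.encode y), [], (1, 2), b₁) = 0) := by
  let out : Bool → S := fun β => bif β then emb b₁ else emb b₀
  obtain ⟨c, hc⟩ := exists_machine (S := S) (B := B) (Z := Y) (σ := Unit)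
    (fun p => (Nat.rfindOpt (test p.2.1)).map fun β => Sum.inr (Sum.inr (out β)))
    (Partrec.map (Partrec.rfindOpt (ht.comp (Computable.fst.comp (Computable.snd.comp .fst)) .snd))
      (Computable.sumInr.comp (Computable.sumInr.comp
        ((Primrec.dom_finite out).to_comp.comp .snd))))
    (fun _ => Sum.inl ((), ())) (.const _)
  have key : ∀ y β, (∃ k, test y k = some β) → (∀ k, test y k ≠ some !β) →
      ∀ s, outputProb O (c.curry (Encodable.encode y)) [] s =
        open Classical in if out β = s then 1 else 0 := by
    intro y β ⟨k, hk⟩ hno s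
    obtain ⟨F, -, -, hF⟩ := hc O y s
    have hdom : (Nat.rfindOpt (test y)).Dom := Nat.rfindOpt_dom.2 ⟨k, β, hk⟩
    obtain ⟨n, hn⟩ := Nat.rfindOpt_spec (Part.get_mem hdom)
    have hget : (Nat.rfindOpt (test y)).get hdom = β := by
      by_contra hcon
      refine hno n ?_
      rw [Option.mem_def.1 hn]
      revert hcon
      cases (Nat.rfindOpt (test y)).get hdom <;> cases β <;> simp
    rw [hF [] _ (Part.mem_map _ (hget ▸ Part.get_mem hdom))]
    rfl
  refine ⟨c, fun y => ?_⟩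
  obtain ⟨q, hq⟩ := hO (c.curry (Encodable.encode y)) []
  have hb : b₀ ≠ b₁ := fun h => hne (h ▸ rfl)
  have hsum : ∀ β, (∃ k, test y k = some β) → (∀ k, test y k ≠ some !β) →
      q b₁ = if β then 1 else 0 := by
    intro β h1 h2
    have e1 := key y β h1 h2 (emb b₁)
    have e0 := key y β h1 h2 (emb b₀)
    rw [hq.eq_outputProb hb hty, e1]
    · cases β <;> simp [out, hne]
    · rw [e1, e0]
      cases β <;> simp [out, hne, hne.symm]
  refine ⟨fun h1 h2 => (hq.answer_half b₁).1 ?_, fun h1 h2 => (hq.answer_half b₁).2 ?_⟩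
  · rw [hsum true h1 h2]; norm_num
  · rw [hsum false h1 h2]; norm_num

/-- Quotients of estimable functions are described by parameters. -/
theorem exists_ratioParam (hO : IsTypedReflective emb ty O) {b₀ b₁ : B} (hne : emb b₀ ≠ emb b₁)
    (hty : ty b₀ = ty b₁) {Y : Type*} [Primcodable Y] {f g : Y → ℝ} {D : Set Y}
    (hf : NatEstimableOn f D) (hg : NatEstimableOn g D) (h0 : ∀ y ∈ D, 0 ≤ f y)
    (hfg : ∀ y ∈ D, f y ≤ g y) (hpos : ∀ y ∈ D, 0 < g y) :
    ∃ t : Y → Param S B, Computable t ∧ ∀ y ∈ D, IsParam O (t y) (f y / g y) := by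
  obtain ⟨f', hf', hfa⟩ := hf
  obtain ⟨g', hg', hga⟩ := hg
  let test : Y × (ℕ × ℕ) → ℕ → Option Bool := fun z k =>
    compareApprox (z.2.1, z.2.2, g' z.1 (k + 1), f' z.1 (k + 1))
  have htest : Computable₂ test := by
    have hy : Computable fun p : (Y × (ℕ × ℕ)) × ℕ => p.1.1 := Computable.fst.comp .fst
    have hm : Computable fun p : (Y × (ℕ × ℕ)) × ℕ => p.1.2.1 :=
      Computable.fst.comp (Computable.snd.comp .fst)
    have hd : Computable fun p : (Y × (ℕ × ℕ)) × ℕ => p.1.2.2 :=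
      Computable.snd.comp (Computable.snd.comp .fst)
    have hk : Computable fun p : (Y × (ℕ × ℕ)) × ℕ => p.2 + 1 := Computable.succ.comp .snd
    have hF := hf'.comp hy hk
    have hG := hg'.comp hy hk
    have h : Computable fun p : (Y × (ℕ × ℕ)) × ℕ =>
        (p.1.2.1, p.1.2.2, g' p.1.1 (p.2 + 1), f' p.1.1 (p.2 + 1)) :=
      .pair hm (.pair hd (.pair hG hF))
    exact (primrec_compareApprox.to_comp.comp h).to₂
  obtain ⟨c, hc⟩ := exists_decider hO hne hty htest
  refine ⟨fun y => Sum.inr (c, Encodable.encode y, b₁), Computable.sumInr.comp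
    (.pair (.const c) (.pair .encode (.const b₁))), fun y hy => ⟨div_nonneg (h0 y hy)
      (hpos y hy).le, (div_le_one (hpos y hy)).2 (hfg y hy), fun m d hd _ => ?_⟩⟩
  have hd' : (0 : ℝ) < d := by exact_mod_cast hd
  have hm' : (0 : ℝ) ≤ m := by positivity
  have hbound : ∀ k : ℕ, |((k + 1 : ℕ) : ℝ) * f y - f' y (k + 1)| < 2 ∧
      |((k + 1 : ℕ) : ℝ) * g y - g' y (k + 1)| < 2 :=
    fun k => ⟨hfa y hy _ (by omega), hga y hy _ (by omega)⟩
  simp only [abs_lt] at hbound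
  have sound1 : ∀ k, m * (g' y (k + 1) + 2) + 2 * d ≤ d * f' y (k + 1) → m * g y < d * f y := by
    intro k hk
    have hk' : (m : ℝ) * (g' y (k + 1) + 2) + 2 * d ≤ d * f' y (k + 1) := by exact_mod_cast hk
    obtain ⟨⟨a1, a2⟩, a3, a4⟩ := hbound k
    have e1 := mul_lt_mul_of_pos_left a1 hd'
    have e2 := mul_le_mul_of_nonneg_left a4.le hm'
    have : ((k + 1 : ℕ) : ℝ) * (m * g y) < ((k + 1 : ℕ) : ℝ) * (d * f y) := by linarith
    exact lt_of_mul_lt_mul_left this (by positivity)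
  have sound0 : ∀ k, d * (f' y (k + 1) + 2) + 2 * m ≤ m * g' y (k + 1) → d * f y < m * g y := by
    intro k hk
    have hk' : (d : ℝ) * (f' y (k + 1) + 2) + 2 * m ≤ m * g' y (k + 1) := by exact_mod_cast hk
    obtain ⟨⟨a1, a2⟩, a3, a4⟩ := hbound k
    have e1 := mul_lt_mul_of_pos_left a2 hd'
    have e2 := mul_le_mul_of_nonneg_left a3.le hm'
    have : ((k + 1 : ℕ) : ℝ) * (d * f y) < ((k + 1 : ℕ) : ℝ) * (m * g y) := by linarith
    exact lt_of_mul_lt_mul_left this (by positivity)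
  -- The margin 4(m + d) pays for the 2m + 2d built into `compareApprox` and for approximation
  -- errors of the same size.
  have large : ∀ δ : ℝ, 0 < δ → ∃ k : ℕ, 4 * (m + d : ℝ) ≤ ((k + 1 : ℕ) : ℝ) * δ := by
    intro δ hδ
    obtain ⟨k, hk⟩ := exists_nat_ge (4 * (m + d : ℝ) / δ)
    refine ⟨k, ?_⟩
    rw [div_le_iff₀ hδ] at hk
    push_cast
    linarith
  have hty' := hc (y, (m, d))
  -- Naturals encode themselves, so the curried parameter is the one formed by `Param.query`.
  rw [show Encodable.encode (y, (m, d)) = Nat.pair (Encodable.encode y) (Nat.pair m d) from rfl]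
    at hty'
  constructor
  · intro h
    rw [div_lt_div_iff₀ hd' (hpos y hy)] at h
    refine hty'.1 ?_ fun k hk => ?_
    · obtain ⟨k, hk⟩ := large (d * f y - m * g y) (by linarith)
      refine ⟨k, if_pos ?_⟩
      obtain ⟨⟨a1, a2⟩, a3, a4⟩ := hbound k
      have e1 := mul_lt_mul_of_pos_left a2 hd'
      have e2 := mul_le_mul_of_nonneg_left a3.le hm'
      have : (m : ℝ) * (g' y (k + 1) + 2) + 2 * d ≤ d * f' y (k + 1) := by linarith
      exact_mod_cast this
    · simp only [test, compareApprox] at hk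
      split_ifs at hk with h1 h2
      · simp at hk
      · linarith [sound0 k h2]
  · intro h
    rw [div_lt_div_iff₀ (hpos y hy) hd'] at h
    have hno : ∀ k, ¬ m * (g' y (k + 1) + 2) + 2 * d ≤ d * f' y (k + 1) := fun k hk => by
      have := sound1 k hk
      linarith
    refine hty'.2 ?_ fun k hk => ?_
    · obtain ⟨k, hk⟩ := large (m * g y - d * f y) (by linarith)
      refine ⟨k, ?_⟩
      simp only [test, compareApprox]
      rw [if_neg (hno k), if_pos]
      obtain ⟨⟨a1, a2⟩, a3, a4⟩ := hbound k
      have e1 := mul_lt_mul_of_pos_left a1 hd'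
      have e2 := mul_le_mul_of_nonneg_left a4.le hm'
      have : (d : ℝ) * (f' y (k + 1) + 2) + 2 * m ≤ m * g' y (k + 1) := by linarith
      exact_mod_cast this
    · simp only [test, compareApprox] at hk
      rw [if_neg (hno k)] at hk
      split_ifs at hk
      simp at hk

end Compare

/-! ### Words -/

section Words

variable {S B : Type*}

/-- The probability of producing the word `w` after `x`, one symbol at a time. -/
def wordVal (emb : B → S) (f : List S → B → ℝ) : List S → List B → ℝ
  | _, [] => 1
  | x, b :: w => f x b * wordVal emb f (x ++ [emb b]) w

theorem wordProb_cons (f : List S → S → ℝ) (x : List S) (s : S) (w : List S) :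
    wordProb f x (s :: w) = f x s * wordProb f (x ++ [s]) w := by
  refine (Fin.prod_univ_succ (n := w.length) _).trans ?_
  simp [wordProb]

theorem wordProb_map (emb : B → S) (f : List S → S → ℝ) (x : List S) (w : List B) :
    wordProb f x (w.map emb) = wordVal emb (fun x b => f x (emb b)) x w := by
  induction w generalizing x with
  | nil => rfl
  | cons b w ih =>
    rw [wordVal, ← ih, List.map_cons, wordProb_cons]

theorem wordProb_eq_wordVal (f : List S → S → ℝ) (x w : List S) :
    wordProb f x w = wordVal id f x w := by
  simpa using wordProb_map id f x w

theorem wordVal_nonneg {emb : B → S} {f : List S → B → ℝ} (hf : ∀ x b, 0 ≤ f x b) (x : List S)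
    (w : List B) : 0 ≤ wordVal emb f x w := by
  induction w generalizing x with
  | nil => exact zero_le_one
  | cons b w ih => exact mul_nonneg (hf x b) (ih _)

theorem wordVal_pos {emb : B → S} {f : List S → B → ℝ} (hf : ∀ x b, 0 < f x b) (x : List S)
    (w : List B) : 0 < wordVal emb f x w := by
  induction w generalizing x with
  | nil => exact zero_lt_one
  | cons b w ih => exact mul_pos (hf x b) (ih _)

theorem wordVal_mono {emb : B → S} {f g : List S → B → ℝ} (hf : ∀ x b, 0 ≤ f x b)
    (hfg : ∀ x b, f x b ≤ g x b) (x : List S) (w : List B) :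
    wordVal emb f x w ≤ wordVal emb g x w := by
  induction w generalizing x with
  | nil => exact le_rfl
  | cons b w ih =>
    exact mul_le_mul (hfg x b) (ih _) (wordVal_nonneg hf _ _) ((hf x b).trans (hfg x b))

/-- If a word has positive probability, then so has each of its symbols. -/
theorem wordVal_append_cons_pos {emb : B → S} {f : List S → B → ℝ} (hf : ∀ x b, 0 ≤ f x b)
    {x : List S} {u : List B} {b : B} {w : List B} (h : 0 < wordVal emb f x (u ++ b :: w)) :
    0 < f (x ++ u.map emb) b := by
  induction u generalizing x with
  | nil => simpa using pos_of_mul_pos_left h (wordVal_nonneg hf _ _)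
  | cons c u ih => simpa using ih (pos_of_mul_pos_right h (hf x c))

/-- The positions of a word: the prefixes with the next symbols. -/
def positions (emb : B → S) : List B → List (List S × B)
  | [] => []
  | b :: w => ([], b) :: (positions emb w).map fun p => (emb b :: p.1, p.2)

theorem prod_positions (emb : B → S) (f : List S → B → ℝ) (x : List S) (w : List B) :
    ((positions emb w).map fun p => f (x ++ p.1) p.2).prod = wordVal emb f x w := by
  induction w generalizing x with
  | nil => rfl
  | cons b w ih =>
    rw [wordVal, ← ih]
    simp [positions, Function.comp_def]

/-- The tests that the completion of `T` produces the word `w` after `x`. -/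
def wordTests (emb : B → S) (T : Machine) (x : List S) (w : List B) : List (Test S B) :=
  (positions emb w).map fun p => some (Sum.inl (T, x ++ p.1, p.2), true)

theorem pass_wordTests {emb : B → S} {O : Oracle S B} {T : Machine} {q : List S → B → ℝ}
    (hq : ∀ x b, IsParam O (Sum.inl (T, x, b)) (q x b)) (x : List S) (w : List B) :
    Pass O (wordTests emb T x w) (wordVal emb q x w) := by
  rw [← prod_positions]
  exact Pass.map (positions emb w) (fun p => Sum.inl (T, x ++ p.1, p.2)) (fun p => q (x ++ p.1) p.2)
    fun p _ => hq _ _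

theorem primrec_wordTests [Primcodable S] [Primcodable B] {A : Type*} [Finite A] [Primcodable A]
    (emb : B → S) (cw : A → List B) :
    Primrec fun p : Machine × List S × A => wordTests emb p.1 p.2.1 (cw p.2.2) := by
  refine Primrec.list_map (f := fun p : Machine × List S × A => positions emb (cw p.2.2))
    ((Primrec.dom_finite fun a => positions emb (cw a)).comp (Primrec.snd.comp .snd)) ?_
  exact Primrec.option_some.comp (.pair (Primrec.sumInl.comp (.pair (Primrec.fst.comp .fst)
    (.pair (Primrec.list_append.comp (Primrec.fst.comp (Primrec.snd.comp .fst))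
      (Primrec.fst.comp .snd)) (Primrec.snd.comp .snd)))) (.const true))

/-! ### Sums over prefix-free codes -/

variable {I A : Type*} [Fintype A] {emb : B → S} {ty : B → I} {cw : A → List B} {i : I}
  {f : List S → B → ℝ} {x : List S}

open Classical in
/-- The probability of producing a code word after `x`, given that it starts with `u`. -/
noncomputable def codeSum (emb : B → S) (cw : A → List B) (f : List S → B → ℝ) (x : List S)
    (u : List B) : ℝ :=
  ∑ a, if u <+: cw a then wordVal emb f (x ++ u.map emb) ((cw a).drop u.length) else 0

theorem codeSum_nil : codeSum emb cw f x [] = ∑ a, wordVal emb f x (cw a) := by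
  simp [codeSum]

theorem codeSum_self (hcw : ∀ a a', cw a <+: cw a' → a = a') (a : A) :
    codeSum emb cw f x (cw a) = 1 := by
  classical
  rw [codeSum, Finset.sum_eq_single a]
  · simp [wordVal]
  · exact fun a' _ hne => if_neg fun h => hne (hcw _ _ h).symm
  · simp

-- A code word that properly extends u has exactly one next symbol, and this symbol has type i.
open Classical in
theorem codeSum_step [Fintype B] (hty : ∀ a, ∀ b ∈ cw a, ty b = i) {u : List B} (hu : ∀ a, cw a ≠ u) :
    codeSum emb cw f x u =
      ∑ b with ty b = i, f (x ++ u.map emb) b * codeSum emb cw f x (u ++ [b]) := by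
  simp only [codeSum, Finset.mul_sum]
  rw [Finset.sum_comm]
  refine Finset.sum_congr rfl fun a _ => ?_
  by_cases h : u <+: cw a
  · rw [if_pos h]
    obtain ⟨t, ht⟩ := h
    cases t with
    | nil => exact absurd (by simpa using ht.symm) (hu a)
    | cons b₀ t =>
      have hb₀ : ty b₀ = i := hty a b₀ (by simp [← ht])
      rw [Finset.sum_eq_single_of_mem b₀ (by simp [hb₀])]
      · have : u ++ [b₀] <+: cw a := ⟨t, by simp [← ht]⟩
        rw [if_pos this, ← ht]
        simp [wordVal]
      · intro b _ hb
        rw [if_neg, mul_zero]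
        rintro ⟨t', ht'⟩
        rw [← ht'] at ht
        simp at ht
        exact hb ht.1.symm
  · rw [if_neg h, Finset.sum_eq_zero]
    intro b _
    rw [if_neg fun h' => h ((List.prefix_append _ _).trans h'), mul_zero]

theorem exists_length_bound (cw : A → List B) : ∃ L, ∀ a, (cw a).length ≤ L := by
  obtain ⟨L, hL⟩ := (Set.finite_range fun a => (cw a).length).bddAbove
  exact ⟨L, fun a => hL ⟨a, rfl⟩⟩

-- Kraft's inequality for sequential production. Going back from the longest words, each `codeSum`
-- is at most 1: it equals 1 at a code word, and elsewhere it is a subconvex combination over the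
-- next symbol.
open Classical in
theorem sum_wordVal_le_one [Fintype B] (hcw : ∀ a a', cw a <+: cw a' → a = a')
    (hty : ∀ a, ∀ b ∈ cw a, ty b = i) (hf : ∀ x b, 0 ≤ f x b)
    (hsum : ∀ x, ∑ b with ty b = i, f x b ≤ 1) :
    ∑ a, wordVal emb f x (cw a) ≤ 1 := by
  obtain ⟨L, hL⟩ := exists_length_bound cw
  have key : ∀ n u, L ≤ u.length + n → codeSum emb cw f x u ≤ 1 := by
    intro n
    induction n with
    | zero =>
      intro u hu
      by_cases h : ∃ a, cw a = u
      · obtain ⟨a, rfl⟩ := h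
        exact (codeSum_self hcw a).le
      · rw [codeSum, Finset.sum_eq_zero]
        · exact zero_le_one
        · intro a _
          refine if_neg fun h' => h ⟨a, (h'.eq_of_length ?_).symm⟩
          exact le_antisymm h'.length_le ((hL a).trans hu)
    | succ n ih =>
      intro u hu
      by_cases h : ∃ a, cw a = u
      · obtain ⟨a, rfl⟩ := h
        exact (codeSum_self hcw a).le
      · rw [codeSum_step hty fun a ha => h ⟨a, ha⟩]
        refine (Finset.sum_le_sum fun b _ => ?_).trans (hsum (x ++ u.map emb))
        exact mul_le_of_le_one_right (hf _ _) (ih _ (by simp; omega))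
  rw [← codeSum_nil]
  exact key L [] (by simp)

-- The same induction with equalities. No mass is lost, because at each proper prefix f is a
-- probability vector supported on symbols that stay inside the tree of code words.
open Classical in
theorem sum_wordVal_eq_one [Fintype B] [Nonempty A] (hcw : ∀ a a', cw a <+: cw a' → a = a')
    (hty : ∀ a, ∀ b ∈ cw a, ty b = i)
    (hsum : ∀ a u, u <+: cw a → u ≠ cw a → ∑ b with ty b = i, f (x ++ u.map emb) b = 1)
    (hsupp : ∀ a u b, u <+: cw a → u ≠ cw a → f (x ++ u.map emb) b ≠ 0 → ∃ a', u ++ [b] <+: cw a') :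
    ∑ a, wordVal emb f x (cw a) = 1 := by
  obtain ⟨L, hL⟩ := exists_length_bound cw
  have key : ∀ n u, L ≤ u.length + n → (∃ a, u <+: cw a) → codeSum emb cw f x u = 1 := by
    intro n
    induction n with
    | zero =>
      rintro u hu ⟨a, ha⟩
      have : u = cw a := ha.eq_of_length (le_antisymm ha.length_le ((hL a).trans hu))
      rw [this, codeSum_self hcw a]
    | succ n ih =>
      rintro u hu ⟨a, ha⟩
      by_cases h : ∃ a, cw a = u
      · obtain ⟨a, rfl⟩ := h
        exact codeSum_self hcw a
      · have hne : u ≠ cw a := fun h' => h ⟨a, h'.symm⟩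
        rw [codeSum_step hty fun a ha => h ⟨a, ha⟩, ← hsum a u ha hne]
        refine Finset.sum_congr rfl fun b _ => ?_
        by_cases hb : f (x ++ u.map emb) b = 0
        · rw [hb, zero_mul]
        · rw [ih _ (by simp; omega) (hsupp a u b ha hne hb), mul_one]
  rw [← codeSum_nil]
  exact key L [] (by simp) ⟨Classical.arbitrary A, List.nil_prefix⟩

end Words

/-! ### Decoding histories -/

section Parse

variable {A E S B : Type*}

theorem Coding.hist_append (C : Coding A E S) (h h' : History A E) :
    C.hist (h ++ h') = C.hist h ++ C.hist h' := by
  simp [Coding.hist]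

theorem Coding.hist_cons (C : Coding A E S) (y : A × E) (h : History A E) :
    C.hist (y :: h) = C.act y.1 ++ (C.per y.2 ++ C.hist h) := by
  simp [Coding.hist]

theorem eq_of_append_eq {γ : Type*} {c : γ → List S} (hc : ∀ z z', c z <+: c z' → z = z')
    {z z' : γ} {r r' : List S} (h : c z ++ r = c z' ++ r') : z = z' ∧ r = r' := by
  have hz : z = z' := by
    rcases List.prefix_or_prefix_of_prefix (List.prefix_append (c z) r)
      (h ▸ List.prefix_append (c z') r') with h1 | h1
    · exact hc _ _ h1
    · exact (hc _ _ h1).symm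
  subst hz
  exact ⟨rfl, List.append_cancel_left h⟩

/-- Code words can be peeled off from the left by prefix-freeness. A proper prefix of an action word
cannot begin with an action word, so both decompositions end at the same place. -/
theorem Coding.hist_inj (C : Coding A E S) {h h' : History A E} {w w' : List S} {a a' : A}
    (hw : w <+: C.act a) (hwa : w ≠ C.act a) (hw' : w' <+: C.act a') (hwa' : w' ≠ C.act a')
    (heq : C.hist h ++ w = C.hist h' ++ w') : h = h' ∧ w = w' := by
  have aux : ∀ {y : A × E} {t : History A E} {w w' : List S} {a : A}, w <+: C.act a →
      w ≠ C.act a → w ≠ C.hist (y :: t) ++ w' := by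
    intro y t w w' a hw hwa h
    rw [C.hist_cons, List.append_assoc] at h
    have h1 : C.act y.1 <+: w := ⟨_, h.symm⟩
    have h2 := C.act_prefixFree _ _ (h1.trans hw)
    rw [h2] at h1
    exact hwa (hw.eq_of_length (le_antisymm hw.length_le h1.length_le))
  induction h generalizing h' with
  | nil =>
    cases h' with
    | nil => exact ⟨rfl, by simpa [Coding.hist] using heq⟩
    | cons y t => exact absurd (by simpa [Coding.hist] using heq) (aux (y := y) (t := t) hw hwa)
  | cons y t ih =>
    cases h' with
    | nil => exact absurd (by simpa [Coding.hist] using heq.symm) (aux (y := y) (t := t) hw' hwa')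
    | cons y' t' =>
      simp only [C.hist_cons, List.append_assoc] at heq
      obtain ⟨h1, h2⟩ := eq_of_append_eq C.act_prefixFree heq
      obtain ⟨h3, h4⟩ := eq_of_append_eq C.per_prefixFree h2
      obtain ⟨h5, h6⟩ := ih h4
      exact ⟨by rw [h5, Prod.ext h1 h3], h6⟩

variable [Finite A] [Finite E] [Primcodable A] [Primcodable E] [Primcodable S] [Primcodable B]

theorem Coding.primrec_hist (C : Coding A E S) : Primrec C.hist := by
  refine Primrec.list_flatMap .id ?_
  exact Primrec.list_append.comp ((Primrec.dom_finite C.act).comp (Primrec.fst.comp .snd))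
    ((Primrec.dom_finite C.per).comp (Primrec.snd.comp .snd))

/-- Histories followed by a proper prefix of a code word can be decoded effectively. -/
theorem Coding.exists_parse (C : Coding A E S) {emb : B → S} (hemb : Function.Injective emb)
    {cw : A → List B} (hact : ∀ a, C.act a = (cw a).map emb) :
    ∃ inp : List S →. History A E × List B, Partrec inp ∧
      ∀ h a u, u <+: cw a → u ≠ cw a → (h, u) ∈ inp (C.hist h ++ u.map emb) := by
  classical
  let check : List S → History A E × A × ℕ → Option (History A E × List B) := fun x t =>
    if t.2.2 < (cw t.2.1).length ∧ C.hist t.1 ++ (C.act t.2.1).take t.2.2 = x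
    then some (t.1, (cw t.2.1).take t.2.2) else none
  have hcheck : Primrec₂ check := by
    have h1 : Primrec fun p : List S × (History A E × A × ℕ) => p.2.1 := Primrec.fst.comp .snd
    have h2 : Primrec fun p : List S × (History A E × A × ℕ) => p.2.2.1 :=
      Primrec.fst.comp (Primrec.snd.comp .snd)
    have h3 : Primrec fun p : List S × (History A E × A × ℕ) => p.2.2.2 :=
      Primrec.snd.comp (Primrec.snd.comp .snd)
    refine Primrec.ite (PrimrecPred.and ?_ ?_) (Primrec.option_some.comp (.pair h1 ?_)) (.const _)
    · exact Primrec.nat_lt.comp h3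
        (Primrec.list_length.comp ((Primrec.dom_finite cw).comp h2))
    · exact Primrec.eq.comp (Primrec.list_append.comp (C.primrec_hist.comp h1)
        (Primrec.list_take.comp h3 ((Primrec.dom_finite C.act).comp h2))) .fst
    · exact Primrec.list_take.comp h3 ((Primrec.dom_finite cw).comp h2)
  -- Unbounded search over a history, an action and a cutting position. It may diverge on strings of
  -- another shape. By `hist_inj`, whatever it finds is the right decomposition.
  refine ⟨fun x => Nat.rfindOpt fun n => (Encodable.decode n).bind (check x),
    Partrec.rfindOpt ?_, fun h a u hu hne => ?_⟩
  · exact (Primrec.option_bind (Primrec.decode.comp .snd)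
      (hcheck.comp (Primrec.fst.comp .fst) .snd).to₂).to_comp
  · have hlt : ∀ {a : A} {u : List B}, u <+: cw a → u ≠ cw a → u.length < (cw a).length :=
      fun hu hne => lt_of_le_of_ne hu.length_le fun h => hne (hu.eq_of_length h)
    have htake : (cw a).take u.length = u := (List.prefix_iff_eq_take.1 hu).symm
    have hdom : (Nat.rfindOpt fun n => (Encodable.decode n).bind
        (check (C.hist h ++ u.map emb))).Dom := by
      refine Nat.rfindOpt_dom.2 ⟨Encodable.encode (h, a, u.length), (h, u), ?_⟩
      simp [check, hlt hu hne, htake, hact, ← List.map_take]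
    obtain ⟨n, hn⟩ := Nat.rfindOpt_spec (Part.get_mem hdom)
    rw [Option.mem_def, Option.bind_eq_some_iff] at hn
    obtain ⟨⟨h', a', j⟩, -, hc⟩ := hn
    simp only [check] at hc
    split_ifs at hc with hcond
    obtain ⟨hj, heq⟩ := hcond
    have hproper : ∀ {a : A} {u : List B}, u <+: cw a → u.length < (cw a).length →
        u.map emb <+: C.act a ∧ u.map emb ≠ C.act a := by
      intro a u hu hlt
      refine ⟨hact a ▸ hu.map emb, fun h => ?_⟩
      rw [hact] at h
      have := congrArg List.length h
      simp at this
      omega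
    have p1 := hproper hu (hlt hu hne)
    have p2 := hproper (List.take_prefix j (cw a')) (by simpa using hj)
    rw [List.map_take, ← hact] at p2
    obtain ⟨e1, e2⟩ := C.hist_inj p2.1 p2.2 p1.1 p1.2 heq
    rw [hact, ← List.map_take] at e2
    have e3 := (List.map_injective_iff.2 hemb) e2
    have := Part.get_mem hdom
    rw [← Option.some.inj hc] at this
    simpa [e1, e3] using this

end Parse

/-! ### The dominant policy -/

section Joint

variable {A E : Type*}

theorem prod_take_append_singleton {Y : Type*} (g : List Y → Y → ℝ) (h : List Y) (y : Y) :
    ∏ k : Fin (h ++ [y]).length, g ((h ++ [y]).take k) ((h ++ [y]).get k) =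
      (∏ k : Fin h.length, g (h.take k) (h.get k)) * g h y := by
  have cons : ∀ (g : List Y → Y → ℝ) (z : Y) (h : List Y),
      ∏ k : Fin (z :: h).length, g ((z :: h).take k) ((z :: h).get k) =
        g [] z * ∏ k : Fin h.length, g (z :: h.take k) (h.get k) := fun g z h => by
    refine (Fin.prod_univ_succ (n := h.length) _).trans ?_
    simp
  induction h generalizing g with
  | nil => simp
  | cons z h ih =>
    rw [List.cons_append, cons, cons, ih fun p => g (z :: p), mul_assoc]

theorem Policy.joint_append [Fintype A] (π : Policy A E) (h : History A E) (a : A) (e : E) :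
    π.joint (h ++ [(a, e)]) = π.joint h * π.prob h a :=
  prod_take_append_singleton (fun p y => π.prob p y.1) h (a, e)

end Joint

section Positive

variable {S B : Type*} [Primcodable S] [Primcodable B] [Finite S]

/-- Drawing a symbol s with weight 2^(-encode s), without tests, gives every symbol positive
probability. This machine keeps the mixture positive, so that it can be normalized. -/
theorem exists_positiveMachine (O : Oracle S B) :
    ∃ T : Machine, ∀ x s, 0 < outputProb O T x s := by
  classical
  obtain ⟨c, hc⟩ := exists_rejectionSampler (S := S) (B := B) (X := List S) (Y := S) (Z := Unit)
    (inp := fun x => Part.some x) Partrec.some (tests := fun _ => []) (.const _)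
    (res := fun p => some p.2.2.2)
    (Computable.option_some.comp (Computable.snd.comp (Computable.snd.comp .snd)))
    (cost := Encodable.encode) .encode fun _ => le_rfl
  refine ⟨c.curry (Encodable.encode ()), fun x s => ?_⟩
  refine lt_of_le_of_ne (outputProb_mem O _ x s).1 fun h => ?_
  have h1 := hc O () x x (Part.mem_some x) (fun _ => 1) (fun _ => Pass.nil) s
  rw [← h] at h1
  have h2 := h1.unique (hasSum_single s fun s' hs' => by simp [hs'])
  simp only [Option.isSome_some, mul_zero, sub_zero, if_true, mul_one] at h2
  exact absurd h2 (by positivity : (0 : ℝ) < _).ne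

end Positive

section HistTests

variable {A E S B : Type*}

/-- The tests that the completion of `T` produces the actions of the history. -/
def histTests (C : Coding A E S) (emb : B → S) (cw : A → List B) (T : Machine)
    (h : History A E) : List (Test S B) :=
  (h.foldl (fun p y => (p.1 ++ (C.act y.1 ++ C.per y.2), p.2 ++ wordTests emb T p.1 (cw y.1)))
    (([], []) : List S × List (Test S B))).2

theorem primrec_histTests [Primcodable S] [Primcodable B] [Finite A] [Finite E] [Primcodable A]
    [Primcodable E] (C : Coding A E S) (emb : B → S) (cw : A → List B) :
    Primrec₂ (histTests C emb cw) := by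
  refine Primrec.snd.comp (Primrec.list_foldl (σ := List S × List (Test S B))
    (f := fun p : Machine × History A E => p.2) (g := fun _ => ([], []))
    (h := fun p t => (t.1.1 ++ (C.act t.2.1 ++ C.per t.2.2),
      t.1.2 ++ wordTests emb p.1 t.1.1 (cw t.2.1))) .snd (.const _) ?_)
  have hp : Primrec fun t : (Machine × History A E) × (List S × List (Test S B)) × (A × E) =>
    t.2.1 := Primrec.fst.comp .snd
  have hy : Primrec fun t : (Machine × History A E) × (List S × List (Test S B)) × (A × E) =>
    t.2.2 := Primrec.snd.comp .snd
  refine Primrec.pair (Primrec.list_append.comp (Primrec.fst.comp hp)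
    (Primrec.list_append.comp ((Primrec.dom_finite C.act).comp (Primrec.fst.comp hy))
      ((Primrec.dom_finite C.per).comp (Primrec.snd.comp hy))))
    (Primrec.list_append.comp (Primrec.snd.comp hp) ((primrec_wordTests emb cw).comp
      (.pair (Primrec.fst.comp .fst) (.pair (Primrec.fst.comp hp) (Primrec.fst.comp hy)))))

theorem histTests_append (C : Coding A E S) (emb : B → S) (cw : A → List B) (T : Machine)
    (h : History A E) (y : A × E) :
    histTests C emb cw T (h ++ [y]) =
      histTests C emb cw T h ++ wordTests emb T (C.hist h) (cw y.1) := by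
  have : ∀ h : History A E, (h.foldl (fun p y => (p.1 ++ (C.act y.1 ++ C.per y.2),
      p.2 ++ wordTests emb T p.1 (cw y.1))) (([], []) : List S × List (Test S B))).1 =
        C.hist h := by
    intro h
    induction h using List.reverseRecOn with
    | nil => rfl
    | append_singleton h y ih =>
      rw [List.foldl_append, C.hist_append]
      simp [ih, Coding.hist]
  simp only [histTests, List.foldl_append, List.foldl_cons, List.foldl_nil, this]

/-- The probability that the completion `q` produces the actions of the history. -/
noncomputable def actionVal (C : Coding A E S) (emb : B → S) (cw : A → List B)
    (q : List S → B → ℝ) (h : History A E) : ℝ :=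
  ∏ k : Fin h.length, wordVal emb q (C.hist (h.take k)) (cw (h.get k).1)

theorem actionVal_append (C : Coding A E S) (emb : B → S) (cw : A → List B)
    (q : List S → B → ℝ) (h : History A E) (y : A × E) :
    actionVal C emb cw q (h ++ [y]) =
      actionVal C emb cw q h * wordVal emb q (C.hist h) (cw y.1) :=
  prod_take_append_singleton (fun p y => wordVal emb q (C.hist p) (cw y.1)) h y

theorem pass_histTests {C : Coding A E S} {emb : B → S} (cw : A → List B) {O : Oracle S B}
    {T : Machine}
    {q : List S → B → ℝ} (hq : ∀ x b, IsParam O (Sum.inl (T, x, b)) (q x b))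
    (h : History A E) : Pass O (histTests C emb cw T h) (actionVal C emb cw q h) := by
  induction h using List.reverseRecOn with
  | nil => simpa [histTests, actionVal] using Pass.nil
  | append_singleton h y ih =>
    rw [histTests_append, actionVal_append]
    exact ih.append (pass_wordTests hq _ _)

end HistTests

section DominantPolicy

variable {A E S B I : Type*} {emb : B → S} {ty : B → I} {C : Coding A E S} {cw : A → List B}
  {i : I}

theorem codeword_prefixFree (hact : ∀ a, C.act a = (cw a).map emb) (a a' : A)
    (h : cw a <+: cw a') : a = a' :=
  C.act_prefixFree a a' (by rw [hact, hact]; exact h.map emb)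

variable [Primcodable S] [Primcodable B] {O : Oracle S B}

theorem mem_reflPolicies_iff [Fintype A] (hact : ∀ a, C.act a = (cw a).map emb)
    {π : Policy A E} :
    π ∈ reflPolicies C O ↔ ∃ T : Machine, ∀ h a, π.prob h a =
      wordVal emb (fun x b => outputProb O T x (emb b)) (C.hist h) (cw a) := by
  simp only [reflPolicies, Set.mem_ofPred_eq, hact, wordProb_map]

section Completed

variable [Fintype B]

open Classical in
theorem IsCompletion.sum_le_one {T : Machine} {x : List S} {q : B → ℝ}
    (h : IsCompletion emb ty O T x q) (i : I) : ∑ b with ty b = i, q b ≤ 1 := by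
  by_cases hi : ∃ b, ty b = i
  · obtain ⟨b, rfl⟩ := hi
    exact (h.1 b).le
  · rw [Finset.sum_eq_zero]
    · exact zero_le_one
    · intro b hb
      exact absurd ⟨b, (Finset.mem_filter.1 hb).2⟩ hi

theorem sum_completion_le_one [Fintype A] (hact : ∀ a, C.act a = (cw a).map emb)
    (hty : ∀ a, ∀ b ∈ cw a, ty b = i) {T : Machine} {q : List S → B → ℝ}
    (hq : ∀ x, IsCompletion emb ty O T x (q x)) (x : List S) :
    ∑ a, wordVal emb q x (cw a) ≤ 1 :=
  sum_wordVal_le_one (codeword_prefixFree hact) hty (fun x b => (hq x).nonneg b)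
    fun x => (hq x).sum_le_one i

end Completed

/-- The weight of a machine in the mixture. -/
noncomputable def machineWeight (K : ℕ) (T : Machine) : ℝ :=
  (1 / 2) ^ Nat.pair K (Encodable.encode T)

theorem machineWeight_pos (K : ℕ) (T : Machine) : 0 < machineWeight K T := by
  unfold machineWeight
  positivity

theorem summable_machineWeight (K : ℕ) : Summable (machineWeight K) := by
  have hinj : Function.Injective fun T : Machine => Nat.pair K (Encodable.encode T) :=
    fun T T' h => Encodable.encode_injective (Nat.pair_eq_pair.1 h).2
  exact summable_geometric_two.comp_injective hinj

/-- The mixture of the probabilities, with respect to all machines, of the actions of the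
history. -/
noncomputable def mixture (C : Coding A E S) (emb : B → S) (cw : A → List B) (K : ℕ)
    (q : Machine → List S → B → ℝ) (h : History A E) : ℝ :=
  ∑' T, machineWeight K T * actionVal C emb cw (q T) h

theorem exists_encode_bound (A : Type*) [Finite A] [Encodable A] :
    ∃ K, ∀ a : A, Encodable.encode a ≤ K := by
  obtain ⟨K, hK⟩ := (Set.finite_range (Encodable.encode : A → ℕ)).bddAbove
  exact ⟨K, fun a => hK ⟨a, rfl⟩⟩

theorem pair_le_pair_left {m n : ℕ} (h : m ≤ n) (k : ℕ) : Nat.pair m k ≤ Nat.pair n k := by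
  rcases h.lt_or_eq with h | rfl
  · exact (Nat.pair_lt_pair_left k h).le
  · exact le_rfl

variable [Fintype A] [Primcodable A] [Finite E] [Primcodable E] [Finite S]

/-- A machine that, after a history and a proper prefix of a code word, continues this code word
according to the mixture. -/
theorem exists_mixtureMachine (hemb : Function.Injective emb)
    (hact : ∀ a, C.act a = (cw a).map emb) {K : ℕ} (hK : ∀ a : A, Encodable.encode a ≤ K)
    {q : Machine → List S → B → ℝ}
    (hq : ∀ T x b, IsParam O (Sum.inl (T, x, b)) (q T x b)) :
    ∃ c : Machine, ∀ (h : History A E) (e : E) (a₀ : A) (u : List B) (b : B), u <+: cw a₀ →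
      u ≠ cw a₀ → open Classical in
      (∑ a, if u ++ [b] <+: cw a then mixture C emb cw K q (h ++ [(a, e)]) else 0) =
        (∑ a, if u <+: cw a then mixture C emb cw K q (h ++ [(a, e)]) else 0) *
          outputProb O c (C.hist h ++ u.map emb) (emb b) := by
  classical
  obtain ⟨inp, hinp, hparse⟩ := C.exists_parse hemb hact
  -- A candidate is a pair (a, T). It survives if the completion of T reproduces all actions of the
  -- history and then a.
  let tests : Machine × Unit × (History A E × List B) × (A × Machine) → List (Test S B) :=
    fun p => histTests C emb cw p.2.2.2.2 p.2.2.1.1 ++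
      wordTests emb p.2.2.2.2 (C.hist p.2.2.1.1) (cw p.2.2.2.1)
  -- Candidates whose code word does not start with the symbols u already written are rejected. The
  -- others yield the symbol that follows u.
  let res : Machine × Unit × (History A E × List B) × (A × Machine) → Option S := fun p =>
    if (cw p.2.2.2.1).take p.2.2.1.2.length = p.2.2.1.2 then
      ((cw p.2.2.2.1).map emb)[p.2.2.1.2.length]? else none
  let D := Machine × Unit × (History A E × List B) × (A × Machine)
  have p1 : Primrec fun p : D => p.2.2.1.1 :=
    Primrec.fst.comp (Primrec.fst.comp (Primrec.snd.comp .snd))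
  have p2 : Primrec fun p : D => p.2.2.1.2 :=
    Primrec.snd.comp (Primrec.fst.comp (Primrec.snd.comp .snd))
  have p3 : Primrec fun p : D => p.2.2.2.1 :=
    Primrec.fst.comp (Primrec.snd.comp (Primrec.snd.comp .snd))
  have p4 : Primrec fun p : D => p.2.2.2.2 :=
    Primrec.snd.comp (Primrec.snd.comp (Primrec.snd.comp .snd))
  have ht : Primrec tests := Primrec.list_append.comp ((primrec_histTests C emb cw).comp p4 p1)
    ((primrec_wordTests emb cw).comp (.pair p4 (.pair (C.primrec_hist.comp p1) p3)))
  have hlen : Primrec fun p : D => p.2.2.1.2.length := Primrec.list_length.comp p2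
  have hr : Primrec res := Primrec.ite
    (Primrec.eq.comp (Primrec.list_take.comp hlen ((Primrec.dom_finite cw).comp p3)) p2)
    (Primrec.list_getElem?.comp ((Primrec.dom_finite fun a => (cw a).map emb).comp p3) hlen)
    (.const none)
  obtain ⟨c, hc⟩ := exists_rejectionSampler (S := S) (B := B) hinp ht.to_comp hr.to_comp
    -- A cost that does not depend on a weights all actions equally. With K in the place of the code
    -- of a, it still bounds the code of the pair.
    (cost := fun y => Nat.pair K (Encodable.encode y.2))
    (Primrec₂.natPair.comp (.const K) (Primrec.encode.comp .snd)).to_comp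
    fun y => pair_le_pair_left (hK y.1) _
  refine ⟨c.curry (Encodable.encode ()), fun h e a₀ u b hu hne => ?_⟩
  have h0 := hc O () (C.hist h ++ u.map emb) (h, u) (hparse h a₀ u hu hne)
    (fun y => actionVal C emb cw (q y.2) (h ++ [(y.1, e)])) (fun y => by
      rw [actionVal_append]
      exact (pass_histTests cw (hq y.2) h).append (pass_wordTests (hq y.2) _ _)) (emb b)
  set lam := outputProb O (c.curry (Encodable.encode ())) (C.hist h ++ u.map emb) (emb b)
  have hsummable : ∀ a, Summable fun T =>
      machineWeight K T * actionVal C emb cw (q T) (h ++ [(a, e)]) := fun a => by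
    refine Summable.of_norm_bounded (summable_machineWeight K) fun T => ?_
    have hp := pass_histTests (C := C) (emb := emb) cw (hq T) (h ++ [(a, e)])
    rw [Real.norm_eq_abs, abs_of_nonneg (mul_nonneg (machineWeight_pos K T).le hp.nonneg)]
    exact mul_le_of_le_one_right (machineWeight_pos K T).le hp.le_one
  -- Among the words starting with u none equals u: the proper prefix u of a code word is not itself
  -- a code word. So a next symbol exists.
  have hres : ∀ a T, ((if res (c, (), (h, u), (a, T)) = some (emb b) then (1 : ℝ) else 0) -
      (if (res (c, (), (h, u), (a, T))).isSome then 1 else 0) * lam) =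
      (if u ++ [b] <+: cw a then 1 else 0) - (if u <+: cw a then 1 else 0) * lam := by
    intro a T
    by_cases hua : u <+: cw a
    · obtain ⟨t, ht⟩ := hua
      cases t with
      | nil =>
        have : cw a = u := by simpa using ht.symm
        have := codeword_prefixFree hact a a₀ (this ▸ hu)
        subst this
        exact absurd (by simpa using ht) hne
      | cons b' t =>
        have e1 : res (c, (), (h, u), (a, T)) = some (emb b') := by
          simp [res, ← ht]
        have e2 : u ++ [b] <+: cw a ↔ b' = b := by
          rw [← ht, List.prefix_append_right_inj]
          simp [eq_comm]
        have e3 : u <+: cw a := ⟨_, ht⟩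
        rw [e1]
        simp only [e2, e3, hemb.eq_iff, Option.some.injEq, Option.isSome_some, if_true]
    · have e1 : res (c, (), (h, u), (a, T)) = none := by
        simp only [res]
        exact if_neg fun (h' : (cw a).take u.length = u) => hua (h' ▸ List.take_prefix _ _)
      have e2 : ¬ u ++ [b] <+: cw a := fun h' => hua ((List.prefix_append _ _).trans h')
      simp [e1, e2, hua]
  have h1 := h0.prod_fiberwise fun a => by
    simp only [hres]
    have := (hsummable a).hasSum.mul_right
      ((if u ++ [b] <+: cw a then 1 else 0) - (if u <+: cw a then 1 else 0) * lam)
    simpa only [machineWeight, mul_assoc] using this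
  have h2 := h1.unique (hasSum_fintype _)
  rw [Finset.sum_mul, ← sub_eq_zero, ← Finset.sum_sub_distrib]
  refine Eq.trans (Finset.sum_congr rfl fun a _ => ?_) h2.symm
  rw [← show mixture C emb cw K q (h ++ [(a, e)]) = ∑' T : Machine,
    (1 / 2 : ℝ) ^ Nat.pair K (Encodable.encode T) * actionVal C emb cw (q T) (h ++ [(a, e)]) from rfl]
  split_ifs <;> ring

/-- The policy is the normalized mixture of completions. Completions dominate the sampled policies
from above and exist for every machine. Hence machines that do not sample a policy can take part in
the mixture. -/
theorem exists_dominantPolicy [Fintype B] [Nonempty A] [Nonempty E] (hO : IsTypedReflective emb ty O)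
    (hemb : Function.Injective emb) (hact : ∀ a, C.act a = (cw a).map emb)
    (hty : ∀ a, ∀ b ∈ cw a, ty b = i) :
    ∃ ζ, IsDominantPolicy (reflPolicies C O) ζ := by
  classical
  choose q hq using hO
  obtain ⟨K, hK⟩ := exists_encode_bound A
  have hpar : ∀ T x b, IsParam O (Sum.inl (T, x, b)) (q T x b) := fun T x b => (hq T x).isParam b
  let e : E := Classical.arbitrary E
  have hval : ∀ T (h : History A E), 0 ≤ actionVal C emb cw (q T) h ∧
      actionVal C emb cw (q T) h ≤ 1 := fun T h =>
    ⟨(pass_histTests (C := C) cw (hpar T) h).nonneg, (pass_histTests (C := C) cw (hpar T) h).le_one⟩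
  have hsummable : ∀ h : History A E, Summable fun T =>
      machineWeight K T * actionVal C emb cw (q T) h := fun h => by
    refine Summable.of_norm_bounded (summable_machineWeight K) fun T => ?_
    rw [Real.norm_eq_abs, abs_of_nonneg (mul_nonneg (machineWeight_pos K T).le (hval T h).1)]
    exact mul_le_of_le_one_right (machineWeight_pos K T).le (hval T h).2
  have hterm : ∀ (h : History A E) T,
      machineWeight K T * actionVal C emb cw (q T) h ≤ mixture C emb cw K q h := fun h T =>
    (hsummable h).le_tsum T fun T' _ => mul_nonneg (machineWeight_pos K T').le (hval T' h).1
  have hpos : ∀ h : History A E, 0 < mixture C emb cw K q h := by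
    obtain ⟨T, hT⟩ := exists_positiveMachine O
    intro h
    refine lt_of_lt_of_le (mul_pos (machineWeight_pos K T) ?_) (hterm h T)
    exact Finset.prod_pos fun k _ =>
      wordVal_pos (fun x b => (hT x (emb b)).trans_le ((hq T x).2.1 b).1) _ _
  have hpercept : ∀ (h : History A E) a e', mixture C emb cw K q (h ++ [(a, e')]) =
      mixture C emb cw K q (h ++ [(a, e)]) := fun h a e' => by
    simp only [mixture, actionVal_append]
  have hsum_le : ∀ h : History A E,
      ∑ a, mixture C emb cw K q (h ++ [(a, e)]) ≤ mixture C emb cw K q h := by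
    intro h
    simp only [mixture]
    rw [← Summable.tsum_finsetSum fun a _ => hsummable _]
    refine Summable.tsum_le_tsum (fun T => ?_) (summable_sum fun a _ => hsummable _) (hsummable h)
    rw [← Finset.mul_sum]
    refine mul_le_mul_of_nonneg_left ?_ (machineWeight_pos K T).le
    simp only [actionVal_append]
    rw [← Finset.mul_sum]
    exact mul_le_of_le_one_right (hval T h).1 (sum_completion_le_one hact hty (hq T) _)
  have htot : ∀ h : History A E, 0 < ∑ a, mixture C emb cw K q (h ++ [(a, e)]) := fun h =>
    Finset.sum_pos (fun a _ => hpos _) Finset.univ_nonempty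
  let ζ : Policy A E :=
    { prob := fun h a => mixture C emb cw K q (h ++ [(a, e)]) /
        ∑ a', mixture C emb cw K q (h ++ [(a', e)])
      nonneg := fun h a => div_nonneg (hpos _).le (htot h).le
      sum_eq_one := fun h => by rw [← Finset.sum_div, div_self (htot h).ne'] }
  refine ⟨ζ, ?_, fun π hπ => ?_⟩
  · rw [mem_reflPolicies_iff hact]
    obtain ⟨c, hc⟩ := exists_mixtureMachine hemb hact hK hpar
    refine ⟨c, fun h a => ?_⟩
    -- The conditional probabilities of the symbols of the code word telescope. By prefix-freeness
    -- only a remains once the word is complete.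
    have key : ∀ w u, u ++ w = cw a →
        (∑ a, if u <+: cw a then mixture C emb cw K q (h ++ [(a, e)]) else 0) *
          wordVal emb (fun x b => outputProb O c x (emb b)) (C.hist h ++ u.map emb) w =
        mixture C emb cw K q (h ++ [(a, e)]) := by
      intro w
      induction w with
      | nil =>
        intro u hu
        rw [List.append_nil] at hu
        subst hu
        rw [wordVal, mul_one, Finset.sum_eq_single a]
        · simp
        · exact fun a' _ hne => if_neg fun h => hne (codeword_prefixFree hact _ _ h).symm
        · simp
      | cons b w ih =>
        intro u hu
        have h1 : u <+: cw a := ⟨_, hu⟩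
        have h2 : u ≠ cw a := fun h => by
          rw [h] at hu
          simp at hu
        rw [wordVal, ← mul_assoc, ← hc h e a u b h1 h2]
        have := ih (u ++ [b]) (by simpa using hu)
        simpa using this
    have := key (cw a) [] rfl
    simp only [List.nil_prefix, if_true, List.map_nil, List.append_nil] at this
    change mixture C emb cw K q (h ++ [(a, e)]) / _ = _
    rw [← this]
    exact mul_div_cancel_left₀ _ (htot h).ne'
  · obtain ⟨T, hT⟩ := (mem_reflPolicies_iff hact).1 hπ
    refine ⟨machineWeight K T / mixture C emb cw K q ([] : History A E),
      div_pos (machineWeight_pos K T) (hpos _), fun h => ?_⟩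
    have h1 : π.joint h ≤ actionVal C emb cw (q T) h := by
      refine Finset.prod_le_prod (fun k _ => π.nonneg _ _) fun k _ => ?_
      rw [hT]
      exact wordVal_mono (fun x b => (outputProb_mem O T x _).1) (fun x b => ((hq T x).2.1 b).1) _ _
    -- The normalizing sum is at most `mixture` at h, so passing to conditionals only increases the
    -- product.
    have h2 : ∀ h : History A E, mixture C emb cw K q h / mixture C emb cw K q ([] : History A E) ≤
        ζ.joint h := by
      intro h
      induction h using List.reverseRecOn with
      | nil => rw [div_self (hpos _).ne']; simp [Policy.joint]
      | append_singleton h y ih =>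
        obtain ⟨a, e'⟩ := y
        rw [ζ.joint_append, hpercept]
        refine le_trans ?_ (mul_le_mul_of_nonneg_right ih (ζ.nonneg h a))
        change _ ≤ _ * (mixture C emb cw K q (h ++ [(a, e)]) / _)
        rw [div_mul_div_comm, mul_comm (mixture C emb cw K q h), ← div_mul_div_comm]
        exact le_mul_of_one_le_right (div_nonneg (hpos _).le (hpos _).le)
          ((one_le_div (htot h)).2 (hsum_le h))
    refine le_trans ?_ (h2 h)
    rw [div_mul_eq_mul_div]
    exact div_le_div_of_nonneg_right ((mul_le_mul_of_nonneg_left h1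
      (machineWeight_pos K T).le).trans (hterm h T)) (hpos _).le

end DominantPolicy

/-! ### Values -/

section Discount

variable {γ : ℕ → ℝ}

theorem discountNorm_nonneg (hγ : ∀ t, 0 ≤ γ t) (t : ℕ) : 0 ≤ discountNorm γ t :=
  tsum_nonneg fun _ => hγ _

theorem discountNorm_succ (hγs : Summable γ) (t : ℕ) :
    discountNorm γ t = γ t + discountNorm γ (t + 1) := by
  have hs : Summable fun k => γ (t + k) := by
    simpa only [add_comm] using (summable_nat_add_iff t).2 hγs
  rw [discountNorm, hs.tsum_eq_zero_add, discountNorm]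
  simp only [add_zero, add_assoc, add_comm 1]

theorem tendsto_discountNorm (γ : ℕ → ℝ) : Tendsto (discountNorm γ) atTop (𝓝 0) := by
  refine (tendsto_sum_nat_add γ).congr fun t => ?_
  simp only [discountNorm, add_comm]

end Discount

/-! ### Expected returns and the Bellman equation -/

section Paths

variable {A E : Type*} [Fintype A] [Fintype E]

/-- The probability of the percepts `e` and the actions `b` after the history `h` and the
action `a`. -/
noncomputable def pathWeight (ζ : Policy A E) (ξ : Environment A E) (h : History A E) (a : A)
    {m : ℕ} (b : Fin m → A) (e : Fin (m + 1) → E) : ℝ :=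
  let act : Fin (m + 1) → A := Fin.cons a b
  let w : History A E := List.ofFn fun i => (act i, e i)
  (∏ i : Fin (m + 1), ξ.prob (h ++ w.take i) (act i) (e i)) *
    ∏ i : Fin m, ζ.prob (h ++ w.take (i + 1)) (b i)

theorem expectedReturn_eq (γ : ℕ → ℝ) (r : E → ℝ) (ζ : Policy A E) (ξ : Environment A E)
    (h : History A E) (a : A) (m : ℕ) :
    expectedReturn γ r ζ ξ h a m = ∑ b : Fin m → A, ∑ e : Fin (m + 1) → E,
      (∑ i : Fin (m + 1), γ (h.length + i) * r (e i)) * pathWeight ζ ξ h a b e := by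
  simp only [expectedReturn, pathWeight, mul_assoc]

theorem pathWeight_zero (ζ : Policy A E) (ξ : Environment A E) (h : History A E) (a : A)
    (b : Fin 0 → A) (e : Fin 1 → E) : pathWeight ζ ξ h a b e = ξ.prob h a (e 0) := by
  simp [pathWeight]

theorem pathWeight_cons (ζ : Policy A E) (ξ : Environment A E) (h : History A E) (a : A) {m : ℕ}
    (a' : A) (b : Fin m → A) (e₀ : E) (e : Fin (m + 1) → E) :
    pathWeight ζ ξ h a (Fin.cons a' b : Fin (m + 1) → A) (Fin.cons e₀ e : Fin (m + 2) → E) =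
      ξ.prob h a e₀ * (ζ.prob (h ++ [(a, e₀)]) a' * pathWeight ζ ξ (h ++ [(a, e₀)]) a' b e) := by
  have hw : (List.ofFn fun i : Fin (m + 2) => ((Fin.cons a (Fin.cons a' b : Fin (m + 1) → A) :
      Fin (m + 2) → A) i, (Fin.cons e₀ e : Fin (m + 2) → E) i)) =
      (a, e₀) :: List.ofFn fun i => ((Fin.cons a' b : Fin (m + 1) → A) i, e i) := by
    rw [List.ofFn_succ]
    rfl
  simp only [pathWeight, hw]
  have h1 := Fin.prod_univ_succ fun i : Fin (m + 2) => ξ.prob (h ++ ((a, e₀) ::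
    List.ofFn fun i => ((Fin.cons a' b : Fin (m + 1) → A) i, e i)).take i)
    ((Fin.cons a (Fin.cons a' b : Fin (m + 1) → A) : Fin (m + 2) → A) i)
    ((Fin.cons e₀ e : Fin (m + 2) → E) i)
  have h2 := Fin.prod_univ_succ fun i : Fin (m + 1) => ζ.prob (h ++ ((a, e₀) ::
    List.ofFn fun i => ((Fin.cons a' b : Fin (m + 1) → A) i, e i)).take (i + 1))
    ((Fin.cons a' b : Fin (m + 1) → A) i)
  simp only [Fin.cons_zero, Fin.cons_succ, Fin.val_zero, Fin.val_succ, List.take_zero,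
    List.append_nil, List.take_succ_cons] at h1 h2
  simp only [List.take_succ_cons, List.append_assoc, List.singleton_append]
  rw [h1, h2]
  ring

theorem sum_fin_cons {Y M : Type*} [Fintype Y] [AddCommMonoid M] {m : ℕ}
    (φ : (Fin (m + 1) → Y) → M) :
    ∑ y, φ y = ∑ y₀ : Y, ∑ y : Fin m → Y, φ (Fin.cons y₀ y) := by
  rw [← (Fin.consEquiv fun _ : Fin (m + 1) => Y).sum_comp, Fintype.sum_prod_type]
  rfl

theorem sum_paths_succ {m : ℕ} (φ : (Fin (m + 1) → A) → (Fin (m + 2) → E) → ℝ) :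
    ∑ b, ∑ e, φ b e =
      ∑ e₀, ∑ a', ∑ b : Fin m → A, ∑ e : Fin (m + 1) → E, φ (Fin.cons a' b) (Fin.cons e₀ e) := by
  calc ∑ b, ∑ e, φ b e
      = ∑ a', ∑ b : Fin m → A, ∑ e₀, ∑ e : Fin (m + 1) → E,
          φ (Fin.cons a' b) (Fin.cons e₀ e) := by
        rw [sum_fin_cons]
        exact Finset.sum_congr rfl fun a' _ => Finset.sum_congr rfl fun b _ => sum_fin_cons _
    _ = ∑ a', ∑ e₀, ∑ b : Fin m → A, ∑ e : Fin (m + 1) → E,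
          φ (Fin.cons a' b) (Fin.cons e₀ e) :=
        Finset.sum_congr rfl fun a' _ => Finset.sum_comm
    _ = _ := Finset.sum_comm

variable (ζ : Policy A E) (ξ : Environment A E)

/-- The expectation of `X` after the next percept and the next action. -/
noncomputable def stepMean (h : History A E) (a : A) (X : E → A → ℝ) : ℝ :=
  ∑ e, ξ.prob h a e * ∑ a', ζ.prob (h ++ [(a, e)]) a' * X e a'

variable {ζ ξ}

/-- Percepts of probability 0 contribute nothing, and the others stay in the domain. So the
comparison is needed only there, which lets inductions run inside the domain of ξ. -/
theorem stepMean_mono {h : History A E} (hh : h ∈ ξ.dom) (a : A) {X Y : E → A → ℝ}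
    (hXY : ∀ e a', h ++ [(a, e)] ∈ ξ.dom → X e a' ≤ Y e a') :
    stepMean ζ ξ h a X ≤ stepMean ζ ξ h a Y := by
  refine Finset.sum_le_sum fun e _ => ?_
  rcases (ξ.nonneg h hh a e).eq_or_lt with h0 | h0
  · rw [← h0, zero_mul, zero_mul]
  · exact mul_le_mul_of_nonneg_left (Finset.sum_le_sum fun a' _ =>
      mul_le_mul_of_nonneg_left (hXY e a' (ξ.step_mem h hh a e h0)) (ζ.nonneg _ _)) h0.le

theorem stepMean_congr {h : History A E} (hh : h ∈ ξ.dom) (a : A) {X Y : E → A → ℝ}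
    (hXY : ∀ e a', h ++ [(a, e)] ∈ ξ.dom → X e a' = Y e a') :
    stepMean ζ ξ h a X = stepMean ζ ξ h a Y :=
  le_antisymm (stepMean_mono hh a fun e a' he => (hXY e a' he).le)
    (stepMean_mono hh a fun e a' he => (hXY e a' he).ge)

theorem stepMean_const {h : History A E} (hh : h ∈ ξ.dom) (a : A) (c : ℝ) :
    stepMean ζ ξ h a (fun _ _ => c) = c := by
  simp only [stepMean, ← Finset.sum_mul, ζ.sum_eq_one, ξ.sum_eq_one h hh, one_mul]

theorem stepMean_add (h : History A E) (a : A) (X Y : E → A → ℝ) :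
    stepMean ζ ξ h a (fun e a' => X e a' + Y e a') =
      stepMean ζ ξ h a X + stepMean ζ ξ h a Y := by
  simp only [stepMean, mul_add, Finset.sum_add_distrib]

theorem stepMean_percept (h : History A E) (a : A) (f : E → ℝ) :
    stepMean ζ ξ h a (fun e _ => f e) = ∑ e, ξ.prob h a e * f e := by
  simp only [stepMean, ← Finset.sum_mul, ζ.sum_eq_one, one_mul]

theorem sum_pathWeight {h : History A E} (hh : h ∈ ξ.dom) (a : A) (m : ℕ) :
    ∑ b : Fin m → A, ∑ e, pathWeight ζ ξ h a b e = 1 := by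
  induction m generalizing h a with
  | zero =>
    simp only [pathWeight_zero]
    rw [Fintype.sum_unique, sum_fin_cons]
    simpa using ξ.sum_eq_one h hh a
  | succ m ih =>
    rw [sum_paths_succ, ← stepMean_const (ζ := ζ) hh a 1]
    refine Eq.trans ?_ (stepMean_congr hh a fun e a' he => ih he a')
    simp only [pathWeight_cons, stepMean, Finset.mul_sum]

theorem expectedReturn_zero (γ : ℕ → ℝ) (r : E → ℝ) (h : History A E) (a : A) :
    expectedReturn γ r ζ ξ h a 0 = stepMean ζ ξ h a fun e _ => γ h.length * r e := by
  rw [stepMean_percept, expectedReturn_eq, Fintype.sum_unique, sum_fin_cons]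
  simp [pathWeight_zero, mul_comm]

/-- Split off the first percept and the next action. The immediate reward comes out of the remaining
sum because path weights sum to 1 on the domain. -/
theorem expectedReturn_succ (γ : ℕ → ℝ) (r : E → ℝ) {h : History A E} (hh : h ∈ ξ.dom) (a : A)
    (m : ℕ) :
    expectedReturn γ r ζ ξ h a (m + 1) = stepMean ζ ξ h a fun e a' =>
      γ h.length * r e + expectedReturn γ r ζ ξ (h ++ [(a, e)]) a' m := by
  rw [expectedReturn_eq, sum_paths_succ]
  have : ∀ e a', h ++ [(a, e)] ∈ ξ.dom →
      ∑ b : Fin m → A, ∑ e' : Fin (m + 1) → E, (γ h.length * r e +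
        ∑ i : Fin (m + 1), γ ((h ++ [(a, e)]).length + i) * r (e' i)) *
          pathWeight ζ ξ (h ++ [(a, e)]) a' b e' =
      γ h.length * r e + expectedReturn γ r ζ ξ (h ++ [(a, e)]) a' m := by
    intro e a' he
    simp only [add_mul, Finset.sum_add_distrib]
    rw [← expectedReturn_eq]
    simp only [← Finset.mul_sum, sum_pathWeight he, mul_one]
  rw [← stepMean_congr hh a this]
  simp only [stepMean, Finset.mul_sum]
  refine Finset.sum_congr rfl fun e₀ _ => Finset.sum_congr rfl fun a' _ =>
    Finset.sum_congr rfl fun b _ => Finset.sum_congr rfl fun e _ => ?_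
  rw [pathWeight_cons, Fin.sum_univ_succ]
  simp only [Fin.cons_zero, Fin.cons_succ, Fin.val_zero, Fin.val_succ, add_zero,
    List.length_append, List.length_singleton, add_assoc, add_comm 1]
  ring

variable {γ : ℕ → ℝ} {r : E → ℝ}

/-- Bounded solutions of the Bellman equation are limits of the expected returns. -/
theorem tendsto_expectedReturn_of_bellman {U : History A E → A → ℝ}
    (hU : ∀ h ∈ ξ.dom, ∀ a, 0 ≤ U h a ∧ U h a ≤ discountNorm γ h.length)
    (hB : ∀ h ∈ ξ.dom, ∀ a, U h a = stepMean ζ ξ h a fun e a' =>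
      γ h.length * r e + U (h ++ [(a, e)]) a') {h : History A E} (hh : h ∈ ξ.dom) (a : A) :
    Tendsto (expectedReturn γ r ζ ξ h a) atTop (𝓝 (U h a)) := by
  -- After m + 1 steps, the only difference from U is the expected U at the horizon, which lies
  -- between 0 and the remaining discount.
  have key : ∀ m, ∀ h ∈ ξ.dom, ∀ a, expectedReturn γ r ζ ξ h a m ≤ U h a ∧
      U h a ≤ expectedReturn γ r ζ ξ h a m + discountNorm γ (h.length + (m + 1)) := by
    intro m
    induction m with
    | zero =>
      intro h hh a
      rw [expectedReturn_zero, hB h hh a]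
      refine ⟨stepMean_mono hh a fun e a' he => by linarith [(hU _ he a').1], ?_⟩
      rw [← stepMean_const (ζ := ζ) hh a (discountNorm γ (h.length + (0 + 1))), ← stepMean_add]
      refine stepMean_mono hh a fun e a' he => ?_
      have := (hU _ he a').2
      rw [List.length_append] at this
      simpa using this
    | succ m ih =>
      intro h hh a
      rw [expectedReturn_succ γ r hh, hB h hh a]
      refine ⟨stepMean_mono hh a fun e a' he => by linarith [(ih _ he a').1], ?_⟩
      rw [← stepMean_const (ζ := ζ) hh a (discountNorm γ (h.length + (m + 1 + 1))), ← stepMean_add]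
      refine stepMean_mono hh a fun e a' he => ?_
      have := (ih _ he a').2
      rw [List.length_append, List.length_singleton,
        show h.length + 1 + (m + 1) = h.length + (m + 1 + 1) by ring] at this
      linarith
  have hlim : Tendsto (fun m => U h a - discountNorm γ (h.length + (m + 1))) atTop
      (𝓝 (U h a)) := by
    have : Tendsto (fun m => h.length + (m + 1)) atTop atTop :=
      tendsto_atTop_mono (fun m => show m ≤ h.length + (m + 1) by omega) tendsto_id
    simpa using ((tendsto_discountNorm γ).comp this).const_sub (U h a)
  exact tendsto_of_tendsto_of_tendsto_of_le_of_le hlim tendsto_const_nhds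
    (fun m => by linarith [(key m h hh a).2]) fun m => (key m h hh a).1

/-- The expected returns converge. -/
theorem exists_tendsto_expectedReturn (hγ : ∀ t, 0 ≤ γ t) (hγs : Summable γ)
    (hr : ∀ e, r e ∈ Set.Icc (0 : ℝ) 1) {h : History A E} (hh : h ∈ ξ.dom) (a : A) :
    ∃ v, Tendsto (expectedReturn γ r ζ ξ h a) atTop (𝓝 v) := by
  have hnn : ∀ m, ∀ h ∈ ξ.dom, ∀ a, 0 ≤ expectedReturn γ r ζ ξ h a m ∧
      expectedReturn γ r ζ ξ h a m ≤ discountNorm γ h.length := by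
    intro m
    induction m with
    | zero =>
      intro h hh a
      rw [expectedReturn_zero, ← stepMean_const (ζ := ζ) hh a (discountNorm γ h.length)]
      refine ⟨?_, stepMean_mono hh a fun e _ _ => ?_⟩
      · refine (stepMean_const (ζ := ζ) hh a 0).symm.le.trans (stepMean_mono hh a fun e _ _ => ?_)
        exact mul_nonneg (hγ _) (hr e).1
      · rw [discountNorm_succ hγs]
        linarith [mul_le_of_le_one_right (hγ h.length) (hr e).2,
          discountNorm_nonneg hγ (h.length + 1)]
    | succ m ih =>
      intro h hh a
      rw [expectedReturn_succ γ r hh, ← stepMean_const (ζ := ζ) hh a (discountNorm γ h.length)]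
      refine ⟨?_, stepMean_mono hh a fun e a' he => ?_⟩
      · refine (stepMean_const (ζ := ζ) hh a 0).symm.le.trans
          (stepMean_mono hh a fun e a' he => ?_)
        exact add_nonneg (mul_nonneg (hγ _) (hr e).1) (ih _ he a').1
      · have := (ih _ he a').2
        rw [List.length_append, List.length_singleton] at this
        rw [discountNorm_succ hγs]
        linarith [mul_le_of_le_one_right (hγ h.length) (hr e).2]
  have hmono : ∀ m, ∀ h ∈ ξ.dom, ∀ a,
      expectedReturn γ r ζ ξ h a m ≤ expectedReturn γ r ζ ξ h a (m + 1) := by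
    intro m
    induction m with
    | zero =>
      intro h hh a
      rw [expectedReturn_zero, expectedReturn_succ γ r hh]
      exact stepMean_mono hh a fun e a' he => by linarith [(hnn 0 _ he a').1]
    | succ m ih =>
      intro h hh a
      rw [expectedReturn_succ γ r hh, expectedReturn_succ γ r hh]
      exact stepMean_mono hh a fun e a' he => by linarith [ih _ he a']
  exact ⟨_, tendsto_atTop_ciSup (monotone_nat_of_le_succ fun m => hmono m h hh a)
    ⟨discountNorm γ h.length, by rintro _ ⟨m, rfl⟩; exact (hnn m h hh a).2⟩⟩

end Paths

/-! ### Machines that sample values -/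

section Mixer

variable {S B I : Type*} {emb : B → S} {ty : B → I} {O : Oracle S B}

theorem IsParam.pass {θ : Param S B} {p : ℝ} (h : IsParam O θ p) (fl : Bool) :
    Pass O [some (θ, fl)] (bif fl then p else 1 - p) := by
  cases fl
  · simpa using Pass.nil.neg h
  · simpa using Pass.nil.pos h

variable [Primcodable S] [Finite S] [Primcodable B] [Fintype B]

/-- A machine that draws `y` by means of tests with probabilities `w y`, and then outputs `b₁` with
the probability described by a parameter (or its complement), and `b₀` otherwise. -/
theorem exists_mixer {b₀ b₁ : B} (hne : emb b₀ ≠ emb b₁) (hty : ty b₀ = ty b₁)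
    {Y Z : Type*} [Fintype Y] [Primcodable Y] [Primcodable Z]
    {pre : Machine × Z × Y → List (Test S B)} (hpre : Computable pre)
    {fin : Machine × Z × Y → Param S B × Bool} (hfin : Computable fin) :
    ∃ c : Machine, ∀ (z : Z) (w p : Y → ℝ), (∀ y, Pass O (pre (c, z, y)) (w y)) →
      (∀ y, IsParam O (fin (c, z, y)).1 (p y)) → ∑ y, w y = 1 →
      ∀ (x : List S) (q : B → ℝ), IsCompletion emb ty O (c.curry (Encodable.encode z)) x q →
        q b₁ = ∑ y, w y * bif (fin (c, z, y)).2 then p y else 1 - p y := by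
  classical
  -- Y is finite, so a constant cost suffices and all pairs (y, output bit) are drawn with equal
  -- weight.
  obtain ⟨K, hK⟩ := exists_encode_bound (Y × Bool)
  let tests : Machine × Z × List S × (Y × Bool) → List (Test S B) := fun t =>
    pre (t.1, t.2.1, t.2.2.2.1) ++ [some ((fin (t.1, t.2.1, t.2.2.2.1)).1,
      bif (fin (t.1, t.2.1, t.2.2.2.1)).2 then t.2.2.2.2 else !t.2.2.2.2)]
  let out : Bool → S := fun β => bif β then emb b₁ else emb b₀
  have hz : Computable fun t : Machine × Z × List S × (Y × Bool) => (t.1, t.2.1, t.2.2.2.1) :=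
    .pair .fst (.pair (Computable.fst.comp .snd) (Computable.fst.comp (Computable.snd.comp
      (Computable.snd.comp .snd))))
  have hβ : Computable fun t : Machine × Z × List S × (Y × Bool) => t.2.2.2.2 :=
    Computable.snd.comp (Computable.snd.comp (Computable.snd.comp .snd))
  have ht : Computable tests := Computable.list_append.comp (hpre.comp hz)
    (Computable.list_cons.comp (Computable.option_some.comp (.pair
      (Computable.fst.comp (hfin.comp hz)) (.cond (Computable.snd.comp (hfin.comp hz)) hβ
        (Primrec.not.to_comp.comp hβ)))) (.const []))
  obtain ⟨c, hc⟩ := exists_rejectionSampler (S := S) (B := B) (inp := fun x => Part.some x)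
    Partrec.some ht (res := fun t => some (out t.2.2.2.2))
    (Computable.option_some.comp ((Primrec.dom_finite out).to_comp.comp hβ)) (cost := fun _ => K)
    (.const K) hK
  refine ⟨c, fun z w p hw hp hsum x q hq => ?_⟩
  set T := c.curry (Encodable.encode z)
  let val : Y × Bool → ℝ := fun y => w y.1 *
    bif (bif (fin (c, z, y.1)).2 then y.2 else !y.2) then p y.1 else 1 - p y.1
  have hval : ∀ s, ∑ y, val y * (if out y.2 = s then 1 else 0) = outputProb O T x s := by
    intro s
    have h := (hc O z x x (Part.mem_some x) val (fun y => (hw y.1).append ((hp y.1).pass _))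
      s).unique (hasSum_fintype _)
    simp only [Option.some.injEq, Option.isSome_some, if_true, one_mul] at h
    rw [← Finset.mul_sum, eq_comm, mul_eq_zero] at h
    have h := h.resolve_left (by positivity)
    simp only [mul_sub, Finset.sum_sub_distrib, ← Finset.sum_mul] at h
    -- The two bits for each y have complementary probabilities. The success probabilities therefore
    -- sum to 1, and conditioning on acceptance leaves them unchanged.
    have htot : ∑ y, val y = 1 := by
      rw [← hsum, Fintype.sum_prod_type]
      refine Finset.sum_congr rfl fun y _ => ?_
      rw [Fintype.sum_bool]
      simp only [val]
      cases (fin (c, z, y)).2 <;> simp <;> ring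
    rw [htot, one_mul] at h
    linarith
  have h1 : outputProb O T x (emb b₁) =
      ∑ y, w y * bif (fin (c, z, y)).2 then p y else 1 - p y := by
    rw [← hval, Fintype.sum_prod_type]
    refine Finset.sum_congr rfl fun y _ => ?_
    rw [Fintype.sum_bool]
    simp [val, out, hne]
  have h0 : outputProb O T x (emb b₀) =
      ∑ y, w y * (1 - bif (fin (c, z, y)).2 then p y else 1 - p y) := by
    rw [← hval, Fintype.sum_prod_type]
    refine Finset.sum_congr rfl fun y _ => ?_
    rw [Fintype.sum_bool]
    simp only [val, out, cond_true, cond_false, hne.symm, if_true, if_false]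
    cases (fin (c, z, y)).2 <;> simp
  have hb : b₀ ≠ b₁ := fun h => hne (congrArg emb h)
  rw [hq.eq_outputProb hb hty, h1]
  rw [h1, h0, ← Finset.sum_add_distrib]
  exact (Finset.sum_congr rfl fun y _ => by ring).trans hsum

end Mixer

section Value

variable {A E S B I : Type*} [Fintype A] [Primcodable A] [Fintype E] [Primcodable E]
  [Primcodable S] [Finite S] [Primcodable B] [Fintype B] {emb : B → S} {ty : B → I}
  {O : Oracle S B} {γ : ℕ → ℝ} {r : E → ℝ} {ζ : Policy A E} {ξ : Environment A E}

/-- A machine whose completion after `h` and `a` is the action value: it samples a percept `e`, and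
then either the reward of `e` or, after sampling the next action, its own completion at the next
step. -/
theorem exists_valueMachine {b₀ b₁ : B} (hne : emb b₀ ≠ emb b₁) (hty : ty b₀ = ty b₁)
    (hγ : ∀ t, 0 ≤ γ t) (hγs : Summable γ)
    {ζt : History A E × A → List (Test S B)} (hζt : Computable ζt)
    (hζ : ∀ h a, Pass O (ζt (h, a)) (ζ.prob h a))
    {ξt : History A E × A × E → List (Test S B)} (hξt : Computable ξt)
    (hξ : ∀ h ∈ ξ.dom, ∀ a e, Pass O (ξt (h, a, e)) (ξ.prob h a e))
    {rt : E → Param S B} (hrt : ∀ e, IsParam O (rt e) (r e))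
    {ρt : ℕ → Param S B} (hρt : Computable ρt)
    (hρ : ∀ t, 0 < discountNorm γ t →
      IsParam O (ρt t) (discountNorm γ (t + 1) / discountNorm γ t)) :
    ∃ c : Machine, ∀ q : Machine → List S → B → ℝ, (∀ T x, IsCompletion emb ty O T x (q T x)) →
      ∀ h ∈ ξ.dom, ∀ a, Tendsto (expectedReturn γ r ζ ξ h a) atTop
        (𝓝 (discountNorm γ h.length * q (c.curry (Encodable.encode (h, a))) [] b₁)) := by
  -- `none` means stopping with the immediate reward (weight 1 - ρ), and `some a'` means continuing
  -- with the next action a' (weight ρ·ζ).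
  let pre : Machine × (History A E × A) × (E × Option A) → List (Test S B) := fun t =>
    ξt (t.2.1.1, t.2.1.2, t.2.2.1) ++ Option.casesOn t.2.2.2 [some (ρt t.2.1.1.length, false)]
      fun a' => some (ρt t.2.1.1.length, true) ::
        ζt (t.2.1.1 ++ [(t.2.1.2, t.2.2.1)], a')
  -- In the second case the final coin is the completion of this very machine at the next step. It
  -- is a valid parameter before anything is known about the machine, because the oracle completes
  -- every machine.
  let fin : Machine × (History A E × A) × (E × Option A) → Param S B × Bool := fun t =>
    Option.casesOn t.2.2.2 (rt t.2.2.1, true) fun a' =>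
      (Sum.inl (t.1.curry (Encodable.encode (t.2.1.1 ++ [(t.2.1.2, t.2.2.1)], a')), [], b₁), true)
  let D := Machine × (History A E × A) × (E × Option A)
  have ph : Primrec fun t : D => t.2.1.1 := Primrec.fst.comp (Primrec.fst.comp .snd)
  have pa : Primrec fun t : D => t.2.1.2 := Primrec.snd.comp (Primrec.fst.comp .snd)
  have pe : Primrec fun t : D => t.2.2.1 := Primrec.fst.comp (Primrec.snd.comp .snd)
  have po : Primrec fun t : D => t.2.2.2 := Primrec.snd.comp (Primrec.snd.comp .snd)
  have pnext : Primrec fun t : D × A => (t.1.2.1.1 ++ [(t.1.2.1.2, t.1.2.2.1)], t.2) :=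
    .pair ((Primrec.list_append.comp ph (Primrec.list_cons.comp (.pair pa pe)
      (.const []))).comp .fst) .snd
  have hρc : Computable fun t : D => ρt t.2.1.1.length :=
    hρt.comp (Primrec.list_length.comp ph).to_comp
  have hpre : Computable pre := by
    refine Computable.list_append.comp (hξt.comp (ph.pair (pa.pair pe)).to_comp)
      (Computable.option_casesOn po.to_comp ?_ ?_)
    · exact Computable.list_cons.comp (Computable.option_some.comp (.pair hρc (.const false)))
        (.const [])
    · exact Computable.list_cons.comp (Computable.option_some.comp
        (.pair (hρc.comp .fst) (.const true))) (hζt.comp pnext.to_comp)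
  have hfin : Computable fin := by
    refine Computable.option_casesOn po.to_comp
      (((Primrec.dom_finite rt).comp pe).pair (.const true)).to_comp ?_
    exact (Primrec.pair (Primrec.sumInl.comp (.pair (Nat.Partrec.Code.primrec₂_curry.comp
      (Primrec.fst.comp .fst) (Primrec.encode.comp pnext)) (.const ([], b₁)))) (.const true)).to_comp
  obtain ⟨c, hc⟩ := exists_mixer (O := O) hne hty hpre hfin
  refine ⟨c, fun q hq h hh a => ?_⟩
  let V : History A E → A → ℝ := fun h a => q (c.curry (Encodable.encode (h, a))) [] b₁
  have hV : ∀ h a, 0 ≤ V h a ∧ V h a ≤ 1 := fun h a => ⟨(hq _ _).nonneg _, (hq _ _).le_one _⟩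
  refine tendsto_expectedReturn_of_bellman (U := fun h a => discountNorm γ h.length * V h a)
    (fun h _ a => ?_) (fun h hh a => ?_) hh a
  · exact ⟨mul_nonneg (discountNorm_nonneg hγ _) (hV h a).1,
      mul_le_of_le_one_right (discountNorm_nonneg hγ _) (hV h a).2⟩
  · have hsucc := discountNorm_succ hγs h.length
    -- If Γ_t = 0, then ρ is not described by `ρt`, but γ_t and Γ_{t+1} vanish as well, and the
    -- equation reads 0 = 0.
    rcases (discountNorm_nonneg hγ h.length).eq_or_lt with h0 | h0
    · have h1 := hγ h.length
      have h2 := discountNorm_nonneg hγ (h.length + 1)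
      have h3 : γ h.length = 0 := by linarith
      have h4 : discountNorm γ (h.length + 1) = 0 := by linarith
      rw [← h0, zero_mul]
      simp [h3, h4, stepMean]
    · set ρ := discountNorm γ (h.length + 1) / discountNorm γ h.length with hρdef
      let w : E × Option A → ℝ := fun y => ξ.prob h a y.1 *
        y.2.elim (1 - ρ) fun a' => ρ * ζ.prob (h ++ [(a, y.1)]) a'
      let p : E × Option A → ℝ := fun y => y.2.elim (r y.1) fun a' => V (h ++ [(a, y.1)]) a'
      have hw : ∀ y, Pass O (pre (c, (h, a), y)) (w y) := by
        rintro ⟨e, _ | a'⟩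
        · exact (hξ h hh a e).append (by simpa using (hρ _ h0).pass false)
        · exact (hξ h hh a e).append ((hζ _ a').pos (hρ _ h0))
      have hp : ∀ y, IsParam O (fin (c, (h, a), y)).1 (p y) := by
        rintro ⟨e, _ | a'⟩
        · exact hrt e
        · exact (hq _ _).isParam b₁
      have hsum : ∑ y, w y = 1 := by
        rw [Fintype.sum_prod_type, ← ξ.sum_eq_one h hh a]
        refine Finset.sum_congr rfl fun e _ => ?_
        simp only [w, Fintype.sum_option, Option.elim, ← Finset.mul_sum, ζ.sum_eq_one]
        ring
      have hval : V h a = ∑ y, w y * bif (fin (c, (h, a), y)).2 then p y else 1 - p y :=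
        hc (h, a) w p hw hp hsum [] _ (hq _ _)
      have hval' : V h a = ∑ e, ξ.prob h a e * ((1 - ρ) * r e +
          ρ * ∑ a', ζ.prob (h ++ [(a, e)]) a' * V (h ++ [(a, e)]) a') := by
        rw [hval, Fintype.sum_prod_type]
        refine Finset.sum_congr rfl fun e _ => ?_
        rw [Fintype.sum_option]
        simp only [w, p, fin, Option.elim, cond_true, mul_add, Finset.mul_sum, mul_assoc]
      have e1 : discountNorm γ h.length * (1 - ρ) = γ h.length := by
        rw [hρdef, mul_sub, mul_div_cancel₀ _ h0.ne']
        linarith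
      have e2 : discountNorm γ h.length * ρ = discountNorm γ (h.length + 1) := by
        rw [hρdef, mul_div_cancel₀ _ h0.ne']
      change discountNorm γ h.length * V h a = _
      rw [hval', stepMean_add, stepMean_percept, stepMean, ← Finset.sum_add_distrib,
        Finset.mul_sum]
      refine Finset.sum_congr rfl fun e _ => ?_
      rw [← e1, List.length_append, List.length_singleton, ← e2]
      simp only [V, Finset.mul_sum, mul_add]
      congr 1
      · ring
      · exact Finset.sum_congr rfl fun a' _ => by ring

end Value

/-! ### Choosing an action of maximal value -/

section Tournament

variable {A E S B I : Type*} {emb : B → S} {ty : B → I} {O : Oracle S B} {C : Coding A E S}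
  {cw : A → List B} {i : I}

/-- The moves of the machine that determines the winner of the successive comparisons of the
elements of a list of actions, and outputs the symbol of its code word at a given position. -/
def tournamentNext (emb : B → S) (cw : A → List B) (Q : History A E × A × A → Query S B) :
    History A E × ℕ × List A → StateMove S B (History A E × ℕ × List A)
  | (h, n, L) =>
    match L.head? with
    | none => Sum.inl ((h, n, L), (h, n, L))
    | some a =>
      match L.tail.head? with
      | none =>
        match ((cw a).map emb)[n]? with
        | none => Sum.inl ((h, n, L), (h, n, L))
        | some s => Sum.inr (Sum.inr s)
      | some b => Sum.inr (Sum.inl (Q (h, a, b), (h, n, a :: L.tail.tail), (h, n, L.tail)))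

theorem computable_tournamentNext [Finite A] [Primcodable A] [Primcodable E] [Primcodable S]
    [Primcodable B] (emb : B → S) (cw : A → List B) {Q : History A E × A × A → Query S B}
    (hQ : Computable Q) : Computable (tournamentNext emb cw Q) := by
  let D := History A E × ℕ × List A
  have hL : Primrec fun u : D => u.2.2 := Primrec.snd.comp .snd
  have hT : Primrec fun u : D => u.2.2.tail := Primrec.list_tail.comp hL
  have hskip : Computable fun u : D => (Sum.inl (u, u) : StateMove S B D) :=
    Computable.sumInl.comp (.pair .id .id)
  have hget : Primrec fun p : D × A => ((cw p.2).map emb)[p.1.2.1]? :=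
    Primrec.list_getElem?.comp ((Primrec.dom_finite fun a => (cw a).map emb).comp .snd)
      (Primrec.fst.comp (Primrec.snd.comp .fst))
  have g1 : Computable₂ fun (u : D) (a : A) => (Option.casesOn (((cw a).map emb)[u.2.1]?)
      (Sum.inl (u, u)) fun s => Sum.inr (Sum.inr s) : StateMove S B D) :=
    Computable.option_casesOn hget.to_comp (hskip.comp .fst)
      (Computable.sumInr.comp (Computable.sumInr.comp .snd))
  have hst : ∀ {l : (D × A) × A → List A}, Primrec l →
      Computable fun p : (D × A) × A => ((p.1.1.1, p.1.1.2.1, l p) : D) := fun hl =>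
    (Primrec.pair (Primrec.fst.comp (Primrec.fst.comp .fst)) (.pair
      (Primrec.fst.comp (Primrec.snd.comp (Primrec.fst.comp .fst))) hl)).to_comp
  have g2 : Computable fun p : (D × A) × A => (Sum.inr (Sum.inl (Q (p.1.1.1, p.1.2, p.2),
      (p.1.1.1, p.1.1.2.1, p.1.2 :: p.1.1.2.2.tail.tail), (p.1.1.1, p.1.1.2.1, p.1.1.2.2.tail))) :
        StateMove S B D) := by
    refine Computable.sumInr.comp (Computable.sumInl.comp (.pair (hQ.comp ?_) (.pair
      (hst ?_) (hst ?_))))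
    · exact (Primrec.pair (Primrec.fst.comp (Primrec.fst.comp .fst))
        (.pair (Primrec.snd.comp .fst) .snd)).to_comp
    · exact Primrec.list_cons.comp (Primrec.snd.comp .fst)
        (Primrec.list_tail.comp (hT.comp (Primrec.fst.comp .fst)))
    · exact hT.comp (Primrec.fst.comp .fst)
  have g3 := Computable.option_casesOn (o := fun p : D × A => p.1.2.2.tail.head?)
    (Primrec.list_head?.comp (hT.comp .fst)).to_comp g1 g2.to₂
  have g4 := Computable.option_casesOn (o := fun u : D => u.2.2.head?)
    (Primrec.list_head?.comp hL).to_comp hskip g3.to₂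
  refine g4.of_eq ?_
  rintro ⟨h, n, _ | ⟨a, _ | ⟨b, L⟩⟩⟩
  · rfl
  · simp only [tournamentNext, List.head?_cons, List.tail_cons, List.head?_nil]
    cases ((cw a).map emb)[n]? <;> rfl
  · rfl

/-- A discarded action is never strictly better than the one kept, since a strict comparison is
answered with certainty. A tie may go either way. So any symbol output with positive probability
comes from a maximizer of the list. -/
theorem tournamentNext_ne_zero {Q : History A E × A × A → Query S B} {V : A → ℝ}
    {h : History A E} (hQ : ∀ a b, (V b < V a → answer O (Q (h, a, b)) = 1) ∧
      (V a < V b → answer O (Q (h, a, b)) = 0))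
    {s : S} {F : History A E × ℕ × List A → ℝ}
    (hF : ∀ u, F u = moveValue O s F (tournamentNext emb cw Q u)) {n : ℕ} (L : List A) (a : A)
    (hn : ∀ a' ∈ a :: L, n < (cw a').length) (hne : F (h, n, a :: L) ≠ 0) :
    ∃ a' ∈ a :: L, (∃ b, (cw a')[n]? = some b ∧ emb b = s) ∧ ∀ a'' ∈ a :: L, V a'' ≤ V a' := by
  induction L generalizing a with
  | nil =>
    obtain ⟨b, hb⟩ : ∃ b, (cw a)[n]? = some b :=
      ⟨_, List.getElem?_eq_getElem (hn a List.mem_cons_self)⟩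
    rw [hF] at hne
    simp only [tournamentNext, List.head?_cons, List.tail_cons, List.head?_nil, List.getElem?_map,
      hb, Option.map_some, moveValue] at hne
    exact ⟨a, List.mem_cons_self, ⟨b, hb, by by_contra h; exact hne (if_neg h)⟩, by simp⟩
  | cons b L ih =>
    rw [hF] at hne
    simp only [tournamentNext, List.head?_cons, List.tail_cons, moveValue] at hne
    have hsub : ∀ c, c ∈ a :: b :: L ↔ c = a ∨ c = b ∨ c ∈ L := fun c => by simp
    by_cases h1 : answer O (Q (h, a, b)) * F (h, n, a :: L) = 0
    · rw [h1, zero_add] at hne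
      obtain ⟨a', ha', hs, hmax⟩ := ih b (fun c hc => hn c (List.mem_cons_of_mem _ hc))
        (right_ne_zero_of_mul hne)
      refine ⟨a', List.mem_cons_of_mem _ ha', hs, fun c hc => ?_⟩
      rcases List.mem_cons.1 hc with rfl | hc
      · refine le_trans (not_lt.1 fun hlt => ?_) (hmax b List.mem_cons_self)
        rw [(hQ c b).1 hlt] at hne
        simp at hne
      · exact hmax c hc
    · have hmem : ∀ c ∈ a :: L, c ∈ a :: b :: L := fun c hc => by
        rcases List.mem_cons.1 hc with rfl | hc
        · exact List.mem_cons_self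
        · exact List.mem_cons_of_mem _ (List.mem_cons_of_mem _ hc)
      obtain ⟨a', ha', hs, hmax⟩ := ih a (fun c hc => hn c (hmem c hc)) (right_ne_zero_of_mul h1)
      refine ⟨a', hmem a' ha', hs, fun c hc => ?_⟩
      rcases (hsub c).1 hc with rfl | rfl | hc
      · exact hmax c List.mem_cons_self
      · refine le_trans (not_lt.1 fun hlt => ?_) (hmax a List.mem_cons_self)
        rw [(hQ a c).2 hlt] at h1
        simp at h1
      · exact hmax c (List.mem_cons_of_mem _ hc)

-- Each comparison shortens the list, so the tournament always halts. Every leaf outputs exactly one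
-- symbol of type i.
open Classical in
theorem tournamentNext_sum [Fintype B] (hemb : Function.Injective emb)
    (hty : ∀ a, ∀ b ∈ cw a, ty b = i) {Q : History A E × A × A → Query S B}
    {F : S → History A E × ℕ × List A → ℝ}
    (hF : ∀ s u, F s u = moveValue O s (F s) (tournamentNext emb cw Q u)) {h : History A E}
    {n : ℕ} (L : List A) (a : A) (hn : ∀ a' ∈ a :: L, n < (cw a').length) :
    ∑ b with ty b = i, F (emb b) (h, n, a :: L) = 1 := by
  induction L generalizing a with
  | nil =>
    have hlt := hn a List.mem_cons_self
    have hb : (cw a)[n]? = some (cw a)[n] := List.getElem?_eq_getElem hlt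
    have hi : ty (cw a)[n] = i := hty a _ (List.getElem_mem hlt)
    have : ∀ b, F (emb b) (h, n, [a]) = if (cw a)[n] = b then 1 else 0 := by
      intro b
      rw [hF]
      simp only [tournamentNext, List.head?_cons, List.tail_cons, List.head?_nil,
        List.getElem?_map, hb, Option.map_some, moveValue, hemb.eq_iff]
    simp only [this]
    rw [Finset.sum_ite_eq, if_pos (by simp [hi])]
  | cons b L ih =>
    have : ∀ c, F (emb c) (h, n, a :: b :: L) =
        answer O (Q (h, a, b)) * F (emb c) (h, n, a :: L) +
          (1 - answer O (Q (h, a, b))) * F (emb c) (h, n, b :: L) := by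
      intro c
      rw [hF]
      simp only [tournamentNext, List.head?_cons, List.tail_cons, moveValue]
    simp only [this]
    rw [Finset.sum_add_distrib, ← Finset.mul_sum, ← Finset.mul_sum, ih a, ih b]
    · ring
    · exact fun c hc => hn c (List.mem_cons_of_mem _ hc)
    · intro c hc
      refine hn c ?_
      rcases List.mem_cons.1 hc with rfl | hc
      · exact List.mem_cons_self
      · exact List.mem_cons_of_mem _ (List.mem_cons_of_mem _ hc)

section Candidates

open Classical in
/-- The actions whose code word starts with `u`. -/
noncomputable def candidates [Fintype A] (cw : A → List B) (u : List B) : List A :=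
  (Finset.univ : Finset A).toList.flatMap fun a => if (cw a).take u.length = u then [a] else []

theorem primrec_candidates [Fintype A] [Primcodable A] [Primcodable B] (cw : A → List B) :
    Primrec (candidates cw) := by
  classical
  exact Primrec.list_flatMap (.const _) (Primrec.ite
    (Primrec.eq.comp (Primrec.list_take.comp (Primrec.list_length.comp .fst)
      ((Primrec.dom_finite cw).comp .snd)) .fst)
    (Primrec.list_cons.comp .snd (.const [])) (.const []))

theorem mem_candidates [Fintype A] {u : List B} {a : A} : a ∈ candidates cw u ↔ u <+: cw a := by
  rw [List.prefix_iff_eq_take, eq_comm (a := u)]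
  simp only [candidates, List.mem_flatMap, Finset.mem_toList, Finset.mem_univ, true_and]
  constructor
  · rintro ⟨a', ha'⟩
    split_ifs at ha' with h
    · rw [List.mem_singleton] at ha'
      rwa [ha']
    · simp at ha'
  · exact fun h => ⟨a, by simp [h]⟩

end Candidates

variable [Fintype A] [Primcodable A] [Finite E] [Primcodable E] [Primcodable S]
  [Finite S] [Primcodable B]

/-- A machine that runs the comparisons between the actions whose code word extends the symbols
written since the last complete step. -/
theorem exists_tournamentMachine (hemb : Function.Injective emb)
    (hact : ∀ a, C.act a = (cw a).map emb) (O : Oracle S B)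
    {Q : History A E × A × A → Query S B} (hQ : Computable Q) :
    ∃ T : Machine, ∀ s, ∃ F : History A E × ℕ × List A → ℝ,
      (∀ u, F u = moveValue O s F (tournamentNext emb cw Q u)) ∧
      ∀ h a u, u <+: cw a → u ≠ cw a →
        outputProb O T (C.hist h ++ u.map emb) s = F (h, u.length, candidates cw u) := by
  obtain ⟨inp, hinp, hparse⟩ := C.exists_parse hemb hact
  let init : History A E × List B → History A E × ℕ × List A := fun p =>
    (p.1, p.2.length, candidates cw p.2)
  have hinit : Computable init :=
    (Primrec.pair Primrec.fst (.pair (Primrec.list_length.comp .snd)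
      ((primrec_candidates cw).comp .snd))).to_comp
  let start : History A E × List B → StateMove S B (History A E × ℕ × List A) := fun p =>
    Sum.inl (init p, init p)
  have hstart : Computable start := Computable.sumInl.comp (.pair hinit hinit)
  have hnext := computable_tournamentNext emb cw hQ
  obtain ⟨c, hc⟩ := exists_machine (S := S) (B := B) (Z := Unit) (σ := History A E × ℕ × List A)
    (fun p => (inp p.2.2).map start)
    (Partrec.map (hinp.comp (Computable.snd.comp .snd)) (hstart.comp .snd))
    (fun p => tournamentNext emb cw Q p.2.2) (hnext.comp (Computable.snd.comp .snd))
  refine ⟨c.curry (Encodable.encode ()), fun s => ?_⟩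
  obtain ⟨F, -, hF, hout⟩ := hc O () s
  refine ⟨F, hF, fun h a u hu hne => ?_⟩
  rw [hout _ _ (Part.mem_map _ (hparse h a u hu hne))]
  simp only [start, init, moveValue]
  ring

variable [Nonempty A] [Fintype B]

/-- If the oracle allows to compare the values of actions, then some policy sampled by a machine
only takes actions of maximal value. -/
theorem exists_greedyPolicy (hemb : Function.Injective emb) (hact : ∀ a, C.act a = (cw a).map emb)
    (hty : ∀ a, ∀ b ∈ cw a, ty b = i) {V : History A E → A → ℝ}
    {Q : History A E × A × A → Query S B} (hQc : Computable Q)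
    (hQ : ∀ h a b, (V h b < V h a → answer O (Q (h, a, b)) = 1) ∧
      (V h a < V h b → answer O (Q (h, a, b)) = 0)) :
    ∃ π ∈ reflPolicies C O, ∀ h a, 0 < π.prob h a → ∀ a', V h a' ≤ V h a := by
  classical
  have hpf := codeword_prefixFree hact
  obtain ⟨T, hT⟩ := exists_tournamentMachine hemb hact O hQc
  choose F hF hstart using hT
  let f : List S → B → ℝ := fun x b => outputProb O T x (emb b)
  have hf0 : ∀ x b, 0 ≤ f x b := fun x b => (outputProb_mem O T x _).1
  have hout : ∀ (h : History A E) a u, u <+: cw a → u ≠ cw a → ∃ a₁ L, candidates cw u = a₁ :: L ∧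
      (∀ a' ∈ a₁ :: L, u.length < (cw a').length) ∧
      ∀ b, f (C.hist h ++ u.map emb) b = F (emb b) (h, u.length, a₁ :: L) := by
    intro h a u hu hne
    obtain ⟨a₁, L, hL⟩ := List.exists_cons_of_ne_nil
      (List.ne_nil_of_mem ((mem_candidates).2 hu))
    refine ⟨a₁, L, hL, fun a' ha' => ?_, fun b => ?_⟩
    · rw [← hL, mem_candidates] at ha'
      refine lt_of_le_of_ne ha'.length_le fun heq => ?_
      have h1 := ha'.eq_of_length heq
      exact hne (h1.trans (congrArg cw (hpf a' a (h1 ▸ hu))))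
    · rw [← hL]
      exact hstart (emb b) h a u hu hne
  -- The winner that produced the symbol b remains a candidate after b, so the best value among the
  -- candidates does not drop.
  have hwin : ∀ (h : History A E) a u b, u <+: cw a → u ≠ cw a →
      f (C.hist h ++ u.map emb) b ≠ 0 →
      ∃ a', u ++ [b] <+: cw a' ∧ ∀ a'', u <+: cw a'' → V h a'' ≤ V h a' := by
    intro h a u b hu hne hfb
    obtain ⟨a₁, L, hL, hlen, hFf⟩ := hout h a u hu hne
    rw [hFf] at hfb
    obtain ⟨a', ha', ⟨b', hb', hbb'⟩, hmax⟩ :=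
      tournamentNext_ne_zero (hQ h) (hF (emb b)) L a₁ hlen hfb
    rw [← hemb hbb']
    rw [← hL, mem_candidates] at ha'
    refine ⟨a', ?_, fun a'' ha'' => hmax a'' ?_⟩
    · obtain ⟨t, ht⟩ := ha'
      rw [← ht] at hb' ⊢
      cases t with
      | nil => simp at hb'
      | cons b₁ t =>
        have : b₁ = b' := by simpa using hb'
        exact ⟨t, by simp [this]⟩
    · rwa [← hL, mem_candidates]
  let π : Policy A E :=
    { prob := fun h a => wordVal emb f (C.hist h) (cw a)
      nonneg := fun h a => wordVal_nonneg hf0 _ _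
      sum_eq_one := fun h => by
        refine sum_wordVal_eq_one hpf hty (fun a u hu hne => ?_) fun a u b hu hne hfb => ?_
        · obtain ⟨a₁, L, hL, hlen, hFf⟩ := hout h a u hu hne
          simp only [hFf]
          exact tournamentNext_sum hemb hty hF L a₁ hlen
        · obtain ⟨a', ha', -⟩ := hwin h a u b hu hne hfb
          exact ⟨a', ha'⟩ }
  refine ⟨π, (mem_reflPolicies_iff hact).2 ⟨T, fun h a => rfl⟩, fun h a ha a' => ?_⟩
  -- Ties may give different winners at different symbols. The invariant is therefore only that some
  -- candidate extending u is at least as good as a'. At u = cw a this candidate is a itself.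
  have key : ∀ u, u <+: cw a → ∃ a'', u <+: cw a'' ∧ V h a' ≤ V h a'' := by
    intro u
    induction u using List.reverseRecOn with
    | nil => exact fun _ => ⟨a', List.nil_prefix, le_rfl⟩
    | append_singleton u b ih =>
      intro hu
      obtain ⟨a'', ha'', hle⟩ := ih ((List.prefix_append _ _).trans hu)
      obtain ⟨w, hw⟩ := hu
      have hw' : u ++ b :: w = cw a := by simpa using hw
      have hpos : 0 < f (C.hist h ++ u.map emb) b := by
        have ha2 : 0 < wordVal emb f (C.hist h) (cw a) := ha
        rw [← hw'] at ha2
        exact wordVal_append_cons_pos hf0 ha2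
      obtain ⟨a₃, ha₃, hmax⟩ := hwin h a u b ⟨_, hw'⟩ (fun heq => by
        rw [heq] at hw'
        simp at hw') hpos.ne'
      exact ⟨a₃, ha₃, hle.trans (hmax a'' ha'')⟩
  obtain ⟨a'', ha'', hle⟩ := key (cw a) List.prefix_rfl
  rwa [hpf a a'' ha'']

end Tournament

/-! ### Self-AIXI policies -/

section SelfAIXI

variable {A E S B I : Type*} {emb : B → S} {ty : B → I} {O : Oracle S B} {C : Coding A E S}
  {cw : A → List B} {i : I}

/-- Words over a single symbol are not prefix-free. -/
theorem exists_symbols_ne [Nontrivial A] (hact : ∀ a, C.act a = (cw a).map emb)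
    (hty : ∀ a, ∀ b ∈ cw a, ty b = i) : ∃ b₀ b₁, b₀ ≠ b₁ ∧ ty b₀ = ty b₁ := by
  by_contra! hcon
  -- With one symbol available, all code words are powers of it, so the shorter of two is a prefix
  -- of the longer.
  have hpre : ∀ a a', (cw a).length ≤ (cw a').length → a = a' := by
    intro a a' hle
    refine codeword_prefixFree hact a a' ?_
    rcases h : cw a with _ | ⟨b, w⟩
    · exact List.nil_prefix
    · rw [← h]
      have hb : ty b = i := hty a b (by simp [h])
      have hrep : ∀ a'', cw a'' = List.replicate (cw a'').length b := fun a'' =>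
        List.eq_replicate_of_mem fun b' hb' => by
          by_contra hne
          exact hcon b' b hne ((hty a'' b' hb').trans hb.symm)
      rw [hrep a, hrep a']
      exact ⟨List.replicate ((cw a').length - (cw a).length) b, by
        rw [← List.replicate_add]; congr 1; omega⟩
  obtain ⟨a, a', hne⟩ := exists_pair_ne A
  rcases le_total (cw a).length (cw a').length with h | h
  · exact hne (hpre a a' h)
  · exact hne (hpre a' a h).symm

variable {γ : ℕ → ℝ} {r : E → ℝ}

theorem isSelfAIXI_of_subsingleton [Fintype A] [Fintype E] {ζ : Policy A E}
    {ξ : Environment A E} [Subsingleton A] (hγ : ∀ t, 0 ≤ γ t) (hγs : Summable γ)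
    (hr : ∀ e, r e ∈ Set.Icc (0 : ℝ) 1) (π : Policy A E) : IsSelfAIXI γ r ζ ξ π := by
  intro h hh
  choose V hV using fun a => exists_tendsto_expectedReturn (ζ := ζ) hγ hγs hr hh a
  refine ⟨fun a => (discountNorm γ h.length)⁻¹ * V a, fun a => (hV a).const_mul _,
    fun a _ a' => ?_⟩
  rw [Subsingleton.elim a' a]

variable [Primcodable A] [Primcodable E] [Primcodable S] [Primcodable B] [Fintype B]

/-- A machine whose completion exceeds `1 / 2` if the completion of the first argument exceeds that
of the second one. -/
theorem exists_comparison [Finite S] {b₀ b₁ : B}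
    (hne : emb b₀ ≠ emb b₁) (hty : ty b₀ = ty b₁) (c : Machine) {q : Machine → List S → B → ℝ}
    (hq : ∀ T x, IsCompletion emb ty O T x (q T x)) :
    ∃ Q : History A E × A × A → Query S B, Computable Q ∧ ∀ h a b,
      (q (c.curry (Encodable.encode (h, b))) [] b₁ < q (c.curry (Encodable.encode (h, a))) [] b₁ →
        answer O (Q (h, a, b)) = 1) ∧
      (q (c.curry (Encodable.encode (h, a))) [] b₁ < q (c.curry (Encodable.encode (h, b))) [] b₁ →
        answer O (Q (h, a, b)) = 0) := by
  let sel : (History A E × A × A) × Bool → A := fun t => bif t.2 then t.1.2.1 else t.1.2.2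
  have hsel : Primrec sel := Primrec.cond .snd (Primrec.fst.comp (Primrec.snd.comp .fst))
    (Primrec.snd.comp (Primrec.snd.comp .fst))
  -- A fair coin chooses between a coin of bias V(a) and the complement of a coin of bias V(b). The
  -- output b₁ then has probability 1/2 + (V(a) - V(b))/2.
  let fin : Machine × (History A E × A × A) × Bool → Param S B × Bool := fun t =>
    (Sum.inl (c.curry (Encodable.encode (t.2.1.1, sel t.2)), [], b₁), t.2.2)
  have hfin : Computable fin := by
    refine (Primrec.pair (Primrec.sumInl.comp (.pair (Nat.Partrec.Code.primrec₂_curry.comp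
      (.const c) (Primrec.encode.comp (.pair (Primrec.fst.comp (Primrec.fst.comp .snd))
        (hsel.comp .snd)))) (.const ([], b₁)))) (Primrec.snd.comp .snd)).to_comp
  obtain ⟨c', hc'⟩ := exists_mixer (O := O) (ty := ty) hne hty
    (Computable.const ([none] : List (Test S B))) hfin
  refine ⟨fun y => (c'.curry (Encodable.encode y), [], (1, 2), b₁), ?_, fun h a b => ?_⟩
  · exact (Primrec.pair (Nat.Partrec.Code.primrec₂_curry.comp (.const c') Primrec.encode)
      (.const (([], (1, 2), b₁) : List S × (ℕ × ℕ) × B))).to_comp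
  · have hval := hc' (h, a, b) (fun _ => 1 / 2)
      (fun β => q (c.curry (Encodable.encode (h, sel ((h, a, b), β)))) [] b₁)
      (fun _ => by simpa using Pass.nil.coin) (fun β => (hq _ _).isParam b₁) (by simp) [] _ (hq _ _)
    have hhalf := (hq (c'.curry (Encodable.encode (h, a, b))) []).answer_half b₁
    rw [Fintype.sum_bool] at hval
    simp only [fin, sel, cond_true, cond_false] at hval
    exact ⟨fun hlt => hhalf.1 (by linarith), fun hlt => hhalf.2 (by linarith)⟩

variable [Fintype A] [Fintype E] {ζ : Policy A E} {ξ : Environment A E}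

/-- Tests that are passed with the probability of an action. -/
theorem exists_actionTests (hact : ∀ a, C.act a = (cw a).map emb) (hty : ∀ a, ∀ b ∈ cw a, ty b = i)
    (hO : IsTypedReflective emb ty O) (hζ : ζ ∈ reflPolicies C O) :
    ∃ ζt : History A E × A → List (Test S B), Computable ζt ∧
      ∀ h a, Pass O (ζt (h, a)) (ζ.prob h a) := by
  obtain ⟨T, hT⟩ := (mem_reflPolicies_iff hact).1 hζ
  choose q hq using hO T
  refine ⟨fun y => wordTests emb T (C.hist y.1) (cw y.2), ?_, fun h a => ?_⟩
  · exact ((primrec_wordTests emb cw).comp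
      (Primrec.pair (.const T) (.pair (C.primrec_hist.comp .fst) .snd))).to_comp
  · have hle : ∀ a, ζ.prob h a ≤ wordVal emb q (C.hist h) (cw a) := fun a => by
      rw [hT]
      exact wordVal_mono (fun x b => (outputProb_mem O T x _).1) (fun x b => ((hq x).2.1 b).1) _ _
    have hsum := sum_completion_le_one hact hty hq (C.hist h)
    rw [← ζ.sum_eq_one h] at hsum
    have heq := (Finset.sum_eq_sum_iff_of_le fun a _ => hle a).1
      (le_antisymm (Finset.sum_le_sum fun a _ => hle a) hsum) a (Finset.mem_univ a)
    rw [heq]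
    exact pass_wordTests (fun x b => (hq x).isParam b) _ _

/-- The existence of Self-AIXI policies for environments whose conditionals are the probabilities of
passing computable lists of tests. -/
theorem exists_selfAIXI [Finite S] [Nonempty A] (hemb : Function.Injective emb)
    (hact : ∀ a, C.act a = (cw a).map emb) (hty : ∀ a, ∀ b ∈ cw a, ty b = i)
    (hO : IsTypedReflective emb ty O) (hγ : ∀ t, 0 ≤ γ t) (hγs : Summable γ)
    (hΓ : EstimableOn (discountNorm γ) Set.univ) (hr : ∀ e, r e ∈ Set.Icc (0 : ℝ) 1)
    (hre : EstimableOn r Set.univ)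
    (hξ : ∀ b₀ b₁, b₀ ≠ b₁ → ty b₀ = ty b₁ → ∃ ξt : History A E × A × E → List (Test S B),
      Computable ξt ∧ ∀ h ∈ ξ.dom, ∀ a e, Pass O (ξt (h, a, e)) (ξ.prob h a e))
    (hζ : ζ ∈ reflPolicies C O) : ∃ πS ∈ reflPolicies C O, IsSelfAIXI γ r ζ ξ πS := by
  rcases subsingleton_or_nontrivial A with hA | hA
  -- A single action may have the empty code word, so two symbols of one type need not exist. Here
  -- every policy is optimal.
  · exact ⟨ζ, hζ, isSelfAIXI_of_subsingleton hγ hγs hr ζ⟩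
  obtain ⟨b₀, b₁, hb, htb⟩ := exists_symbols_ne hact hty
  have hne := hemb.ne hb
  obtain ⟨ξt, hξt, hξt'⟩ := hξ b₀ b₁ hb htb
  obtain ⟨ζt, hζt, hζt'⟩ := exists_actionTests hact hty hO hζ
  obtain ⟨rt, -, hrt⟩ := exists_ratioParam hO hne htb (hre.natEstimableOn fun e _ => (hr e).1)
    (natEstimableOn_one _) (fun e _ => (hr e).1) (fun e _ => (hr e).2) fun _ _ => one_pos
  have hΓ' := hΓ.natEstimableOn fun t _ => discountNorm_nonneg hγ t
  -- Positivity of Γ_t is not decidable from the estimates, so the ratio is described only where the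
  -- denominator is positive.
  obtain ⟨ρt, hρt, hρt'⟩ := exists_ratioParam (D := {t | 0 < discountNorm γ t}) hO hne htb
    ((hΓ'.comp Computable.succ).mono (Set.subset_univ _)) (hΓ'.mono (Set.subset_univ _))
    (fun t _ => discountNorm_nonneg hγ _)
    (fun t _ => by rw [discountNorm_succ hγs t]; exact le_add_of_nonneg_left (hγ t)) fun _ ht => ht
  obtain ⟨c, hc⟩ := exists_valueMachine hne htb hγ hγs hζt hζt' hξt hξt'
    (fun e => by simpa using hrt e trivial) hρt hρt'
  choose q hq using hO
  obtain ⟨Q, hQ, hcomp⟩ := exists_comparison (A := A) (E := E) hne htb c hq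
  obtain ⟨π, hπ, hmax⟩ := exists_greedyPolicy hemb hact hty hQ hcomp
  -- The action value is Γ⁻¹·Γ·q rather than q. It is monotone in q and also covers Γ = 0, where all
  -- values are 0.
  refine ⟨π, hπ, fun h hh => ⟨_, fun a => (hc q hq h hh a).const_mul _, fun a ha a' => ?_⟩⟩
  have h0 := discountNorm_nonneg hγ h.length
  exact mul_le_mul_of_nonneg_left (mul_le_mul_of_nonneg_left (hmax h a ha a') h0) (inv_nonneg.2 h0)

end SelfAIXI

/-! ### Tests for the conditionals of environments -/

section Environments

variable {A E : Type*} [Primcodable A] [Fintype E] [Primcodable E] {ξ : Environment A E}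

/-- A conditional probability is estimable with values in [0,1] on the domain, so
`exists_ratioParam` with denominator 1 describes it by a single test. -/
theorem Environment.HasEstimableConditionals.exists_tests {S B I : Type*} [Primcodable S]
    [Finite S] [Primcodable B] [Fintype B] {emb : B → S} {ty : B → I} {O : Oracle S B}
    (h : ξ.HasEstimableConditionals) (hO : IsTypedReflective emb ty O) {b₀ b₁ : B}
    (hne : emb b₀ ≠ emb b₁) (hty : ty b₀ = ty b₁) :
    ∃ ξt : History A E × A × E → List (Test S B), Computable ξt ∧
      ∀ h ∈ ξ.dom, ∀ a e, Pass O (ξt (h, a, e)) (ξ.prob h a e) := by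
  have h0 : ∀ y ∈ {y : History A E × A × E | y.1 ∈ ξ.dom}, 0 ≤ ξ.prob y.1 y.2.1 y.2.2 :=
    fun y hy => ξ.nonneg y.1 hy _ _
  have h1 : ∀ y ∈ {y : History A E × A × E | y.1 ∈ ξ.dom}, ξ.prob y.1 y.2.1 y.2.2 ≤ 1 := by
    intro y hy
    rw [← ξ.sum_eq_one y.1 hy y.2.1]
    exact Finset.single_le_sum (f := ξ.prob y.1 y.2.1) (fun e _ => ξ.nonneg y.1 hy _ e)
      (Finset.mem_univ _)
  obtain ⟨t, ht, ht'⟩ := exists_ratioParam hO hne hty (h.natEstimableOn h0)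
    (natEstimableOn_one _) h0 h1 fun _ _ => one_pos
  refine ⟨fun y => [some (t y, true)], ?_, fun h hh a e => ?_⟩
  · exact Computable.list_cons.comp (Computable.option_some.comp (.pair ht (.const true)))
      (.const [])
  · simpa using (ht' (h, a, e) hh).pass true

theorem exists_tests_of_mem_reflEnvironments [Finite A] {S I : Type*} [Primcodable S] [Fintype S]
    {ty : S → I} {O : Oracle S S} {C : Coding A E S} (hξ : ξ ∈ reflEnvironments C ty O) :
    ∃ ξt : History A E × A × E → List (Test S S), Computable ξt ∧
      ∀ h ∈ ξ.dom, ∀ a e, Pass O (ξt (h, a, e)) (ξ.prob h a e) := by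
  obtain ⟨T, q, hq, hprob⟩ := hξ
  refine ⟨fun y => wordTests id T (C.hist y.1 ++ C.act y.2.1) (C.per y.2.2), ?_,
    fun h hh a e => ?_⟩
  · exact ((primrec_wordTests id C.per).comp (Primrec.pair (.const T) (.pair
      (Primrec.list_append.comp (C.primrec_hist.comp .fst)
        ((Primrec.dom_finite C.act).comp (Primrec.fst.comp .snd)))
      (Primrec.snd.comp .snd)))).to_comp
  · rw [hprob h hh, wordProb_eq_wordVal]
    exact pass_wordTests (fun x b => (hq x).isParam b) _ _

end Environments
end ReflOracle

open ReflOracle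
theorem mainTheorem10 {A E : Type*} [Fintype A] [Nonempty A] [Primcodable A]
    [Fintype E] [Nonempty E] [Primcodable E]
    (γ : ℕ → ℝ) (hγ : ∀ t, 0 ≤ γ t) (hγs : Summable γ)
    (hΓ : EstimableOn (discountNorm γ) Set.univ)
    (r : E → ℝ) (hr : ∀ e, r e ∈ Set.Icc (0 : ℝ) 1) (hre : EstimableOn r Set.univ) :
    (∀ O : Oracle (A ⊕ E) A, IsReflective Sum.inl O →
      ∀ (M : Set (Environment A E)) (ξ : Environment A E), IsDominantEnvironment M ξ →
        ξ.HasEstimableConditionals →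
        (∃ ζ, IsDominantPolicy (reflPolicies (Coding.single A E) O) ζ) ∧
        ∀ ζ, IsDominantPolicy (reflPolicies (Coding.single A E) O) ζ →
          ∃ πS ∈ reflPolicies (Coding.single A E) O, IsSelfAIXI γ r ζ ξ πS) ∧
    (∀ (S I : Type*) [Fintype S] [Primcodable S] (ty : S → I) (C : Coding A E S) (i j : I),
      (∀ a, ∀ s ∈ C.act a, ty s = i) → (∀ e, ∀ s ∈ C.per e, ty s = j) →
      ∀ O : Oracle S S, IsTypedReflective id ty O →
      ∀ ξ : Environment A E, IsDominantEnvironment (reflEnvironments C ty O) ξ →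
        (∃ ζ, IsDominantPolicy (reflPolicies C O) ζ) ∧
        ∀ ζ, IsDominantPolicy (reflPolicies C O) ζ →
          ∃ πS ∈ reflPolicies C O, IsSelfAIXI γ r ζ ξ πS) := by
  refine ⟨fun O hO M ξ _ hest => ?_, fun S I _ _ ty C i j hi _ O hO ξ hξ => ?_⟩
  -- The output alphabet is 𝒜 itself, embedded by `Sum.inl`. The untyped oracle is the typed one
  -- with the single type `()`.
  · have hact : ∀ a, (Coding.single A E).act a = [a].map Sum.inl := fun _ => rfl
    exact ⟨exists_dominantPolicy hO Sum.inl_injective hact (i := ()) (fun _ _ _ => rfl),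
      fun ζ hζ => exists_selfAIXI Sum.inl_injective hact (i := ()) (fun _ _ _ => rfl) hO hγ hγs hΓ
        hr hre (fun b₀ b₁ hb htb => hest.exists_tests hO (Sum.inl_injective.ne hb) htb) hζ.1⟩
  · have hact : ∀ a, C.act a = (C.act a).map id := fun a => (List.map_id _).symm
    exact ⟨exists_dominantPolicy hO Function.injective_id hact hi,
      fun ζ hζ => exists_selfAIXI Function.injective_id hact hi hO hγ hγs hΓ hr hre
        (fun _ _ _ _ => exists_tests_of_mem_reflEnvironments hξ.1) hζ.1⟩
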